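/- Let $n\ge 2$ agents be linked by an undirected connected graph. Let $W=(w_{ij})\in\mathbb{R}^{n\times n}$ be nonnegative, symmetric and stochastic ($W\mathbf 1=\mathbf 1$), where for $i\ne j$ the agents $i,j$ are linked if and only if $w_{ij}>0$. Let $\lambda_2$ be its second largest eigenvalue (with multiplicity). Let $f_1,\dots,f_n:\mathbb{R}^p\to\mathbb{R}$ be differentiable with $L$-Lipschitz gradients and $f_i\ge \underline f_i$, and put $f=\frac1n\sum_i f_i$, $f^{\inf}=\frac1n\sum_i\underline f_i$. Let $\mathcal C:\mathbb{R}^p\to\mathbb{R}^p$ be a randomized operator with $\mathbb E[\mathcal C(x)]=x$ and $\mathbb E\|\mathcal C(x)-x\|^2\le C\|x\|^2$ for all $x$, where $C>0$. CEDAS with constant stepsize $\eta$ and parameters $\gamma,\alpha$ starts from deterministic $x_{i,-1},h_{i,0}\in\mathbb{R}^p$ and sets $d_{i,0}=0$, $(h_w)_{i,0}=\sum_j w_{ij}h_{j,0}$, $x_{i,0}=x_{i,-1}-\eta g_{i,-1}$. For $k=0,\dots,K-1$, $$y_{i,k}=x_{i,k}-\eta g_{i,k}-d_{i,k},\quad q_{i,k}=\mathcal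 C(y_{i,k}-h_{i,k}),\quad \hat y_{i,k}=h_{i,k}+q_{i,k},\quad (\hat y_w)_{i,k}=(h_w)_{i,k}+\sum_j w_{ij}q_{j,k},$$ $$h_{i,k+1}=(1-\alpha)h_{i,k}+\alpha\hat y_{i,k},\qquad (h_w)_{i,k+1}=(1-\alpha)(h_w)_{i,k}+\alpha(\hat y_w)_{i,k},$$ $$d_{i,k+1}=d_{i,k}+\tfrac{\gamma}{2}\big(\hat y_{i,k}-(\hat y_w)_{i,k}\big),\qquad x_{i,k+1}=x_{i,k}-\eta g_{i,k}-d_{i,k+1}.$$ Here $g_{i,k}=\nabla f_i(x_{i,k};\xi_{i,k})$ is a stochastic gradient with $\mathbb E[g_{i,k}\mid x_{i,k}]=\nabla f_i(x_{i,k})$ and $\mathbb E[\|g_{i,k}-\nabla f_i(x_{i,k})\|^2\mid x_{i,k}]\le\sigma^2$, $\sigma>0$. The samples $\xi_{i,k}$ are independent across agents and iterations, and the randomness of the compressor is drawn afresh at every iteration, independently of them. Put $\bar x_k=\frac1n\sum_i x_{i,k}$, $\|\mathbf x_{-1}\|^2=\sum_i\|x_{i,-1}\|^2$, $\|H_0\|^2=\sum_i\|h_{i,0}\|^2$,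 $\|\nabla F(\mathbf x_{-1})\|^2=\sum_i\|\nabla f_i(x_{i,-1})\|^2$ and $\tilde\lambda_2=1-\frac{\gamma}{2}(1-\lambda_2)$. Suppose $$0<\alpha\le\min\Big\{1,\frac1{12C}\Big\},\quad 0<\gamma\le\min\Big\{\frac{\sqrt\alpha}{2\sqrt C},\frac12,\frac{\alpha^2(1-\lambda_2)}{1728C}\Big\},\quad \eta=\sqrt{\frac nK},\quad K\ge\max\Big\{\frac{12L^2n}{\alpha},\frac{256nL^2}{\gamma^2(1-\lambda_2)^2}\Big\},\ K\ge1.$$ Then the expectations below are finite and $$\frac1K\sum_{k=-1}^{K-1}\mathbb E\big[\|\nabla f(\bar x_k)\|^2\big]\le M\left(\frac1{\sqrt{nK}}+\frac{n}{(1-\tilde\lambda_2)K}+\frac{\|\mathbf x_{-1}\|^2+\|H_0\|^2}{n(1-\tilde\lambda_2)K}+\frac{\|\nabla F(\mathbf x_{-1})\|^2}{(1-\tilde\lambda_2)^2K^2}\right),$$ where the constant $M$ depends only on $L$, $\sigma$ and an upper bound $\Delta$ of $f(\bar x_{-1})-f^{\inf}$. -/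

import Mathlib

open MeasureTheory ProbabilityTheory

noncomputable section

namespace CEDAS

/-- The decision space `ℝ^p` with the Euclidean norm. -/
abbrev Vec (p : ℕ) : Type := EuclideanSpace ℝ (Fin p)

/-! ### Network and mixing matrix -/

/-- `W` is a mixing matrix compliant with the undirected connected graph `G` on the `n` agents:
it is nonnegative, symmetric and stochastic, and for `i ≠ j` the agents `i` and `j` are linked
exactly when `w_ij > 0` (hence `w_ij = 0` when they are not linked). -/
structure IsMixingMatrix {n : ℕ} (G : SimpleGraph (Fin n)) (W : Matrix (Fin n) (Fin n) ℝ) :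
    Prop where
  connected : G.Connected
  adj_iff : ∀ i j, i ≠ j → (G.Adj i j ↔ 0 < W i j)
  nonneg : ∀ i j, 0 ≤ W i j
  symm : W.IsSymm
  stochastic : ∀ i, ∑ j, W i j = 1

theorem IsMixingMatrix.isHermitian {n : ℕ} {G : SimpleGraph (Fin n)}
    {W : Matrix (Fin n) (Fin n) ℝ} (hW : IsMixingMatrix G W) : W.IsHermitian := by
  unfold Matrix.IsHermitian
  rw [Matrix.conjTranspose_eq_transpose_of_trivial]
  exact hW.symm

/-- The second largest eigenvalue `λ₂` of `W`, where `λ₁ ≥ λ₂ ≥ ⋯ ≥ λₙ` are the eigenvalues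
counted with multiplicity (`eigenvalues₀` lists them in decreasing order). -/
def IsMixingMatrix.lambda₂ {n : ℕ} {G : SimpleGraph (Fin n)}
    {W : Matrix (Fin n) (Fin n) ℝ} (hW : IsMixingMatrix G W) (hn : 2 ≤ n) : ℝ :=
  hW.isHermitian.eigenvalues₀ ⟨1, by rw [Fintype.card_fin]; omega⟩

/-- `λ̃₂ = 1 - (γ / 2) (1 - λ₂)`, the second largest eigenvalue of `I - (γ / 2) (I - W)`. -/
def IsMixingMatrix.tlambda₂ {n : ℕ} {G : SimpleGraph (Fin n)}
    {W : Matrix (Fin n) (Fin n) ℝ} (hW : IsMixingMatrix G W) (hn : 2 ≤ n) (γ : ℝ) : ℝ :=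
  1 - γ / 2 * (1 - hW.lambda₂ hn)

/-! ### Objective functions -/

/-- The average objective `f = (1/n) ∑ fᵢ`. -/
def avgObjective {n p : ℕ} (f : Fin n → Vec p → ℝ) (x : Vec p) : ℝ :=
  (1 / (n : ℝ)) * ∑ i, f i x

/-- Each `fᵢ` has an `L`-Lipschitz continuous gradient and is bounded from below by `fLow i`. -/
structure IsSmoothBddBelow {n p : ℕ} (f : Fin n → Vec p → ℝ) (L : ℝ) (fLow : Fin n → ℝ) :
    Prop where
  differentiable : ∀ i, Differentiable ℝ (f i)
  lipschitz : ∀ i x x', ‖gradient (f i) x - gradient (f i) x'‖ ≤ L * ‖x - x'‖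
  lower : ∀ i x, fLow i ≤ f i x

/-- The average (over the agents) of a stacked vector. -/
def mean {n p : ℕ} (x : Fin n → Vec p) : Vec p := (1 / (n : ℝ)) • ∑ i, x i

/-- The squared (Frobenius) norm of a stacked vector. -/
def sqNorm {n p : ℕ} (x : Fin n → Vec p) : ℝ := ∑ i, ‖x i‖ ^ 2

/-! ### Compression operators -/

/-- A randomized operator `comp` on `ℝ^p`, whose random seed has law `ν`, is an unbiased
compressor with parameter `C`: `𝔼[comp x] = x` and `𝔼 ‖comp x - x‖² ≤ C ‖x‖²` for all `x`. -/
structure IsUnbiasedCompressor {p : ℕ} {R : Type*} [MeasurableSpace R]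
    (comp : Vec p → R → Vec p) (ν : Measure R) (C : ℝ) : Prop where
  measurable : Measurable (Function.uncurry comp)
  memLp : ∀ x, MemLp (comp x) 2 ν
  unbiased : ∀ x, ∫ r, comp x r ∂ν = x
  variance : ∀ x, ∫ r, ‖comp x r - x‖ ^ 2 ∂ν ≤ C * ‖x‖ ^ 2

/-! ### The algorithm

Everything is defined along one realization `s` of the gradient samples and `r` of the seeds of
the compressor. The algorithm starts at iteration `-1`, so gradient samples are indexed with a
shift: `s t i` is the sample that agent `i` uses at iteration `t - 1`. The seed that agent `i` uses
in its compression at iteration `k ≥ 0` is `r k i`. -/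

section Algorithm

/-- The output of the communication procedure. -/
structure CommOutput (n p : ℕ) where
  yhat : Fin n → Vec p
  yhatw : Fin n → Vec p
  h : Fin n → Vec p
  hw : Fin n → Vec p

/-- The communication procedure: agent `i` sends only `q i = comp (y i - h i)`. Summing over all `j`
is the same as summing over `i` and its neighbours, because `W i j = 0` for the other `j`. -/
def communicate {n p : ℕ} {R : Type*} (W : Matrix (Fin n) (Fin n) ℝ) (comp : Vec p → R → Vec p)
    (α : ℝ) (y h hw : Fin n → Vec p) (r : Fin n → R) : CommOutput n p :=
  let q : Fin n → Vec p := fun i => comp (y i - h i) (r i)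
  let yhat : Fin n → Vec p := fun i => h i + q i
  let yhatw : Fin n → Vec p := fun i => hw i + ∑ j, W i j • q j
  { yhat := yhat
    yhatw := yhatw
    h := fun i => (1 - α) • h i + α • yhat i
    hw := fun i => (1 - α) • hw i + α • yhatw i }

/-- The variables kept by the agents at the beginning of an iteration `k ≥ 0`. -/
structure State (n p : ℕ) where
  x : Fin n → Vec p
  d : Fin n → Vec p
  h : Fin n → Vec p
  hw : Fin n → Vec p

/-- The initialization: it produces the variables at `k = 0` from `x_{-1}` and `h_0`. -/
def initState {n p : ℕ} {Ξ : Type*} (W : Matrix (Fin n) (Fin n) ℝ)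
    (g : Fin n → Vec p → Ξ → Vec p) (η : ℝ) (xinit hinit : Fin n → Vec p)
    (s : Fin n → Ξ) : State n p where
  x := fun i => xinit i - η • g i (xinit i) (s i)
  d := fun _ => 0
  h := hinit
  hw := fun i => ∑ j, W i j • hinit j

/-- One iteration of CEDAS with stepsize `η`. -/
def step {n p : ℕ} {Ξ R : Type*} (W : Matrix (Fin n) (Fin n) ℝ)
    (g : Fin n → Vec p → Ξ → Vec p) (comp : Vec p → R → Vec p) (η γ α : ℝ)
    (S : State n p) (s : Fin n → Ξ) (r : Fin n → R) : State n p :=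
  let y : Fin n → Vec p := fun i => S.x i - η • g i (S.x i) (s i) - S.d i
  let c := communicate W comp α y S.h S.hw r
  let d' : Fin n → Vec p := fun i => S.d i + (γ / 2) • (c.yhat i - c.yhatw i)
  { x := fun i => S.x i - η • g i (S.x i) (s i) - d' i
    d := d'
    h := c.h
    hw := c.hw }

/-- The variables at the beginning of iteration `k`. -/
def state {n p : ℕ} {Ξ R : Type*} (W : Matrix (Fin n) (Fin n) ℝ)
    (g : Fin n → Vec p → Ξ → Vec p) (comp : Vec p → R → Vec p) (η γ α : ℝ)
    (xinit hinit : Fin n → Vec p) (s : ℕ → Fin n → Ξ) (r : ℕ → Fin n → R) : ℕ → State n p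
  | 0 => initState W g η xinit hinit (s 0)
  | k + 1 => step W g comp η γ α
      (state W g comp η γ α xinit hinit s r k) (s (k + 1)) (r k)

/-- The iterates, with a shift of the index by one: `iterate … t i` is `x_{i,t-1}`. -/
def iterate {n p : ℕ} {Ξ R : Type*} (W : Matrix (Fin n) (Fin n) ℝ)
    (g : Fin n → Vec p → Ξ → Vec p) (comp : Vec p → R → Vec p) (η γ α : ℝ)
    (xinit hinit : Fin n → Vec p) (s : ℕ → Fin n → Ξ) (r : ℕ → Fin n → R) :
    ℕ → Fin n → Vec p
  | 0 => xinit
  | k + 1 => (state W g comp η γ α xinit hinit s r k).x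

end Algorithm

/-! ### Randomness -/

/-- The randomness of a run. The gradient samples `ξ t i` are independent (across agents and
iterations), and the compression seeds `ρ k i` all have law `ν` and are drawn afresh at every
iteration, independently of the gradient samples. Nothing is assumed on the joint law of the seeds of
different agents at one iteration. -/
structure IsFreshRandomness {n : ℕ} {Ω Ξ R : Type*} [MeasurableSpace Ω] [MeasurableSpace Ξ]
    [MeasurableSpace R] (μ : Measure Ω) (ν : Measure R)
    (ξ : ℕ → Fin n → Ω → Ξ) (ρ : ℕ → Fin n → Ω → R) : Prop where
  measurable_sample : ∀ t i, Measurable (ξ t i)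
  measurable_seed : ∀ k i, Measurable (ρ k i)
  law_seed : ∀ k i, μ.map (ρ k i) = ν
  indep_sample : iIndepFun (fun (a : ℕ × Fin n) (ω : Ω) => ξ a.1 a.2 ω) μ
  indep_seed : iIndepFun (fun (k : ℕ) (ω : Ω) (i : Fin n) => ρ k i ω) μ
  indep_sample_seed :
    IndepFun (fun (ω : Ω) (t : ℕ) (i : Fin n) => ξ t i ω)
      (fun (ω : Ω) (k : ℕ) (i : Fin n) => ρ k i ω) μ

/-- The stochastic gradients `g i (x t i) (ξ t i)` are unbiased given the point `x t i` at which
they are evaluated, with conditional variance at most `σ²`. -/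
structure IsStochasticGradient {n p : ℕ} {Ω Ξ : Type*} [MeasurableSpace Ω] [MeasurableSpace Ξ]
    (μ : Measure Ω) (f : Fin n → Vec p → ℝ) (g : Fin n → Vec p → Ξ → Vec p)
    (ξ : ℕ → Fin n → Ω → Ξ) (x : ℕ → Fin n → Ω → Vec p) (σ : ℝ) : Prop where
  measurable : ∀ i, Measurable (Function.uncurry (g i))
  memLp : ∀ t i,
    MemLp (fun ω => g i (x t i ω) (ξ t i ω) - gradient (f i) (x t i ω)) 2 μ
  unbiased : ∀ t i,
    μ[fun ω => g i (x t i ω) (ξ t i ω) | MeasurableSpace.comap (x t i) inferInstance]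
      =ᵐ[μ] fun ω => gradient (f i) (x t i ω)
  variance : ∀ t i,
    μ[fun ω => ‖g i (x t i ω) (ξ t i ω) - gradient (f i) (x t i ω)‖ ^ 2 |
        MeasurableSpace.comap (x t i) inferInstance]
      ≤ᵐ[μ] fun _ => σ ^ 2

end CEDAS

end

/-! The proof takes place in the space `SqInt μ p` of square-integrable random vectors with the
inner product `𝔼⟨X, Y⟩`. There, freshness of randomness becomes orthogonality to submodules of
measurable vectors, and the deterministic estimates can be proved once in an abstract inner product
space.

Let e be the compression error and y the vector being communicated. The invariant h_w = W h
(`state_hw`) reduces one iteration to x⁺ = y - 𝓛y - 𝓛e, d⁺ = d + 𝓛y + 𝓛e, h⁺ = h + α(y - h) + αe,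
where 𝓛 = (γ/2)(I - W) is `laplace`. Since 𝓛 annihilates the consensus direction, the average of the
iterates follows plain SGD (`avg_iterL_succ`), free of d and e. The descent lemma then bounds the
squared gradients by the initial gap, the variance σ²/n and the disagreement of the iterates
(`meanObjective_succ_le`).

The disagreement is handled mode by mode in an eigenbasis of W. For a mode with eigenvalue b of 𝓛,
let X be the component of x and U that of d + η∇F(x̄). Without perturbations the step is X ↦
(1-b)(X-U), U ↦ U + b(X-U), and ‖X‖² + ((1-b)/b)‖U‖² shrinks by exactly 1 - b
(`energy_contraction`). Gradient disagreement, noise, gradient drift and compression error are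
perturbations (`mode_energy_step`, `energy_step`). The compression error has variance at most C‖y -
h‖², so the tracking error ‖x - h‖² must decay as well (`tracking_step`). Adding it with weight
4γC/α gives a Lyapunov function whose one-step decrease controls the disagreement, up to small
multiples of the squared gradient and the noise (`lyapunov_arith`, `lyapunov_succ_le`).

Both recursions are telescoped (`sum_gradient_le`, `sum_energy_le`). Substituting one in the other
returns the gradient sum with a coefficient at most 1/2, because the lower bound on K makes ηL at
most b/8 for the smallest nonzero eigenvalue b; this part is absorbed and η = √(n/K) gives the rate
(`rate_arith`). -/

namespace CEDAS

/-! ### Inequalities in an inner product space and the contraction of a single mode. -/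

section Hilbert

variable {E : Type*} [SeminormedAddCommGroup E]

theorem norm_add_sq_le_young (x y : E) {θ : ℝ} (hθ : 0 < θ) :
    ‖x + y‖ ^ 2 ≤ (1 + θ) * ‖x‖ ^ 2 + (1 + 1 / θ) * ‖y‖ ^ 2 := by
  have h1 := norm_add_le x y
  have h2 : ‖x + y‖ ^ 2 ≤ (‖x‖ + ‖y‖) ^ 2 := by gcongr
  have h3 : (1 + θ) * ‖x‖ ^ 2 + (1 + 1 / θ) * ‖y‖ ^ 2 - (‖x‖ + ‖y‖) ^ 2
      = (θ * ‖x‖ - ‖y‖) ^ 2 / θ := by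
    field_simp
    ring
  have h4 : 0 ≤ (θ * ‖x‖ - ‖y‖) ^ 2 / θ := by positivity
  linarith

theorem norm_sub_sq_le_young (x y : E) {θ : ℝ} (hθ : 0 < θ) :
    ‖x - y‖ ^ 2 ≤ (1 + θ) * ‖x‖ ^ 2 + (1 + 1 / θ) * ‖y‖ ^ 2 := by
  simpa [sub_eq_add_neg] using norm_add_sq_le_young x (-y) hθ

theorem norm_add_sq_le_two (x y : E) : ‖x + y‖ ^ 2 ≤ 2 * ‖x‖ ^ 2 + 2 * ‖y‖ ^ 2 := by
  have h := norm_add_sq_le_young x y one_pos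
  norm_num at h
  exact h

theorem norm_sub_sq_le_two (x y : E) : ‖x - y‖ ^ 2 ≤ 2 * ‖x‖ ^ 2 + 2 * ‖y‖ ^ 2 := by
  simpa [sub_eq_add_neg] using norm_add_sq_le_two x (-y)

theorem norm_add_three_sq_le (x y z : E) :
    ‖x + y + z‖ ^ 2 ≤ 3 * ‖x‖ ^ 2 + 3 * ‖y‖ ^ 2 + 3 * ‖z‖ ^ 2 := by
  have h1 := norm_add₃_le (a := x) (b := y) (c := z)
  have h2 : ‖x + y + z‖ ^ 2 ≤ (‖x‖ + ‖y‖ + ‖z‖) ^ 2 := by gcongr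
  nlinarith [sq_nonneg (‖x‖ - ‖y‖), sq_nonneg (‖x‖ - ‖z‖), sq_nonneg (‖y‖ - ‖z‖)]

variable [InnerProductSpace ℝ E]

open scoped RealInnerProductSpace

/-- This is Young's inequality with θ = α/(1-α). Writing the deficit as a square avoids that
quotient, so α = 1 is allowed. -/
theorem norm_convex_comb_sq_le (x y : E) {α : ℝ} (h0 : 0 < α) (h1 : α ≤ 1) :
    ‖(1 - α) • x + y‖ ^ 2 ≤ (1 - α) * ‖x‖ ^ 2 + 1 / α * ‖y‖ ^ 2 := by
  have h2 := norm_add_le ((1 - α) • x) y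
  rw [norm_smul, Real.norm_of_nonneg (by linarith)] at h2
  have h3 : ‖(1 - α) • x + y‖ ^ 2 ≤ ((1 - α) * ‖x‖ + ‖y‖) ^ 2 := by gcongr
  have h4 : (1 - α) * ‖x‖ ^ 2 + 1 / α * ‖y‖ ^ 2 - ((1 - α) * ‖x‖ + ‖y‖) ^ 2
      = (1 - α) * (α * ‖x‖ - ‖y‖) ^ 2 / α := by
    field_simp
    ring
  have h5 : 0 ≤ (1 - α) * (α * ‖x‖ - ‖y‖) ^ 2 / α :=
    div_nonneg (mul_nonneg (by linarith) (sq_nonneg _)) h0.le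
  linarith

theorem norm_smul_sq (c : ℝ) (x : E) : ‖c • x‖ ^ 2 = c ^ 2 * ‖x‖ ^ 2 := by
  rw [norm_smul, mul_pow, Real.norm_eq_abs, sq_abs]

theorem norm_add_sq_of_inner_eq_zero {x y : E} (h : ⟪x, y⟫ = 0) :
    ‖x + y‖ ^ 2 = ‖x‖ ^ 2 + ‖y‖ ^ 2 := by
  rw [norm_add_sq_real, h]; ring

theorem norm_sub_sq_of_inner_eq_zero {x y : E} (h : ⟪x, y⟫ = 0) :
    ‖x - y‖ ^ 2 = ‖x‖ ^ 2 + ‖y‖ ^ 2 := by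
  rw [norm_sub_sq_real, h]; ring

/-- The noiseless primal-dual step contracts the weighted energy exactly by `1 - b`. -/
theorem energy_contraction (X U : E) {b : ℝ} (hb : 0 < b) :
    ‖(1 - b) • (X - U)‖ ^ 2 + (1 - b) / b * ‖U + b • (X - U)‖ ^ 2
      = (1 - b) * (‖X‖ ^ 2 + (1 - b) / b * ‖U‖ ^ 2) := by
  have e : U + b • (X - U) = (1 - b) • U + b • X := by module
  -- The weight (1-b)/b is chosen so that the cross terms ∓2(1-b)²⟨X, U⟩ cancel.
  rw [e, norm_add_sq_real, norm_smul, norm_smul, norm_smul, inner_smul_left, inner_smul_right,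
    mul_pow, mul_pow, mul_pow, norm_sub_sq_real X U, Real.norm_eq_abs, Real.norm_eq_abs, sq_abs,
    sq_abs, real_inner_comm X U]
  simp only [conj_trivial]
  field_simp
  ring

/-- Scalar bookkeeping for `mode_energy_step`, with every letter except b and b₀ a squared norm. Two
uses of Young's inequality with θ = b₀/4, one for the drift and one for the gradient disagreement,
spoil the exact factor 1 - b only to (1 + b₀/4)²(1 - b₀) ≤ 1 - b₀/2, uniformly over the modes. -/
theorem mode_energy_arith {b b₀ a z X U d p q r s : ℝ} (hb₀ : 0 < b₀) (hb : b₀ ≤ b) (hb1 : b < 1)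
    (ha : 0 ≤ a) (hz : 0 ≤ z) (hX : 0 ≤ X) (hU : 0 ≤ U) (hd : 0 ≤ d) (hp : 0 ≤ p)
    (h3 : q ≤ (1 + b₀ / 4) * r + (1 + b₀ / 4) * (4 / b₀) * d)
    (h4 : p + (1 - b) / b * r = (1 - b) * (s + z + (1 - b) / b * U))
    (h6 : s ≤ (1 + b₀ / 4) * X + (1 + b₀ / 4) * (4 / b₀) * a) :
    p + (1 - b) / b * q ≤ (1 - b₀ / 2) * (X + (1 - b) / b * U) + 4 / b₀ * a + z
      + 4 / b₀ ^ 2 * d := by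
  have hb' : 0 < b := hb₀.trans_le hb
  set w := (1 - b) / b with hw
  have hw0 : 0 ≤ w := div_nonneg (by linarith) hb'.le
  have c1 : (1 + b₀ / 4) * (1 - b) ≤ 1 := by nlinarith
  have c2 : (1 + b₀ / 4) ^ 2 * (1 - b) ≤ 1 - b₀ / 2 := by
    have : (1 + b₀ / 4) ^ 2 * (1 - b) ≤ (1 + b₀ / 4) ^ 2 * (1 - b₀) := by gcongr
    nlinarith [pow_pos hb₀ 3, pow_pos hb₀ 2]
  have c3 : (1 + b₀ / 4) * w ≤ 1 / b₀ := by
    rw [hw, ← mul_div_assoc, div_le_div_iff₀ hb' hb₀]; nlinarith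
  have c4 : (1 + b₀ / 4) ^ 2 * (1 - b) ≤ 1 := by linarith
  have A1 : w * q ≤ (1 + b₀ / 4) * (w * r) + 4 / b₀ ^ 2 * d := by
    have e1 : 4 / b₀ ^ 2 * d = 1 / b₀ * (4 / b₀ * d) := by field_simp
    have e2 : (1 + b₀ / 4) * w * (4 / b₀ * d) ≤ 1 / b₀ * (4 / b₀ * d) := by gcongr
    have e3 := mul_le_mul_of_nonneg_left h3 hw0
    rw [e1]
    linarith
  have s0 : 0 ≤ (1 + b₀ / 4) * (1 - b) := mul_nonneg (by positivity) (by linarith)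
  have s1 : (1 + b₀ / 4) * (1 - b) * s ≤ (1 - b₀ / 2) * X + 4 / b₀ * a := by
    have e1 := mul_le_mul_of_nonneg_left h6 s0
    have e2 : (1 + b₀ / 4) ^ 2 * (1 - b) * X ≤ (1 - b₀ / 2) * X := by gcongr
    have e3 : (1 + b₀ / 4) ^ 2 * (1 - b) * (4 / b₀ * a) ≤ 1 * (4 / b₀ * a) := by gcongr
    linarith
  have s2 : (1 + b₀ / 4) * (1 - b) * z ≤ 1 * z := by gcongr
  have s3 : (1 + b₀ / 4) * (1 - b) * (w * U) ≤ (1 - b₀ / 2) * (w * U) := by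
    gcongr; nlinarith
  have A4 : p ≤ (1 + b₀ / 4) * p := by nlinarith
  have A5 : (1 + b₀ / 4) * (p + w * r) = (1 + b₀ / 4) * ((1 - b) * (s + z + w * U)) := by rw [h4]
  linarith

/-- One step of the algorithm for a single eigenmode with eigenvalue `b`: `X` is the primal
variable, `U` the shifted dual one, `a` the gradient disagreement, `z` the gradient noise, `dl` the
drift of the gradients and `e` the compression error. -/
theorem mode_energy_step (X U a z dl e : E) {b b₀ : ℝ} (hb₀ : 0 < b₀) (hb : b₀ ≤ b) (hb1 : b < 1)
    (hz : ⟪X - a, z⟫ = 0) (he : ⟪X - U - a - z, e⟫ = 0) (heU : ⟪U, e⟫ = 0) (hed : ⟪dl, e⟫ = 0) :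
    ‖(1 - b) • (X - U - a - z) - b • e‖ ^ 2
        + (1 - b) / b * ‖U + b • (X - U - a - z) + b • e + dl‖ ^ 2
      ≤ (1 - b₀ / 2) * (‖X‖ ^ 2 + (1 - b) / b * ‖U‖ ^ 2) + 4 / b₀ * ‖a‖ ^ 2 + ‖z‖ ^ 2
        + 4 / b₀ ^ 2 * ‖dl‖ ^ 2 + b * ‖e‖ ^ 2 := by
  have hb' : 0 < b := hb₀.trans_le hb
  set Y := X - U - a - z with hY
  set w := (1 - b) / b with hw
  have hw0 : 0 ≤ w := div_nonneg (by linarith) hb'.le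
  have hwb : w * b = 1 - b := by rw [hw]; field_simp
  have h1 : ‖(1 - b) • Y - b • e‖ ^ 2 = ‖(1 - b) • Y‖ ^ 2 + b ^ 2 * ‖e‖ ^ 2 := by
    rw [norm_sub_sq_of_inner_eq_zero, norm_smul b e, mul_pow, Real.norm_eq_abs, sq_abs]
    rw [inner_smul_left, inner_smul_right, he]; simp
  have h2 : ‖U + b • Y + b • e + dl‖ ^ 2 = ‖U + b • Y + dl‖ ^ 2 + b ^ 2 * ‖e‖ ^ 2 := by
    have : U + b • Y + b • e + dl = (U + b • Y + dl) + b • e := by abel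
    rw [this, norm_add_sq_of_inner_eq_zero, norm_smul b e, mul_pow, Real.norm_eq_abs, sq_abs]
    rw [inner_add_left, inner_add_left, inner_smul_right, inner_smul_left, inner_smul_right,
      inner_smul_right, he, heU, hed]; simp
  have h3 := norm_add_sq_le_young (U + b • Y) dl (θ := b₀ / 4) (by positivity)
  have h4 := energy_contraction (X - a - z) U hb'
  have h5 : X - a - z - U = Y := by rw [hY]; abel
  -- The noise is orthogonal to X - a, so it enters additively and costs no Young factor.
  rw [h5, ← hw, norm_sub_sq_of_inner_eq_zero hz] at h4
  have h6 := norm_sub_sq_le_young X a (θ := b₀ / 4) (by positivity)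
  have h7 : (0 : ℝ) ≤ ‖(1 - b) • Y‖ ^ 2 := by positivity
  have hθ : 1 + 1 / (b₀ / 4) = (1 + b₀ / 4) * (4 / b₀) := by field_simp; ring
  rw [hθ] at h3 h6
  rw [h1, h2]
  have key := mode_energy_arith hb₀ hb hb1 (sq_nonneg ‖a‖) (sq_nonneg ‖z‖) (sq_nonneg ‖X‖)
    (sq_nonneg ‖U‖) (sq_nonneg ‖dl‖) h7 h3 h4 h6
  -- The error enters the primal and the dual part with coefficient b², and b²(1 + w) = b.
  have A3 : b ^ 2 * ‖e‖ ^ 2 + w * (b ^ 2 * ‖e‖ ^ 2) = b * ‖e‖ ^ 2 := by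
    have : b ^ 2 * ‖e‖ ^ 2 + w * (b ^ 2 * ‖e‖ ^ 2) = b * (b + w * b) * ‖e‖ ^ 2 := by ring
    rw [this, hwb]; ring
  rw [← hw] at key
  linarith

end Hilbert

/-! ### Eigenmodes of the mixing matrix acting on stacked vectors. -/

section Modes

variable {E : Type*} [SeminormedAddCommGroup E] [InnerProductSpace ℝ E] {n : ℕ}

open scoped RealInnerProductSpace

/-- The rows of `O` form an orthonormal eigenbasis of `W`; the row `j₀` spans the consensus
direction and the other rows have eigenvalues in `[-1, lam₂]`. -/
structure IsModeBasis (W O : Matrix (Fin n) (Fin n) ℝ) (lam : Fin n → ℝ) (j₀ : Fin n)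
    (lam₂ : ℝ) : Prop where
  orth : ∀ i k, ∑ j, O j i * O j k = if i = k then 1 else 0
  eig : ∀ j k, ∑ i, O j i * W i k = lam j * O j k
  eig_zero : lam j₀ = 1
  sum_zero : ∀ j ≠ j₀, ∑ i, O j i = 0
  le_lam₂ : ∀ j ≠ j₀, lam j ≤ lam₂
  neg_one_le : ∀ j, -1 ≤ lam j

/-- The component of a stacked vector along `a`. -/
def mode (a : Fin n → ℝ) : (Fin n → E) →ₗ[ℝ] E := ∑ i, a i • LinearMap.proj i

theorem mode_apply (a : Fin n → ℝ) (x : Fin n → E) : mode a x = ∑ i, a i • x i := by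
  simp [mode]

/-- The average of a stacked vector, as a linear map. -/
noncomputable def avg : (Fin n → E) →ₗ[ℝ] E := mode fun _ => 1 / (n : ℝ)

theorem avg_apply (x : Fin n → E) : avg x = (1 / (n : ℝ)) • ∑ i, x i := by
  rw [avg, mode_apply, Finset.smul_sum]

/-- `(γ / 2) (I - W)` acting on stacked vectors. -/
noncomputable def laplace (W : Matrix (Fin n) (Fin n) ℝ) (γ : ℝ) (x : Fin n → E) : Fin n → E :=
  fun i => (γ / 2) • (x i - ∑ k, W i k • x k)

theorem mode_mem {S : Submodule ℝ E} (a : Fin n → ℝ) {x : Fin n → E} (hx : ∀ i, x i ∈ S) :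
    mode a x ∈ S := by
  rw [mode_apply]
  exact S.sum_mem fun i _ => S.smul_mem _ (hx i)

theorem inner_mode_eq_zero (a : Fin n → ℝ) {s : E} {x : Fin n → E} (hx : ∀ i, ⟪s, x i⟫ = 0) :
    ⟪s, mode a x⟫ = 0 := by
  rw [mode_apply, inner_sum]
  exact Finset.sum_eq_zero fun i _ => by rw [inner_smul_right, hx i, mul_zero]

theorem laplace_mem {S : Submodule ℝ E} (W : Matrix (Fin n) (Fin n) ℝ) (γ : ℝ) {x : Fin n → E}
    (hx : ∀ i, x i ∈ S) (i : Fin n) : laplace W γ x i ∈ S :=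
  S.smul_mem _ (S.sub_mem (hx i) (S.sum_mem fun k _ => S.smul_mem _ (hx k)))

theorem inner_laplace_eq_zero (W : Matrix (Fin n) (Fin n) ℝ) (γ : ℝ) {s : E} {x : Fin n → E}
    (hx : ∀ i, ⟪s, x i⟫ = 0) (i : Fin n) : ⟪s, laplace W γ x i⟫ = 0 := by
  rw [laplace, inner_smul_right, inner_sub_right, inner_sum, hx i]
  simp [inner_smul_right, hx]

theorem norm_avg_sq_le (x : Fin n → E) : n * ‖avg x‖ ^ 2 ≤ ∑ i, ‖x i‖ ^ 2 := by
  rcases Nat.eq_zero_or_pos n with rfl | hn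
  · simp
  have hn' : (0 : ℝ) < n := by exact_mod_cast hn
  have h1 : ‖∑ i, x i‖ ^ 2 ≤ (∑ i, ‖x i‖) ^ 2 := by
    gcongr; exact norm_sum_le _ _
  have h2 := sq_sum_le_card_mul_sum_sq (s := (Finset.univ : Finset (Fin n))) (f := fun i => ‖x i‖)
  simp only [Finset.card_univ, Fintype.card_fin] at h2
  rw [avg_apply, norm_smul, mul_pow, Real.norm_of_nonneg (by positivity)]
  have : (n : ℝ) * ((1 / (n : ℝ)) ^ 2 * ‖∑ i, x i‖ ^ 2) = (1 / (n : ℝ)) * ‖∑ i, x i‖ ^ 2 := by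
    field_simp
  rw [this, one_div, inv_mul_le_iff₀ hn']
  exact h1.trans h2

namespace IsModeBasis

variable {W O : Matrix (Fin n) (Fin n) ℝ} {lam : Fin n → ℝ} {j₀ : Fin n} {lam₂ : ℝ}

/-- Expanding the squares produces the Gram coefficients of the columns of O; this is why `orth` is
stated for columns. -/
theorem parseval (hB : IsModeBasis W O lam j₀ lam₂) (x : Fin n → E) :
    ∑ j, ‖mode (O j) x‖ ^ 2 = ∑ i, ‖x i‖ ^ 2 := by
  have h1 : ∀ j, ‖mode (O j) x‖ ^ 2 = ∑ i, ∑ k, (O j i * O j k) * ⟪x i, x k⟫ := fun j => by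
    rw [← real_inner_self_eq_norm_sq, mode_apply, sum_inner]
    refine Finset.sum_congr rfl fun i _ => ?_
    rw [inner_sum]
    refine Finset.sum_congr rfl fun k _ => ?_
    rw [inner_smul_left, inner_smul_right]
    simp only [conj_trivial]; ring
  simp_rw [h1]
  rw [Finset.sum_comm]
  refine Finset.sum_congr rfl fun i _ => ?_
  rw [Finset.sum_comm]
  simp_rw [← Finset.sum_mul, hB.orth]
  simp

theorem mode_laplace (hB : IsModeBasis W O lam j₀ lam₂) (γ : ℝ) (x : Fin n → E) (j : Fin n) :
    mode (O j) (laplace W γ x) = (γ / 2 * (1 - lam j)) • mode (O j) x := by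
  have h1 : mode (O j) (fun i => ∑ k, W i k • x k) = lam j • mode (O j) x := by
    simp_rw [mode_apply, Finset.smul_sum, smul_smul]
    rw [Finset.sum_comm]
    simp_rw [← Finset.sum_smul, hB.eig]
  have h2 : laplace W γ x = (γ / 2) • (x - fun i => ∑ k, W i k • x k) := rfl
  rw [h2, map_smul, map_sub, h1]
  module

theorem mode_const (hB : IsModeBasis W O lam j₀ lam₂) {j : Fin n} (hj : j ≠ j₀) (c : E) :
    mode (O j) (fun _ : Fin n => c) = 0 := by
  rw [mode_apply, ← Finset.sum_smul, hB.sum_zero j hj, zero_smul]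

/-- Sum the column orthonormality relation over its second index: every row other than j₀ has sum
zero and drops out. Consequently the row j₀ is a nonzero constant. -/
theorem consensus_row (hB : IsModeBasis W O lam j₀ lam₂) (i : Fin n) :
    (∑ k, O j₀ k) * O j₀ i = 1 := by
  have h : ∑ k, ∑ j, O j i * O j k = 1 := by simp [hB.orth]
  rw [Finset.sum_comm] at h
  simp_rw [← Finset.mul_sum] at h
  rw [Finset.sum_eq_single j₀ (fun j _ hj => by rw [hB.sum_zero j hj, mul_zero])
    (fun h => absurd (Finset.mem_univ _) h)] at h
  linarith

theorem sum_mode_le (hB : IsModeBasis W O lam j₀ lam₂) (x : Fin n → E) :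
    ∑ j ∈ Finset.univ.erase j₀, ‖mode (O j) x‖ ^ 2 ≤ ∑ i, ‖x i‖ ^ 2 := by
  rw [← hB.parseval]
  exact Finset.sum_le_sum_of_subset_of_nonneg (Finset.erase_subset _ _)
    fun _ _ _ => by positivity

theorem mode_consensus_eq_zero (hB : IsModeBasis W O lam j₀ lam₂) {x : Fin n → E}
    (hx : ∑ i, x i = 0) : mode (O j₀) x = 0 := by
  obtain ⟨c, hc⟩ : ∃ c, ∀ i, O j₀ i = c :=
    ⟨(∑ k, O j₀ k)⁻¹, fun i => eq_inv_of_mul_eq_one_right (hB.consensus_row i)⟩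
  rw [mode_apply]
  simp_rw [hc]
  rw [← Finset.smul_sum, hx, smul_zero]

theorem sum_eq_sum_mode (hB : IsModeBasis W O lam j₀ lam₂) {x : Fin n → E} (hx : ∑ i, x i = 0) :
    ∑ i, ‖x i‖ ^ 2 = ∑ j ∈ Finset.univ.erase j₀, ‖mode (O j) x‖ ^ 2 := by
  rw [← hB.parseval, ← Finset.add_sum_erase _ _ (Finset.mem_univ j₀),
    hB.mode_consensus_eq_zero hx]
  simp

theorem sum_sub_avg (hB : IsModeBasis W O lam j₀ lam₂) (x : Fin n → E) :
    ∑ i, ‖x i - avg x‖ ^ 2 = ∑ j ∈ Finset.univ.erase j₀, ‖mode (O j) x‖ ^ 2 := by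
  have hn : (n : ℝ) ≠ 0 := by
    have : NeZero n := ⟨by rintro rfl; exact j₀.elim0⟩
    exact_mod_cast this.out
  rw [hB.sum_eq_sum_mode]
  · refine Finset.sum_congr rfl fun j hj => ?_
    have : (fun i => x i - avg x) = x - fun _ => avg x := rfl
    rw [this, map_sub, hB.mode_const (Finset.ne_of_mem_erase hj), sub_zero]
  · rw [Finset.sum_sub_distrib, avg_apply]
    simp [← Nat.cast_smul_eq_nsmul ℝ, smul_smul, hn]

end IsModeBasis

end Modes


/-! ### One iteration: energy, local progress and tracking error. -/

section OneStep

variable {E : Type*} [SeminormedAddCommGroup E] [InnerProductSpace ℝ E] {n : ℕ}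

open scoped RealInnerProductSpace

/-- The weighted disagreement energy of the primal variable `x` and of the shifted dual variable
`d + η gm` over all non-consensus modes. -/
noncomputable def energy (O : Matrix (Fin n) (Fin n) ℝ) (lam : Fin n → ℝ) (j₀ : Fin n) (γ η : ℝ)
    (x d gm : Fin n → E) : ℝ :=
  ∑ j ∈ Finset.univ.erase j₀, (‖mode (O j) x‖ ^ 2
    + (1 - γ / 2 * (1 - lam j)) / (γ / 2 * (1 - lam j)) * ‖mode (O j) (d + η • gm)‖ ^ 2)

namespace IsModeBasis

variable {W O : Matrix (Fin n) (Fin n) ℝ} {lam : Fin n → ℝ} {j₀ : Fin n} {lam₂ γ η : ℝ}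

theorem laplace_eigenvalue_bounds (hB : IsModeBasis W O lam j₀ lam₂) (hγ : 0 < γ) {j : Fin n}
    (hj : j ≠ j₀) :
    γ / 2 * (1 - lam₂) ≤ γ / 2 * (1 - lam j) ∧ γ / 2 * (1 - lam j) ≤ γ := by
  have h1 := hB.le_lam₂ j hj
  have h2 := hB.neg_one_le j
  constructor <;> nlinarith

theorem sum_laplace_sq_le (hB : IsModeBasis W O lam j₀ lam₂) (hγ : 0 < γ) (hl : lam₂ < 1)
    (x : Fin n → E) :
    ∑ i, ‖laplace W γ x i‖ ^ 2 ≤ γ ^ 2 * ∑ j ∈ Finset.univ.erase j₀, ‖mode (O j) x‖ ^ 2 := by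
  rw [← hB.parseval, ← Finset.add_sum_erase _ _ (Finset.mem_univ j₀), Finset.mul_sum]
  have h0 : mode (O j₀) (laplace W γ x) = 0 := by rw [hB.mode_laplace, hB.eig_zero]; simp
  rw [h0]
  simp only [norm_zero, ne_eq, OfNat.ofNat_ne_zero, not_false_eq_true, zero_pow, zero_add]
  refine Finset.sum_le_sum fun j hj => ?_
  obtain ⟨h1, h2⟩ := hB.laplace_eigenvalue_bounds hγ (Finset.ne_of_mem_erase hj)
  have h3 : 0 ≤ γ / 2 * (1 - lam₂) := mul_nonneg (by positivity) (by linarith)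
  rw [hB.mode_laplace, norm_smul, mul_pow, Real.norm_of_nonneg (h3.trans h1)]
  have h4 := h3.trans h1
  gcongr

theorem energy_weight_nonneg (hB : IsModeBasis W O lam j₀ lam₂) (hγ : 0 < γ) (hγ2 : γ ≤ 1 / 2)
    (hl : lam₂ < 1) {j : Fin n} (hj : j ≠ j₀) :
    0 ≤ (1 - γ / 2 * (1 - lam j)) / (γ / 2 * (1 - lam j)) := by
  obtain ⟨h1, h2⟩ := hB.laplace_eigenvalue_bounds hγ hj
  have h3 : 0 ≤ γ / 2 * (1 - lam₂) := mul_nonneg (by positivity) (by linarith)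
  exact div_nonneg (by linarith) (by linarith)

theorem energy_nonneg (hB : IsModeBasis W O lam j₀ lam₂) (hγ : 0 < γ) (hγ2 : γ ≤ 1 / 2)
    (hl : lam₂ < 1) (x d gm : Fin n → E) : 0 ≤ energy O lam j₀ γ η x d gm :=
  Finset.sum_nonneg fun _ hj => add_nonneg (sq_nonneg _) (mul_nonneg
    (hB.energy_weight_nonneg hγ hγ2 hl (Finset.ne_of_mem_erase hj)) (sq_nonneg _))

theorem sum_mode_le_energy (hB : IsModeBasis W O lam j₀ lam₂) (hγ : 0 < γ) (hγ2 : γ ≤ 1 / 2)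
    (hl : lam₂ < 1) (x d gm : Fin n → E) :
    ∑ j ∈ Finset.univ.erase j₀, ‖mode (O j) x‖ ^ 2 ≤ energy O lam j₀ γ η x d gm :=
  Finset.sum_le_sum fun _ hj => le_add_of_nonneg_right (mul_nonneg
    (hB.energy_weight_nonneg hγ hγ2 hl (Finset.ne_of_mem_erase hj)) (sq_nonneg _))

/-- The eigenvalue β of a mode satisfies β ≤ γ ≤ 1/2, so its dual weight (1-β)/β is at least 1/(2γ).
-/
theorem sum_dual_le_energy (hB : IsModeBasis W O lam j₀ lam₂) (hγ : 0 < γ) (hγ2 : γ ≤ 1 / 2)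
    (hl : lam₂ < 1) (x d gm : Fin n → E) :
    ∑ j ∈ Finset.univ.erase j₀, ‖mode (O j) (d + η • gm)‖ ^ 2
      ≤ 2 * γ * energy O lam j₀ γ η x d gm := by
  rw [energy, Finset.mul_sum]
  refine Finset.sum_le_sum fun j hj => ?_
  obtain ⟨h1, h2⟩ := hB.laplace_eigenvalue_bounds hγ (Finset.ne_of_mem_erase hj)
  have h3 : 0 < γ / 2 * (1 - lam₂) := mul_pos (by positivity) (by linarith)
  set β := γ / 2 * (1 - lam j)
  have hβ : 0 < β := h3.trans_le h1
  have h4 : 1 ≤ 2 * γ * ((1 - β) / β) := by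
    rw [← mul_div_assoc, le_div_iff₀ hβ]; nlinarith
  have h5 := mul_le_mul_of_nonneg_right h4 (sq_nonneg ‖mode (O j) (d + η • gm)‖)
  have h6 : 0 ≤ 2 * γ * ‖mode (O j) x‖ ^ 2 := by positivity
  linarith

/-- The submodules Sz ≤ S model two stages of information: before the gradients of this iteration
are sampled, and after that but before compression. The noise z is orthogonal to the first and the
compression error e to the second. Requiring the next reference gradient gm' to lie in S is
legitimate because the average iterate does not see e. -/
theorem energy_step (hB : IsModeBasis W O lam j₀ lam₂) (hγ : 0 < γ) (hγ2 : γ ≤ 1 / 2)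
    (hl : lam₂ < 1) {x d gx gm gm' z e y : Fin n → E} {S Sz : Submodule ℝ E}
    (hy : ∀ i, y i = x i - η • (gx i + z i) - d i)
    (hzS : ∀ s ∈ Sz, ∀ i, ⟪s, z i⟫ = 0) (heS : ∀ s ∈ S, ∀ i, ⟪s, e i⟫ = 0) (hS : Sz ≤ S)
    (hx : ∀ i, x i ∈ Sz) (hd : ∀ i, d i ∈ Sz) (hgx : ∀ i, gx i ∈ Sz) (hgm : ∀ i, gm i ∈ Sz)
    (hz : ∀ i, z i ∈ S) (hgm' : ∀ i, gm' i ∈ S) :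
    energy O lam j₀ γ η (y - laplace W γ y - laplace W γ e) (d + laplace W γ y + laplace W γ e) gm'
      ≤ (1 - γ / 2 * (1 - lam₂) / 2) * energy O lam j₀ γ η x d gm
        + 4 / (γ / 2 * (1 - lam₂)) * (η ^ 2 * ∑ i, ‖gx i - gm i‖ ^ 2) + η ^ 2 * ∑ i, ‖z i‖ ^ 2
        + 4 / (γ / 2 * (1 - lam₂)) ^ 2 * (η ^ 2 * ∑ i, ‖gm' i - gm i‖ ^ 2)
        + γ * ∑ i, ‖e i‖ ^ 2 := by
  set b := γ / 2 * (1 - lam₂) with hb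
  have hb0 : 0 < b := mul_pos (by positivity) (by linarith)
  have step : ∀ j ∈ Finset.univ.erase j₀,
      ‖mode (O j) (y - laplace W γ y - laplace W γ e)‖ ^ 2
        + (1 - γ / 2 * (1 - lam j)) / (γ / 2 * (1 - lam j))
          * ‖mode (O j) (d + laplace W γ y + laplace W γ e + η • gm')‖ ^ 2
      ≤ (1 - b / 2) * (‖mode (O j) x‖ ^ 2
        + (1 - γ / 2 * (1 - lam j)) / (γ / 2 * (1 - lam j)) * ‖mode (O j) (d + η • gm)‖ ^ 2)
        + 4 / b * (η ^ 2 * ‖mode (O j) (gx - gm)‖ ^ 2) + η ^ 2 * ‖mode (O j) z‖ ^ 2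
        + 4 / b ^ 2 * (η ^ 2 * ‖mode (O j) (gm' - gm)‖ ^ 2) + γ * ‖mode (O j) e‖ ^ 2 := by
    intro j hj
    obtain ⟨h1, h2⟩ := hB.laplace_eigenvalue_bounds hγ (Finset.ne_of_mem_erase hj)
    have hx' := mode_mem (O j) hx
    have hd' := mode_mem (O j) hd
    have hgx' := mode_mem (O j) hgx
    have hgm'' := mode_mem (O j) hgm
    have hz' := mode_mem (O j) hz
    have hgm3 := mode_mem (O j) hgm'
    have Hz : ∀ s ∈ Sz, ⟪s, mode (O j) z⟫ = 0 := fun s hs => inner_mode_eq_zero _ (hzS s hs)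
    have He : ∀ s ∈ S, ⟪s, mode (O j) e⟫ = 0 := fun s hs => inner_mode_eq_zero _ (heS s hs)
    have hU : mode (O j) (d + η • gm) ∈ Sz := by
      rw [map_add, map_smul]; exact Sz.add_mem hd' (Sz.smul_mem _ hgm'')
    have ha : η • mode (O j) (gx - gm) ∈ Sz := by
      rw [map_sub]; exact Sz.smul_mem _ (Sz.sub_mem hgx' hgm'')
    have hdl : η • mode (O j) (gm' - gm) ∈ S := by
      rw [map_sub]; exact S.smul_mem _ (S.sub_mem hgm3 (hS hgm''))
    have key := mode_energy_step (mode (O j) x) (mode (O j) (d + η • gm))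
      (η • mode (O j) (gx - gm)) (η • mode (O j) z) (η • mode (O j) (gm' - gm)) (mode (O j) e)
      hb0 h1 (by linarith)
      (by rw [inner_smul_right, Hz _ (Sz.sub_mem hx' ha), mul_zero])
      (He _ (S.sub_mem (S.sub_mem (S.sub_mem (hS hx') (hS hU)) (hS ha)) (S.smul_mem _ hz')))
      (He _ (hS hU)) (He _ hdl)
    have hy' : y = x - η • (gx + z) - d := funext hy
    -- The shift η gm in the dual variable cancels against the one in the gradient disagreement.
    have hY : mode (O j) x - mode (O j) (d + η • gm) - η • mode (O j) (gx - gm)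
        - η • mode (O j) z = mode (O j) y := by
      rw [hy']
      simp only [map_add, map_sub, map_smul]
      module
    rw [hY, norm_smul_sq η, norm_smul_sq η, norm_smul_sq η] at key
    have e1 : mode (O j) (y - laplace W γ y - laplace W γ e)
        = (1 - γ / 2 * (1 - lam j)) • mode (O j) y - (γ / 2 * (1 - lam j)) • mode (O j) e := by
      rw [map_sub, map_sub, hB.mode_laplace, hB.mode_laplace]
      module
    have e2 : mode (O j) (d + laplace W γ y + laplace W γ e + η • gm')
        = mode (O j) (d + η • gm) + (γ / 2 * (1 - lam j)) • mode (O j) y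
          + (γ / 2 * (1 - lam j)) • mode (O j) e + η • mode (O j) (gm' - gm) := by
      simp only [map_add, map_sub, map_smul, hB.mode_laplace]
      module
    rw [e1, e2]
    refine key.trans ?_
    gcongr
  refine (Finset.sum_le_sum step).trans ?_
  simp only [Finset.sum_add_distrib, ← Finset.mul_sum]
  have a1 := hB.sum_mode_le (gx - gm)
  have a2 := hB.sum_mode_le z
  have a3 := hB.sum_mode_le (gm' - gm)
  have a4 := hB.sum_mode_le e
  simp only [Pi.sub_apply] at a1 a3
  simp only [energy, Finset.sum_add_distrib]
  gcongr

/-- Write x - y as (d + η(gm - avg gm)) + η(gx - gm) + η avg gm plus the orthogonal noise. The first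
summand has zero average, hence lies in the non-consensus modes, where it is the dual part of the
energy; three summands times the factor 2γ give 6γ. -/
theorem local_progress_le (hB : IsModeBasis W O lam j₀ lam₂) (hγ : 0 < γ) (hγ2 : γ ≤ 1 / 2)
    (hl : lam₂ < 1) {x d gx gm z y : Fin n → E} {Sz : Submodule ℝ E}
    (hy : ∀ i, y i = x i - η • (gx i + z i) - d i)
    (hzS : ∀ s ∈ Sz, ∀ i, ⟪s, z i⟫ = 0)
    (hd : ∀ i, d i ∈ Sz) (hgx : ∀ i, gx i ∈ Sz) (hd0 : ∑ i, d i = 0) :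
    ∑ i, ‖y i - x i‖ ^ 2 ≤ 6 * γ * energy O lam j₀ γ η x d gm
        + 3 * (η ^ 2 * ∑ i, ‖gx i - gm i‖ ^ 2) + 3 * (η ^ 2 * (n * ‖avg gm‖ ^ 2))
        + η ^ 2 * ∑ i, ‖z i‖ ^ 2 := by
  have hn : (n : ℝ) ≠ 0 := by
    have : NeZero n := ⟨by rintro rfl; exact j₀.elim0⟩
    exact_mod_cast this.out
  have hu : ∑ i, ‖d i + η • (gm i - avg gm)‖ ^ 2
      ≤ 2 * γ * energy O lam j₀ γ η x d gm := by
    rw [hB.sum_eq_sum_mode]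
    · refine le_trans (le_of_eq ?_) (hB.sum_dual_le_energy hγ hγ2 hl x d gm)
      refine Finset.sum_congr rfl fun j hj => ?_
      have : (fun i => d i + η • (gm i - avg gm)) = d + η • gm - η • fun _ => avg gm := by
        ext i; simp only [Pi.add_apply, Pi.sub_apply, Pi.smul_apply]; module
      rw [this, map_sub, map_smul _ η (fun _ => avg gm),
        hB.mode_const (Finset.ne_of_mem_erase hj), smul_zero, sub_zero]
    · rw [Finset.sum_add_distrib, hd0, ← Finset.smul_sum, Finset.sum_sub_distrib, avg_apply]
      simp [← Nat.cast_smul_eq_nsmul ℝ, smul_smul, hn]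
  have step : ∀ i, ‖y i - x i‖ ^ 2 ≤ 3 * ‖d i + η • (gm i - avg gm)‖ ^ 2
      + 3 * (η ^ 2 * ‖gx i - gm i‖ ^ 2) + 3 * (η ^ 2 * ‖avg gm‖ ^ 2) + η ^ 2 * ‖z i‖ ^ 2 := by
    intro i
    have e1 : ‖y i - x i‖ = ‖(η • gx i + d i) + η • z i‖ := by
      rw [← norm_neg, hy]; congr 1; module
    rw [e1, norm_add_sq_of_inner_eq_zero]
    · have e2 : η • gx i + d i = (d i + η • (gm i - avg gm)) + η • (gx i - gm i) + η • avg gm := by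
        module
      have e3 := norm_add_three_sq_le (d i + η • (gm i - avg gm)) (η • (gx i - gm i)) (η • avg gm)
      rw [← e2] at e3
      rw [norm_smul_sq η (gx i - gm i), norm_smul_sq η (avg gm)] at e3
      rw [norm_smul_sq η (z i)]
      linarith
    · rw [inner_smul_right, hzS _ (Sz.add_mem (Sz.smul_mem _ (hgx i)) (hd i)), mul_zero]
  refine (Finset.sum_le_sum fun i _ => step i).trans ?_
  simp only [Finset.sum_add_distrib, ← Finset.mul_sum, Finset.sum_const, Finset.card_univ,
    Fintype.card_fin, nsmul_eq_mul]
  linarith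

/-- Up to an orthogonal multiple of the compression error, the new difference is (1-α)(x - h) plus a
perturbation made of y - x and 𝓛y, so convexity preserves the factor 1 - α. Splitting 𝓛y = 𝓛(y - x)
+ 𝓛x leaves only the disagreement of x, since 𝓛 ignores consensus. -/
theorem tracking_step (hB : IsModeBasis W O lam j₀ lam₂) (hγ : 0 < γ) (hγ2 : γ ≤ 1 / 2)
    (hl : lam₂ < 1) {α : ℝ} (hα0 : 0 < α) (hα1 : α ≤ 1) {x d h gm e y : Fin n → E}
    {S : Submodule ℝ E} (heS : ∀ s ∈ S, ∀ i, ⟪s, e i⟫ = 0)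
    (hh : ∀ i, h i ∈ S) (hyS : ∀ i, y i ∈ S) :
    ∑ i, ‖(y - laplace W γ y - laplace W γ e) i - (h i + α • (y i - h i) + α • e i)‖ ^ 2
      ≤ (1 - α) * ∑ i, ‖x i - h i‖ ^ 2
        + 1 / α * (3 * ∑ i, ‖y i - x i‖ ^ 2 + 4 * γ ^ 2 * energy O lam j₀ γ η x d gm)
        + (2 * α ^ 2 + 2 * γ ^ 2) * ∑ i, ‖e i‖ ^ 2 := by
  have step : ∀ i, ‖(y - laplace W γ y - laplace W γ e) i - (h i + α • (y i - h i) + α • e i)‖ ^ 2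
      ≤ (1 - α) * ‖x i - h i‖ ^ 2
        + 1 / α * (2 * ‖y i - x i‖ ^ 2 + 2 * ‖laplace W γ y i‖ ^ 2)
        + (2 * α ^ 2 * ‖e i‖ ^ 2 + 2 * ‖laplace W γ e i‖ ^ 2) := by
    intro i
    have e1 : (y - laplace W γ y - laplace W γ e) i - (h i + α • (y i - h i) + α • e i)
        = ((1 - α) • (y i - h i) - laplace W γ y i) - (α • e i + laplace W γ e i) := by
      simp only [Pi.sub_apply]; module
    have hL := laplace_mem W γ hyS i
    have hs : (1 - α) • (y i - h i) - laplace W γ y i ∈ S :=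
      S.sub_mem (S.smul_mem _ (S.sub_mem (hyS i) (hh i))) hL
    rw [e1, norm_sub_sq_of_inner_eq_zero]
    · have e2 : (1 - α) • (y i - h i) - laplace W γ y i
          = (1 - α) • (x i - h i) + ((1 - α) • (y i - x i) - laplace W γ y i) := by module
      have e3 := norm_convex_comb_sq_le (x i - h i) ((1 - α) • (y i - x i) - laplace W γ y i)
        hα0 hα1
      rw [← e2] at e3
      have e4 := norm_sub_sq_le_two ((1 - α) • (y i - x i)) (laplace W γ y i)
      have e5 := norm_add_sq_le_two (α • e i) (laplace W γ e i)
      rw [norm_smul_sq] at e4 e5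
      have e6 : (1 - α) ^ 2 * ‖y i - x i‖ ^ 2 ≤ 1 * ‖y i - x i‖ ^ 2 := by
        gcongr; nlinarith
      have e7 : 1 / α * ‖(1 - α) • (y i - x i) - laplace W γ y i‖ ^ 2
          ≤ 1 / α * (2 * ‖y i - x i‖ ^ 2 + 2 * ‖laplace W γ y i‖ ^ 2) := by
        gcongr; linarith
      linarith
    · rw [inner_add_right, inner_smul_right, heS _ hs,
        inner_laplace_eq_zero W γ (heS _ hs)]
      simp
  refine (Finset.sum_le_sum fun i _ => step i).trans ?_
  simp only [Finset.sum_add_distrib, ← Finset.mul_sum]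
  have f1 : ∑ i, ‖laplace W γ y i‖ ^ 2 ≤ 2 * γ ^ 2 * ∑ i, ‖y i - x i‖ ^ 2
      + 2 * γ ^ 2 * energy O lam j₀ γ η x d gm := by
    have g1 : ∀ i, ‖laplace W γ y i‖ ^ 2
        ≤ 2 * ‖laplace W γ (y - x) i‖ ^ 2 + 2 * ‖laplace W γ x i‖ ^ 2 := fun i => by
      have : laplace W γ y i = laplace W γ (y - x) i + laplace W γ x i := by
        simp only [laplace, Pi.sub_apply, smul_sub, Finset.sum_sub_distrib]; abel
      rw [this]; exact norm_add_sq_le_two _ _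
    refine (Finset.sum_le_sum fun i _ => g1 i).trans ?_
    simp only [Finset.sum_add_distrib, ← Finset.mul_sum]
    have g2 := hB.sum_laplace_sq_le hγ hl (y - x)
    have g3 := hB.sum_laplace_sq_le hγ hl x
    have g4 := hB.sum_mode_le (y - x)
    simp only [Pi.sub_apply] at g4
    have g5 := hB.sum_mode_le_energy hγ hγ2 hl (η := η) x d gm
    have g6 := mul_le_mul_of_nonneg_left g4 (sq_nonneg γ)
    have g7 := mul_le_mul_of_nonneg_left g5 (sq_nonneg γ)
    linarith
  have f2 : ∑ i, ‖laplace W γ e i‖ ^ 2 ≤ γ ^ 2 * ∑ i, ‖e i‖ ^ 2 :=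
    (hB.sum_laplace_sq_le hγ hl e).trans
      (mul_le_mul_of_nonneg_left (hB.sum_mode_le e) (sq_nonneg γ))
  have f3 : 0 ≤ ∑ i, ‖y i - x i‖ ^ 2 := Finset.sum_nonneg fun _ _ => sq_nonneg _
  have f4 : 2 * ∑ i, ‖y i - x i‖ ^ 2 + 2 * ∑ i, ‖laplace W γ y i‖ ^ 2
      ≤ 3 * ∑ i, ‖y i - x i‖ ^ 2 + 4 * γ ^ 2 * energy O lam j₀ γ η x d gm := by
    have : 4 * γ ^ 2 * ∑ i, ‖y i - x i‖ ^ 2 ≤ 1 * ∑ i, ‖y i - x i‖ ^ 2 := by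
      gcongr; nlinarith
    linarith
  have f5 : 1 / α * (2 * ∑ i, ‖y i - x i‖ ^ 2 + 2 * ∑ i, ‖laplace W γ y i‖ ^ 2)
      ≤ 1 / α * (3 * ∑ i, ‖y i - x i‖ ^ 2 + 4 * γ ^ 2 * energy O lam j₀ γ η x d gm) := by
    gcongr
  linarith

end IsModeBasis

end OneStep


/-! ### Choice of constants in the Lyapunov inequality. -/

/-- P is the energy, H the tracking error, Q the local progress, T the squared norm of the
compressed vector, A the gradient disagreement, D the gradient drift, N the noise, e the compression
error and G the squared average gradient. The stepsize condition makes the disagreement cost b/16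
and its feedback through the drift b/1024, both small against the contraction b/2. -/
theorem energy_step_arith {γ L C η σ n b P P' H Q T A D N e G : ℝ}
    (hC : 0 < C) (hγ : 0 < γ) (hb0 : 0 < b) (hb2 : b ≤ 1 / 2)
    (hη : η ^ 2 * L ^ 2 ≤ b ^ 2 / 64) (hn : 1 ≤ n) (hP : 0 ≤ P) (hG : 0 ≤ G)
    (hstep : P' ≤ (1 - b / 2) * P + 4 / b * (η ^ 2 * A) + η ^ 2 * N + 4 / b ^ 2 * (η ^ 2 * D)
      + γ * e)
    (hA2 : η ^ 2 * A ≤ b ^ 2 / 64 * P)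
    (hD : D ≤ L ^ 2 * (η ^ 2 * (2 * (n * G) + 2 * A + σ ^ 2)))
    (hN : N ≤ n * σ ^ 2) (he : e ≤ C * T) (hT : T ≤ 2 * H + 2 * Q) :
    P' ≤ (1 - b / 2 + b / 16 + b / 1024) * P + 1 / 8 * (η ^ 2 * (n * G))
      + 17 / 16 * (η ^ 2 * (n * σ ^ 2)) + (2 * (γ * C) * H + 2 * (γ * C) * Q) := by
  set g := η ^ 2 * (n * G) with hg
  set s := η ^ 2 * (n * σ ^ 2) with hs
  have hg0 : 0 ≤ g := by positivity
  have hs0 : 0 ≤ s := by positivity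
  have hA3 : 4 / b * (η ^ 2 * A) ≤ b / 16 * P := by
    calc _ ≤ 4 / b * (b ^ 2 / 64 * P) := by gcongr
      _ = _ := by field_simp; ring
  have hN2 : η ^ 2 * N ≤ s := mul_le_mul_of_nonneg_left hN (sq_nonneg η)
  have hσ : η ^ 2 * σ ^ 2 ≤ s :=
    mul_le_mul_of_nonneg_left (le_mul_of_one_le_left (sq_nonneg _) hn) (sq_nonneg η)
  have hbP : b ^ 2 * P ≤ 1 / 2 * (b * P) := by
    have : b * (b * P) ≤ 1 / 2 * (b * P) := by gcongr
    linarith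
  have hD2 : 4 / b ^ 2 * (η ^ 2 * D) ≤ 1 / 8 * g + b / 1024 * P + 1 / 16 * s := by
    calc 4 / b ^ 2 * (η ^ 2 * D)
        ≤ 4 / b ^ 2 * (η ^ 2 * (L ^ 2 * (η ^ 2 * (2 * (n * G) + 2 * A + σ ^ 2)))) := by gcongr
      _ = 4 / b ^ 2 * ((η ^ 2 * L ^ 2) * (2 * g + 2 * (η ^ 2 * A) + η ^ 2 * σ ^ 2)) := by
          rw [hg]; ring
      _ ≤ 4 / b ^ 2 * ((η ^ 2 * L ^ 2) * (2 * g + 2 * (b ^ 2 / 64 * P) + s)) := by gcongr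
      _ ≤ 4 / b ^ 2 * (b ^ 2 / 64 * (2 * g + 2 * (b ^ 2 / 64 * P) + s)) := by gcongr
      _ = 1 / 16 * (2 * g + 2 * (b ^ 2 / 64 * P) + s) := by field_simp; ring
      _ ≤ _ := by linarith
  have hT0 : C * T ≤ C * (2 * H + 2 * Q) := by gcongr
  have he3 := mul_le_mul_of_nonneg_left (he.trans hT0) hγ.le
  linarith

/-- The weight 4γC/α turns the decay αH into 4γC·H. This pays for 2γC·H from the energy step and for
(336/250)γC·H from the tracking recursion itself. The amplification 1/α of the perturbation is tamed
by γC ≤ α²l/1728, which explains l/432 = 4l/1728. -/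
theorem tracking_step_arith {α γ l C P H H' Q T e : ℝ}
    (hα0 : 0 < α) (hα1 : α ≤ 1) (hC : 0 < C) (hαC : α * C ≤ 1 / 12) (hγ : 0 < γ) (hγ2 : γ ≤ 1 / 2)
    (hl : 0 < l) (hl2 : l ≤ 2) (hγC : γ * C ≤ α ^ 2 * l / 1728)
    (hP : 0 ≤ P) (hH : 0 ≤ H) (hQ : 0 ≤ Q)
    (he : e ≤ C * T) (hT : T ≤ 2 * H + 2 * Q)
    (hH' : H' ≤ (1 - α) * H + 1 / α * (3 * Q + 4 * γ ^ 2 * P) + (2 * α ^ 2 + 2 * γ ^ 2) * e) :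
    4 * (γ * C) / α * H' ≤ 4 * (γ * C) / α * H - 4 * (γ * C) * H
      + l / 432 * (3 * Q + 4 * γ ^ 2 * P) + 168 / 250 * (γ * C) * (2 * H + 2 * Q) := by
  have hγC0 : 0 < γ * C := by positivity
  have he2 : e ≤ C * (2 * H + 2 * Q) := he.trans (mul_le_mul_of_nonneg_left hT hC.le)
  have hκ : 4 * (γ * C) / α * (1 / α) ≤ l / 432 := by
    rw [div_mul_div_comm, div_le_div_iff₀ (by positivity) (by norm_num)]
    linarith
  have hα2 : α ^ 2 ≤ α := by
    rw [sq]; exact mul_le_of_le_one_left hα0.le hα1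
  -- The term with α² contributes at most α/6 and the one with γ² at most α/864; their sum is below
  -- 42α/250.
  have hcoef : 4 * (γ * C) / α * ((2 * α ^ 2 + 2 * γ ^ 2) * C) ≤ 168 / 250 * (γ * C) := by
    have h1 : (2 * α ^ 2 + 2 * γ ^ 2) * C ≤ 42 / 250 * α := by
      have h2 : α * (α * C) ≤ α * (1 / 12) := by gcongr
      have h3 : γ * (γ * C) ≤ 1 / 2 * (α ^ 2 * l / 1728) := by gcongr
      have h4 : α ^ 2 * l ≤ α * 2 := by gcongr
      linarith
    calc _ ≤ 4 * (γ * C) / α * (42 / 250 * α) := by gcongr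
      _ = _ := by field_simp; norm_num
  have h0 : 0 ≤ 4 * (γ * C) / α := by positivity
  have hcoef2 : 4 * (γ * C) / α * ((2 * α ^ 2 + 2 * γ ^ 2) * e)
      ≤ 168 / 250 * (γ * C) * (2 * H + 2 * Q) := by
    calc _ ≤ 4 * (γ * C) / α * ((2 * α ^ 2 + 2 * γ ^ 2) * (C * (2 * H + 2 * Q))) := by gcongr
      _ = 4 * (γ * C) / α * ((2 * α ^ 2 + 2 * γ ^ 2) * C) * (2 * H + 2 * Q) := by ring
      _ ≤ _ := by gcongr
  have h1 := mul_le_mul_of_nonneg_left hH' h0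
  have h2 : 4 * (γ * C) / α * (1 / α) * (3 * Q + 4 * γ ^ 2 * P)
      ≤ l / 432 * (3 * Q + 4 * γ ^ 2 * P) := by gcongr
  have h3 : 4 * (γ * C) / α * ((1 - α) * H)
      = 4 * (γ * C) / α * H - 4 * (γ * C) * H := by field_simp
  linarith

theorem lyapunov_arith {α γ l C η L σ n b P P' H H' Q T A D N e G : ℝ}
    (hα0 : 0 < α) (hα1 : α ≤ 1) (hC : 0 < C) (hαC : α * C ≤ 1 / 12) (hγ : 0 < γ) (hγ2 : γ ≤ 1 / 2)
    (hl : 0 < l) (hl2 : l ≤ 2) (hγC : γ * C ≤ α ^ 2 * l / 1728) (hb : b = γ / 2 * l)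
    (hη : η ^ 2 * L ^ 2 ≤ b ^ 2 / 64) (hn : 1 ≤ n)
    (hP : 0 ≤ P) (hH : 0 ≤ H) (hQ : 0 ≤ Q) (hG : 0 ≤ G)
    (hstep : P' ≤ (1 - b / 2) * P + 4 / b * (η ^ 2 * A) + η ^ 2 * N + 4 / b ^ 2 * (η ^ 2 * D)
      + γ * e)
    (hA : A ≤ L ^ 2 * P) (hD : D ≤ L ^ 2 * (η ^ 2 * (2 * (n * G) + 2 * A + σ ^ 2)))
    (hN : N ≤ n * σ ^ 2) (he : e ≤ C * T) (hT : T ≤ 2 * H + 2 * Q)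
    (hQle : Q ≤ 6 * γ * P + 3 * (η ^ 2 * A) + 3 * (η ^ 2 * (n * G)) + η ^ 2 * N)
    (hH' : H' ≤ (1 - α) * H + 1 / α * (3 * Q + 4 * γ ^ 2 * P) + (2 * α ^ 2 + 2 * γ ^ 2) * e) :
    P' + 4 * (γ * C) / α * H' ≤ P + 4 * (γ * C) / α * H - b / 4 * P
      + 1 / 4 * (η ^ 2 * (n * G)) + 2 * (η ^ 2 * (n * σ ^ 2)) := by
  have hb0 : 0 < b := by rw [hb]; positivity
  have hbγ : b ≤ γ := by rw [hb]; nlinarith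
  have hA2 : η ^ 2 * A ≤ b ^ 2 / 64 * P := by
    calc η ^ 2 * A ≤ η ^ 2 * (L ^ 2 * P) := by gcongr
      _ = η ^ 2 * L ^ 2 * P := by ring
      _ ≤ _ := by gcongr
  have hE := energy_step_arith hC hγ hb0 (by linarith) hη hn hP hG hstep hA2 hD hN he hT
  have hH2 := tracking_step_arith hα0 hα1 hC hαC hγ hγ2 hl hl2 hγC hP hH hQ he hT hH'
  have hN2 : η ^ 2 * N ≤ η ^ 2 * (n * σ ^ 2) := mul_le_mul_of_nonneg_left hN (sq_nonneg η)
  have hg0 : 0 ≤ η ^ 2 * (n * G) := by positivity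
  have hs0 : 0 ≤ η ^ 2 * (n * σ ^ 2) := by positivity
  generalize η ^ 2 * (n * G) = g at *
  generalize η ^ 2 * (n * σ ^ 2) = s at *
  have hQ2 : Q ≤ (6 + 3 / 128) * γ * P + 3 * g + s := by
    have h1 : b ^ 2 * P ≤ 1 / 2 * γ * P := by
      gcongr
      calc b ^ 2 = b * b := sq b
        _ ≤ 1 / 2 * γ := by gcongr; linarith
    linarith
  have hα2 : α ^ 2 ≤ 1 := pow_le_one₀ hα0.le hα1
  have hγl : γ * C ≤ l / 1728 := by
    have : α ^ 2 * l ≤ 1 * l := by gcongr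
    linarith
  -- Since lγ = 2b, the factor l that accompanies Q turns the γP in its bound into bP, which the
  -- contraction can absorb.
  have hQ3 : l * Q ≤ (12 + 3 / 64) * (b * P) + 6 * g + 2 * s := by
    calc l * Q ≤ l * ((6 + 3 / 128) * γ * P + 3 * g + s) := by gcongr
      _ = (12 + 3 / 64) * (b * P) + 3 * (l * g) + l * s := by rw [hb]; ring
      _ ≤ (12 + 3 / 64) * (b * P) + 3 * (2 * g) + 2 * s := by gcongr
      _ = _ := by ring
  have hbP0 : 0 ≤ b * P := by positivity
  have hP3 : l * (γ ^ 2 * P) ≤ b * P := by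
    calc l * (γ ^ 2 * P) = 2 * γ * (b * P) := by rw [hb]; ring
      _ ≤ 1 * (b * P) := by gcongr; linarith
      _ = _ := one_mul _
  have hQ4 : γ * C * Q ≤ l / 1728 * Q := by gcongr
  have hH3 : 0 ≤ γ * C * H := by positivity
  linarith

/-! ### The Lyapunov inequality in an abstract inner product space. -/

section Step

variable {E : Type*} [SeminormedAddCommGroup E] [InnerProductSpace ℝ E] {n : ℕ}

open scoped RealInnerProductSpace

/-- By Pythagoras, averaging n orthogonal noises divides the variance by n. This is the source of
the linear speedup in n. -/
theorem norm_avg_sq_le_of_orthogonal (hn : 0 < n) {z : Fin n → E} {σ : ℝ}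
    (hz : ∀ i, ‖z i‖ ^ 2 ≤ σ ^ 2) (hzz : ∀ i k, i ≠ k → ⟪z i, z k⟫ = 0) :
    n * ‖avg z‖ ^ 2 ≤ σ ^ 2 := by
  have hn' : (0 : ℝ) < n := by exact_mod_cast hn
  have h1 : ‖∑ i, z i‖ ^ 2 = ∑ i, ‖z i‖ ^ 2 := by
    rw [← real_inner_self_eq_norm_sq, sum_inner]
    refine Finset.sum_congr rfl fun i _ => ?_
    rw [inner_sum, Finset.sum_eq_single i (fun k _ hk => hzz i k hk.symm)
      (fun h => absurd (Finset.mem_univ _) h), real_inner_self_eq_norm_sq]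
  have h2 : ∑ i, ‖z i‖ ^ 2 ≤ n * σ ^ 2 := by
    refine (Finset.sum_le_sum fun i _ => hz i).trans ?_
    simp
  rw [avg_apply, norm_smul_sq, h1]
  calc (n : ℝ) * ((1 / (n : ℝ)) ^ 2 * ∑ i, ‖z i‖ ^ 2) = 1 / (n : ℝ) * ∑ i, ‖z i‖ ^ 2 := by
        field_simp
    _ ≤ 1 / (n : ℝ) * (n * σ ^ 2) := by gcongr
    _ = σ ^ 2 := by field_simp

namespace IsModeBasis

variable {W O : Matrix (Fin n) (Fin n) ℝ} {lam : Fin n → ℝ} {j₀ : Fin n} {lam₂ γ η : ℝ}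

theorem sum_laplace (hB : IsModeBasis W O lam j₀ lam₂) (x : Fin n → E) :
    ∑ i, laplace W γ x i = 0 := by
  have h0 : mode (O j₀) (laplace W γ x) = 0 := by rw [hB.mode_laplace, hB.eig_zero]; simp
  have hc := fun i => eq_inv_of_mul_eq_one_right (hB.consensus_row i)
  have hc0 : (∑ k, O j₀ k) ≠ 0 := left_ne_zero_of_mul_eq_one (hB.consensus_row j₀)
  generalize (∑ k, O j₀ k) = c at hc hc0
  rw [mode_apply] at h0
  simp_rw [hc] at h0
  rw [← Finset.smul_sum] at h0
  have := congrArg (fun v => c • v) h0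
  simpa [smul_smul, hc0] using this

/-- The dual variables have zero sum and 𝓛 maps into vectors of zero sum, so neither duals nor
compression affect the average. -/
theorem avg_step (hB : IsModeBasis W O lam j₀ lam₂) {x d gx z e y : Fin n → E}
    (hy : ∀ i, y i = x i - η • (gx i + z i) - d i) (hd0 : ∑ i, d i = 0) :
    avg (y - laplace W γ y - laplace W γ e) = avg x - η • (avg gx + avg z) := by
  have h1 : ∀ v : Fin n → E, avg (laplace W γ v) = 0 := fun v => by
    rw [avg_apply, hB.sum_laplace, smul_zero]
  have h2 : avg d = 0 := by rw [avg_apply, hd0, smul_zero]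
  have hy' : y = x - η • (gx + z) - d := funext hy
  rw [map_sub, map_sub, h1, h1, hy', map_sub, map_sub, map_smul, map_add, h2]
  simp

theorem lyapunov_step (hB : IsModeBasis W O lam j₀ lam₂) {α C L σ : ℝ}
    (hα0 : 0 < α) (hα1 : α ≤ 1) (hC : 0 < C) (hαC : α * C ≤ 1 / 12) (hγ : 0 < γ) (hγ2 : γ ≤ 1 / 2)
    (hl : lam₂ < 1) (hn : 2 ≤ n) (hγC : γ * C ≤ α ^ 2 * (1 - lam₂) / 1728)
    (hη : η ^ 2 * L ^ 2 ≤ (γ / 2 * (1 - lam₂)) ^ 2 / 64)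
    {x d h gx gm gm' z e y : Fin n → E} {S Sz : Submodule ℝ E}
    (hy : ∀ i, y i = x i - η • (gx i + z i) - d i) (hd0 : ∑ i, d i = 0)
    (hzS : ∀ s ∈ Sz, ∀ i, ⟪s, z i⟫ = 0) (heS : ∀ s ∈ S, ∀ i, ⟪s, e i⟫ = 0) (hS : Sz ≤ S)
    (hx : ∀ i, x i ∈ Sz) (hd : ∀ i, d i ∈ Sz) (hh : ∀ i, h i ∈ Sz) (hgx : ∀ i, gx i ∈ Sz)
    (hgm : ∀ i, gm i ∈ Sz) (hz : ∀ i, z i ∈ S) (hgm' : ∀ i, gm' i ∈ S)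
    (hzσ : ∀ i, ‖z i‖ ^ 2 ≤ σ ^ 2) (hzz : ∀ i k, i ≠ k → ⟪z i, z k⟫ = 0)
    (heC : ∀ i, ‖e i‖ ^ 2 ≤ C * ‖y i - h i‖ ^ 2)
    (hgL : ∀ i, ‖gx i - gm i‖ ^ 2 ≤ L ^ 2 * ‖x i - avg x‖ ^ 2)
    (hgmL : ∀ i, ‖gm' i - gm i‖ ^ 2
      ≤ L ^ 2 * ‖avg (y - laplace W γ y - laplace W γ e) - avg x‖ ^ 2) :
    energy O lam j₀ γ η (y - laplace W γ y - laplace W γ e) (d + laplace W γ y + laplace W γ e) gm'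
        + 4 * (γ * C) / α *
          ∑ i, ‖(y - laplace W γ y - laplace W γ e) i - (h i + α • (y i - h i) + α • e i)‖ ^ 2
      ≤ energy O lam j₀ γ η x d gm + 4 * (γ * C) / α * ∑ i, ‖x i - h i‖ ^ 2
        - γ / 2 * (1 - lam₂) / 4 * energy O lam j₀ γ η x d gm
        + 1 / 4 * (η ^ 2 * (n * ‖avg gm‖ ^ 2)) + 2 * (η ^ 2 * (n * σ ^ 2)) := by
  have hn1 : (1 : ℝ) ≤ n := by exact_mod_cast (by omega : 1 ≤ n)
  have hyS : ∀ i, y i ∈ S := fun i => by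
    rw [hy i]
    exact S.sub_mem (S.sub_mem (hS (hx i)) (S.smul_mem _ (S.add_mem (hS (hgx i)) (hz i))))
      (hS (hd i))
  have : Nontrivial (Fin n) := Fin.nontrivial_iff_two_le.mpr hn
  have hl2 : 1 - lam₂ ≤ 2 := by
    obtain ⟨j, hj⟩ := exists_ne j₀
    have := hB.le_lam₂ j hj
    have := hB.neg_one_le j
    linarith
  have hA : ∑ i, ‖gx i - gm i‖ ^ 2 ≤ L ^ 2 * energy O lam j₀ γ η x d gm := by
    calc _ ≤ ∑ i, L ^ 2 * ‖x i - avg x‖ ^ 2 := Finset.sum_le_sum fun i _ => hgL i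
      _ = L ^ 2 * ∑ i, ‖x i - avg x‖ ^ 2 := by rw [Finset.mul_sum]
      _ ≤ _ := by
        rw [hB.sum_sub_avg]
        exact mul_le_mul_of_nonneg_left (hB.sum_mode_le_energy hγ hγ2 hl x d gm) (sq_nonneg L)
  refine lyapunov_arith (A := ∑ i, ‖gx i - gm i‖ ^ 2) (D := ∑ i, ‖gm' i - gm i‖ ^ 2)
    (N := ∑ i, ‖z i‖ ^ 2) (e := ∑ i, ‖e i‖ ^ 2) (T := ∑ i, ‖y i - h i‖ ^ 2)
    (Q := ∑ i, ‖y i - x i‖ ^ 2)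
    hα0 hα1 hC hαC hγ hγ2 (by linarith) hl2 hγC rfl hη hn1
    (hB.energy_nonneg hγ hγ2 hl x d gm) (Finset.sum_nonneg fun _ _ => sq_nonneg _)
    (Finset.sum_nonneg fun _ _ => sq_nonneg _) (sq_nonneg _)
    (hB.energy_step hγ hγ2 hl hy hzS heS hS hx hd hgx hgm hz hgm') hA ?_ ?_ ?_ ?_
    (hB.local_progress_le hγ hγ2 hl hy hzS hd hgx hd0)
    (hB.tracking_step hγ hγ2 hl hα0 hα1 heS (fun i => hS (hh i)) hyS)
  -- The drift of the reference gradients is L times the move of the average, which is an SGD step;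
  -- its gradient is compared with the one at the average iterate.
  · have h1 : avg (y - laplace W γ y - laplace W γ e) - avg x = -(η • (avg gx + avg z)) := by
      rw [hB.avg_step hy hd0]; abel
    have h2 : ‖avg gx + avg z‖ ^ 2 = ‖avg gx‖ ^ 2 + ‖avg z‖ ^ 2 :=
      norm_add_sq_of_inner_eq_zero (inner_mode_eq_zero _ (hzS _ (mode_mem _ hgx)))
    have h3 : ‖avg gx‖ ^ 2 ≤ 2 * ‖avg gm‖ ^ 2 + 2 * ‖avg (gx - gm)‖ ^ 2 := by
      have : avg gx = avg gm + avg (gx - gm) := by rw [map_sub]; abel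
      rw [this]; exact norm_add_sq_le_two _ _
    have h4 := norm_avg_sq_le (gx - gm)
    simp only [Pi.sub_apply] at h4
    have h5 := norm_avg_sq_le_of_orthogonal (by omega) hzσ hzz
    calc _ ≤ ∑ i : Fin n, L ^ 2 * (η ^ 2 * (‖avg gx‖ ^ 2 + ‖avg z‖ ^ 2)) := by
          refine Finset.sum_le_sum fun i _ => (hgmL i).trans (le_of_eq ?_)
          rw [h1, norm_neg, norm_smul_sq, h2]
      _ = L ^ 2 * (η ^ 2 * (n * ‖avg gx‖ ^ 2 + n * ‖avg z‖ ^ 2)) := by simp; ring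
      _ ≤ _ := by
        gcongr
        have := mul_le_mul_of_nonneg_left h3 (by linarith : (0 : ℝ) ≤ n)
        linarith
  · refine (Finset.sum_le_sum fun i _ => hzσ i).trans ?_
    simp
  · rw [Finset.mul_sum]
    exact Finset.sum_le_sum fun i _ => heC i
  · rw [Finset.mul_sum, Finset.mul_sum, ← Finset.sum_add_distrib]
    refine Finset.sum_le_sum fun i _ => ?_
    have : y i - h i = (x i - h i) + (y i - x i) := by abel
    rw [this]; exact norm_add_sq_le_two _ _

end IsModeBasis

end Step


/-! ### An eigenbasis of the mixing matrix. -/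

namespace IsMixingMatrix

variable {n : ℕ} {G : SimpleGraph (Fin n)} {W : Matrix (Fin n) (Fin n) ℝ}

theorem col_sum (hW : IsMixingMatrix G W) (k : Fin n) : ∑ i, W i k = 1 := by
  rw [← hW.stochastic k]
  exact Finset.sum_congr rfl fun i _ => hW.symm.apply k i

/-- The eigenvalues of a symmetric stochastic matrix are at least `-1`. -/
theorem neg_one_le_of_eigenvector (hW : IsMixingMatrix G W) {v : Fin n → ℝ} {l : ℝ}
    (hv : ∑ i, v i * v i = 1) (he : ∀ k, ∑ i, v i * W i k = l * v k) : -1 ≤ l := by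
  have h1 : 0 ≤ ∑ i, ∑ k, W i k * (v i + v k) ^ 2 :=
    Finset.sum_nonneg fun i _ => Finset.sum_nonneg fun k _ =>
      mul_nonneg (hW.nonneg i k) (sq_nonneg _)
  have h2 : ∑ i, ∑ k, W i k * (v i + v k) ^ 2
      = (∑ i, ∑ k, W i k * (v i * v i)) + 2 * (∑ i, ∑ k, v i * W i k * v k)
        + ∑ i, ∑ k, W i k * (v k * v k) := by
    rw [Finset.mul_sum, ← Finset.sum_add_distrib, ← Finset.sum_add_distrib]
    refine Finset.sum_congr rfl fun i _ => ?_
    rw [Finset.mul_sum, ← Finset.sum_add_distrib, ← Finset.sum_add_distrib]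
    exact Finset.sum_congr rfl fun k _ => by ring
  have h3 : ∑ i, ∑ k, W i k * (v i * v i) = 1 := by
    simp_rw [← Finset.sum_mul, hW.stochastic, one_mul, hv]
  have h4 : ∑ i, ∑ k, W i k * (v k * v k) = 1 := by
    rw [Finset.sum_comm]
    simp_rw [← Finset.sum_mul, hW.col_sum, one_mul, hv]
  have h5 : ∑ i, ∑ k, v i * W i k * v k = l := by
    rw [Finset.sum_comm]
    simp_rw [← Finset.sum_mul, he, mul_assoc, ← Finset.mul_sum, hv, mul_one]
  rw [h2, h3, h4, h5] at h1
  linarith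

/-- Stochasticity shows that each eigenvector's coordinate sum is multiplied by 1 when W acts, so
the sum vanishes unless the eigenvalue is 1. Every index except that of the largest eigenvalue has
eigenvalue at most λ₂ < 1. The sums cannot all vanish, because the all-ones vector is nonzero; hence
the largest eigenvalue is 1. -/
theorem exists_isModeBasis (hW : IsMixingMatrix G W) (hn : 2 ≤ n) (hl : hW.lambda₂ hn < 1) :
    ∃ (O : Matrix (Fin n) (Fin n) ℝ) (lam : Fin n → ℝ) (j₀ : Fin n),
      IsModeBasis W O lam j₀ (hW.lambda₂ hn) := by
  classical
  set hH := hW.isHermitian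
  set bas := hH.eigenvectorBasis with hbas
  set eqv := Fintype.equivOfCardEq (Fintype.card_fin (Fintype.card (Fin n))) with heqv
  have hc : Fintype.card (Fin n) = n := Fintype.card_fin n
  -- This is definitional because `eqv` is the very reindexing used by `eigenvalues`; j₀ must be the
  -- image of position 0 under it.
  have hlam : ∀ j, hH.eigenvalues j = hH.eigenvalues₀ (eqv.symm j) := fun j => rfl
  set j₀ : Fin n := eqv ⟨0, by omega⟩ with hj₀
  have hinner : ∀ j k, ∑ i, bas j i * bas k i = if j = k then 1 else 0 := fun j k => by
    have := orthonormal_iff_ite.mp bas.orthonormal j k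
    rw [← this, PiLp.inner_apply]
    exact Finset.sum_congr rfl fun i _ => by simp [mul_comm]
  have heig : ∀ j k, ∑ i, bas j i * W i k = hH.eigenvalues j * bas j k := fun j k => by
    have h := congrFun (hH.mulVec_eigenvectorBasis j) k
    rw [Matrix.mulVec, dotProduct] at h
    simp only [Pi.smul_apply, smul_eq_mul] at h
    rw [← h]
    exact Finset.sum_congr rfl fun i _ => by rw [mul_comm, hW.symm.apply k i]
  have horth : ∀ i k, ∑ j, bas j i * bas j k = if i = k then 1 else 0 := by
    set M : Matrix (Fin n) (Fin n) ℝ := Matrix.of fun j i => bas j i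
    have h1 : M * M.transpose = 1 := by
      ext j k
      rw [Matrix.mul_apply, Matrix.one_apply]
      exact hinner j k
    have h2 : M.transpose * M = 1 := mul_eq_one_comm.mp h1
    intro i k
    have := congrFun (congrFun h2 i) k
    rw [Matrix.mul_apply, Matrix.one_apply] at this
    exact this
  have hle : ∀ j ≠ j₀, hH.eigenvalues j ≤ hW.lambda₂ hn := fun j hj => by
    rw [hlam]
    refine hH.eigenvalues₀_antitone ?_
    rw [Fin.le_def]
    by_contra hlt
    apply hj
    rw [hj₀, ← Equiv.symm_apply_eq]
    ext
    simp only at hlt ⊢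
    omega
  have hsum : ∀ j, hH.eigenvalues j * ∑ k, bas j k = ∑ k, bas j k := fun j => by
    rw [Finset.mul_sum]
    simp_rw [← heig]
    rw [Finset.sum_comm]
    simp_rw [← Finset.mul_sum, hW.stochastic, mul_one]
  have hzero : ∀ j ≠ j₀, ∑ k, bas j k = 0 := fun j hj => by
    have h1 := hle j hj
    have h2 := hsum j
    have h3 : (1 - hH.eigenvalues j) * ∑ k, bas j k = 0 := by linarith
    rcases mul_eq_zero.mp h3 with h | h
    · linarith
    · exact h
  refine ⟨fun j i => bas j i, hH.eigenvalues, j₀, horth, heig, ?_, hzero, hle, fun j =>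
    hW.neg_one_le_of_eigenvector (by simpa using hinner j j) (heig j)⟩
  have h0 : ∑ k, bas j₀ k ≠ 0 := by
    intro h
    have hall : ∀ j, ∑ k, bas j k = 0 := fun j => by
      by_cases hj : j = j₀
      · rw [hj, h]
      · exact hzero j hj
    have h1 : ∑ k, ∑ j, bas j j₀ * bas j k = 1 := by simp [horth]
    rw [Finset.sum_comm] at h1
    simp_rw [← Finset.mul_sum, hall] at h1
    simp at h1
  exact mul_right_cancel₀ h0 (by rw [hsum, one_mul])

end IsMixingMatrix

/-! ### Smooth functions -/

/-- Along the segment, f minus its quadratic model has a nonpositive derivative by the Lipschitz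
bound. Monotonicity is used instead of an integral of the gradient. -/
theorem sub_sub_inner_gradient_le {p : ℕ} {f : Vec p → ℝ} {L : ℝ} (hf : Differentiable ℝ f)
    (hL : ∀ x x', ‖gradient f x - gradient f x'‖ ≤ L * ‖x - x'‖) (x v : Vec p) :
    f (x + v) ≤ f x + inner ℝ (gradient f x) v + L / 2 * ‖v‖ ^ 2 := by
  set φ : ℝ → ℝ := fun t => f (x + t • v) - t * inner ℝ (gradient f x) v - L / 2 * t ^ 2 * ‖v‖ ^ 2
    with hφ
  have hd : ∀ t, HasDerivAt φ (inner ℝ (gradient f (x + t • v)) v - inner ℝ (gradient f x) v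
      - L * t * ‖v‖ ^ 2) t := by
    intro t
    have h1 : HasDerivAt (fun t : ℝ => x + t • v) v t := by
      simpa using ((hasDerivAt_id t).smul_const v).const_add x
    have h2 := (hf (x + t • v)).hasGradientAt.hasFDerivAt.comp_hasDerivAt t h1
    have h3 := ((hasDerivAt_id t).mul_const (inner ℝ (gradient f x) v))
    have h4 := (((hasDerivAt_id t).pow 2).const_mul (L / 2)).mul_const (‖v‖ ^ 2)
    refine ((h2.sub h3).sub h4).congr_deriv ?_
    rw [InnerProductSpace.toDual_apply_apply]
    simp only [id, Nat.cast_ofNat, Nat.add_one_sub_one, pow_one]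
    ring
  have hanti : AntitoneOn φ (Set.Icc 0 1) := by
    refine antitoneOn_of_deriv_nonpos (convex_Icc 0 1)
      (fun t _ => (hd t).continuousAt.continuousWithinAt)
      (fun t _ => (hd t).differentiableAt.differentiableWithinAt) fun t ht => ?_
    rw [interior_Icc] at ht
    rw [(hd t).deriv, ← inner_sub_left]
    have h1 := real_inner_le_norm (gradient f (x + t • v) - gradient f x) v
    have h2 := hL (x + t • v) x
    rw [add_sub_cancel_left, norm_smul, Real.norm_of_nonneg ht.1.le] at h2
    have h3 := mul_le_mul_of_nonneg_right h2 (norm_nonneg v)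
    nlinarith
  have h := hanti (Set.left_mem_Icc.mpr zero_le_one) (Set.right_mem_Icc.mpr zero_le_one) zero_le_one
  simp only [hφ, one_smul, zero_smul, add_zero] at h
  linarith

namespace IsSmoothBddBelow

variable {n p : ℕ} {f : Fin n → Vec p → ℝ} {L : ℝ} {fLow : Fin n → ℝ}

theorem hasGradientAt_avgObjective (hf : IsSmoothBddBelow f L fLow) (x : Vec p) :
    HasGradientAt (avgObjective f) (avg fun i => gradient (f i) x) x := by
  rw [hasGradientAt_iff_hasFDerivAt]
  have h1 : HasFDerivAt (fun x => ∑ i, f i x)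
      (∑ i, (InnerProductSpace.toDual ℝ (Vec p)) (gradient (f i) x)) x :=
    HasFDerivAt.fun_sum fun i _ => (hf.differentiable i x).hasGradientAt.hasFDerivAt
  refine (h1.const_mul (1 / (n : ℝ))).congr_fderiv ?_
  rw [avg_apply]
  simp [map_sum]

theorem gradient_avgObjective (hf : IsSmoothBddBelow f L fLow) (x : Vec p) :
    gradient (avgObjective f) x = avg fun i => gradient (f i) x :=
  (hf.hasGradientAt_avgObjective x).gradient

theorem gradient_avgObjective_lipschitz (hf : IsSmoothBddBelow f L fLow) (hn : 0 < n)
    (x x' : Vec p) :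
    ‖gradient (avgObjective f) x - gradient (avgObjective f) x'‖ ≤ L * ‖x - x'‖ := by
  have hn' : (0 : ℝ) < n := by exact_mod_cast hn
  rw [hf.gradient_avgObjective, hf.gradient_avgObjective, avg_apply, avg_apply, ← smul_sub,
    ← Finset.sum_sub_distrib, norm_smul, Real.norm_of_nonneg (by positivity)]
  calc _ ≤ 1 / (n : ℝ) * ∑ i : Fin n, L * ‖x - x'‖ := by
        gcongr
        exact (norm_sum_le _ _).trans (Finset.sum_le_sum fun i _ => hf.lipschitz i x x')
    _ = _ := by simp; field_simp

theorem avgObjective_descent (hf : IsSmoothBddBelow f L fLow) (hn : 0 < n) (x v : Vec p) :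
    avgObjective f (x + v)
      ≤ avgObjective f x + inner ℝ (gradient (avgObjective f) x) v + L / 2 * ‖v‖ ^ 2 :=
  sub_sub_inner_gradient_le (fun x => (hf.hasGradientAt_avgObjective x).differentiableAt)
    (hf.gradient_avgObjective_lipschitz hn) x v

theorem le_avgObjective (hf : IsSmoothBddBelow f L fLow) (x : Vec p) :
    (1 / (n : ℝ)) * ∑ i, fLow i ≤ avgObjective f x := by
  rw [avgObjective]
  gcongr with i
  exact hf.lower i x

theorem continuous_gradient (hf : IsSmoothBddBelow f L fLow) (i : Fin n) :
    Continuous (gradient (f i)) := by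
  refine (LipschitzWith.of_dist_le_mul (K := Real.toNNReal L) fun x y => ?_).continuous
  rw [dist_eq_norm, dist_eq_norm]
  refine (hf.lipschitz i x y).trans ?_
  gcongr
  exact Real.le_coe_toNNReal L

end IsSmoothBddBelow


/-! ### Independence turned into orthogonality. -/

section Probability

variable {Ω Ξ R : Type*} {p : ℕ}

/-- The intersections of an m₂-set with an m₃-set form a π-system generating m₂ ⊔ m₃, and on it the
product formula follows from the two assumed independences. -/
theorem _root_.ProbabilityTheory.Indep.sup_right {m₁ m₂ m₃ mΩ : MeasurableSpace Ω} {μ : Measure Ω}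
    [IsProbabilityMeasure μ] (h₁ : m₁ ≤ mΩ) (h₂ : m₂ ≤ mΩ) (h₃ : m₃ ≤ mΩ)
    (h12 : Indep m₁ m₂ μ) (h123 : Indep (m₁ ⊔ m₂) m₃ μ) : Indep m₁ (m₂ ⊔ m₃) μ := by
  set inters : Set (Set Ω) := {s | ∃ b c, MeasurableSet[m₂] b ∧ MeasurableSet[m₃] c ∧ s = b ∩ c}
  have hgen : m₂ ⊔ m₃ = MeasurableSpace.generateFrom inters := by
    apply le_antisymm
    · refine sup_le (fun s hs => ?_) (fun s hs => ?_)
      · exact MeasurableSpace.measurableSet_generateFrom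
          ⟨s, Set.univ, hs, MeasurableSet.univ, (Set.inter_univ s).symm⟩
      · exact MeasurableSpace.measurableSet_generateFrom
          ⟨Set.univ, s, MeasurableSet.univ, hs, (Set.univ_inter s).symm⟩
    · refine MeasurableSpace.generateFrom_le ?_
      rintro _ ⟨b, c, hb, hc, rfl⟩
      exact @MeasurableSet.inter _ (m₂ ⊔ m₃) _ _ ((le_sup_left : m₂ ≤ m₂ ⊔ m₃) _ hb)
        ((le_sup_right : m₃ ≤ m₂ ⊔ m₃) _ hc)
  have hpi : IsPiSystem inters := by
    rintro _ ⟨b, c, hb, hc, rfl⟩ _ ⟨b', c', hb', hc', rfl⟩ _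
    exact ⟨b ∩ b', c ∩ c', @MeasurableSet.inter _ m₂ _ _ hb hb',
      @MeasurableSet.inter _ m₃ _ _ hc hc', Set.inter_inter_inter_comm _ _ _ _⟩
  refine IndepSets.indep h₁ (sup_le h₂ h₃) (@MeasurableSpace.isPiSystem_measurableSet _ m₁) hpi
    (@MeasurableSpace.generateFrom_measurableSet _ m₁).symm hgen ?_
  rw [IndepSets_iff]
  rintro a _ ha ⟨b, c, hb, hc, rfl⟩
  have e1 := (Indep_iff _ _ _).mp h123 (a ∩ b) c
    (@MeasurableSet.inter _ (m₁ ⊔ m₂) _ _ ((le_sup_left : m₁ ≤ m₁ ⊔ m₂) _ ha)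
      ((le_sup_right : m₂ ≤ m₁ ⊔ m₂) _ hb)) hc
  have e2 := (Indep_iff _ _ _).mp h12 a b ha hb
  have e3 := (Indep_iff _ _ _).mp h123 b c ((le_sup_right : m₂ ≤ m₁ ⊔ m₂) _ hb) hc
  rw [← Set.inter_assoc, e1, e2, e3, mul_assoc]

theorem integrable_inner_of_memLp {mΩ : MeasurableSpace Ω} {μ : Measure Ω} {X Y : Ω → Vec p}
    (hX : MemLp X 2 μ) (hY : MemLp Y 2 μ) : Integrable (fun ω => inner ℝ (X ω) (Y ω)) μ :=
  (hX.norm.integrable_mul hY.norm).mono' (hX.1.inner hY.1)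
    (Filter.Eventually.of_forall fun _ => norm_inner_le_norm _ _)

variable [MeasurableSpace Ξ] [MeasurableSpace R]

theorem map_prodMk_of_indep {A : Type*} [MeasurableSpace A] {m mΩ : MeasurableSpace Ω}
    {μ : Measure Ω} [IsProbabilityMeasure μ] (hm : m ≤ mΩ) {U : Ω → A} {ζ : Ω → Ξ}
    (hU : Measurable[m] U) (hζ : Measurable ζ)
    (hind : Indep (MeasurableSpace.comap ζ inferInstance) m μ) :
    μ.map (fun ω => (U ω, ζ ω)) = (μ.map U).prod (μ.map ζ) := by
  have h : IndepFun U ζ μ := by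
    rw [IndepFun_iff_Indep]
    exact (indep_of_indep_of_le_right hind (measurable_iff_comap_le.mp hU)).symm
  exact h.map_prod_eq_prod_map_map (hU.mono hm le_rfl).aemeasurable hζ.aemeasurable

/-- A fresh noise term with vanishing conditional mean is orthogonal to the past. -/
theorem integral_inner_eq_zero_of_indep {m mΩ : MeasurableSpace Ω} {μ : Measure Ω}
    [IsProbabilityMeasure μ] (hm : m ≤ mΩ) {X Z : Ω → Vec p} {ζ : Ω → Ξ} {φ : Vec p → Ξ → Vec p}
    (hφ : Measurable (Function.uncurry φ)) (hX : Measurable[m] X) (hZ : Measurable[m] Z)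
    (hζ : Measurable ζ) (hind : Indep (MeasurableSpace.comap ζ inferInstance) m μ)
    (hZ2 : MemLp Z 2 μ) (hφ2 : MemLp (fun ω => φ (X ω) (ζ ω)) 2 μ)
    (h0 : ∀ᵐ x ∂(μ.map X), ∫ s, φ x s ∂(μ.map ζ) = 0) :
    ∫ ω, inner ℝ (Z ω) (φ (X ω) (ζ ω)) ∂μ = 0 := by
  have hX' := hX.mono hm le_rfl
  have hZ' := hZ.mono hm le_rfl
  have hU : Measurable[m] fun ω => (X ω, Z ω) := hX.prodMk hZ
  have hlaw := map_prodMk_of_indep hm hU hζ hind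
  have hU' : Measurable fun ω => (X ω, Z ω) := hX'.prodMk hZ'
  have hp : Measurable fun ω => ((X ω, Z ω), ζ ω) := hU'.prodMk hζ
  set F : (Vec p × Vec p) × Ξ → ℝ := fun u => inner ℝ u.1.2 (φ u.1.1 u.2) with hF
  set Φ : (Vec p × Vec p) × Ξ → Vec p := fun u => φ u.1.1 u.2 with hΦ
  have hΦm : Measurable Φ :=
    hφ.comp ((measurable_fst.comp measurable_fst).prodMk measurable_snd)
  have hFm : Measurable F := (measurable_snd.comp measurable_fst).inner hΦm
  have hFi : Integrable F ((μ.map fun ω => (X ω, Z ω)).prod (μ.map ζ)) := by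
    rw [← hlaw, integrable_map_measure hFm.aestronglyMeasurable hp.aemeasurable]
    exact integrable_inner_of_memLp hZ2 hφ2
  have hΦi : Integrable Φ ((μ.map fun ω => (X ω, Z ω)).prod (μ.map ζ)) := by
    rw [← hlaw, integrable_map_measure hΦm.aestronglyMeasurable hp.aemeasurable]
    exact hφ2.integrable one_le_two
  have e1 : ∫ ω, inner ℝ (Z ω) (φ (X ω) (ζ ω)) ∂μ
      = ∫ u, F u ∂((μ.map fun ω => (X ω, Z ω)).prod (μ.map ζ)) := by
    rw [← hlaw, integral_map hp.aemeasurable hFm.aestronglyMeasurable]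
  have : IsProbabilityMeasure (μ.map ζ) := Measure.isProbabilityMeasure_map hζ.aemeasurable
  have : IsProbabilityMeasure (μ.map fun ω => (X ω, Z ω)) :=
    Measure.isProbabilityMeasure_map hU'.aemeasurable
  rw [e1, integral_prod _ hFi]
  -- The null set of exceptional x is pulled back along the first projection, so that Fubini can be
  -- applied with Z frozen as well.
  have h0' : ∀ᵐ u ∂(μ.map fun ω => (X ω, Z ω)), ∫ s, φ u.1 s ∂(μ.map ζ) = 0 := by
    have hfst : μ.map X = (μ.map fun ω => (X ω, Z ω)).map Prod.fst := by
      rw [Measure.map_map measurable_fst hU']; rfl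
    rw [hfst] at h0
    exact ae_of_ae_map measurable_fst.aemeasurable h0
  refine integral_eq_zero_of_ae ?_
  filter_upwards [h0', hΦi.prod_right_ae] with u hu1 hu2
  simp only [hF, Pi.zero_apply]
  rw [integral_inner hu2, hu1, inner_zero_right]

/-- The oracle is centred only given its evaluation point, whereas orthogonality to the entire past
is needed. As the sample is independent of the point, the conditional mean is the integral of φ(x,
·) against the law of the sample. Vanishing of that integral for almost every x no longer mentions
the conditioning and can be combined with independence of a larger σ-algebra. -/
theorem ae_integral_eq_zero_of_condExp {mΩ : MeasurableSpace Ω} {μ : Measure Ω}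
    [IsProbabilityMeasure μ] {X : Ω → Vec p} {ζ : Ω → Ξ} {φ : Vec p → Ξ → Vec p}
    (hφ : Measurable (Function.uncurry φ)) (hX : Measurable X) (hζ : Measurable ζ)
    (hlaw : μ.map (fun ω => (X ω, ζ ω)) = (μ.map X).prod (μ.map ζ))
    (hφi : Integrable (fun ω => φ (X ω) (ζ ω)) μ)
    (hc : μ[fun ω => φ (X ω) (ζ ω) | MeasurableSpace.comap X inferInstance] =ᵐ[μ] 0) :
    ∀ᵐ x ∂(μ.map X), ∫ s, φ x s ∂(μ.map ζ) = 0 := by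
  have : IsProbabilityMeasure (μ.map ζ) := Measure.isProbabilityMeasure_map hζ.aemeasurable
  have : IsProbabilityMeasure (μ.map X) := Measure.isProbabilityMeasure_map hX.aemeasurable
  have hp : Measurable fun ω => (X ω, ζ ω) := hX.prodMk hζ
  have hi : Integrable (Function.uncurry φ) ((μ.map X).prod (μ.map ζ)) := by
    rw [← hlaw, integrable_map_measure hφ.aestronglyMeasurable hp.aemeasurable]
    exact hφi
  refine hi.integral_prod_left.ae_eq_zero_of_forall_setIntegral_eq_zero fun A hA _ => ?_
  have e1 := setIntegral_prod (s := A) (t := Set.univ) _ hi.integrableOn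
  simp only [Measure.restrict_univ] at e1
  rw [← hlaw, setIntegral_map (hA.prod MeasurableSet.univ) hφ.aestronglyMeasurable
    hp.aemeasurable] at e1
  have e2 : (fun ω => (X ω, ζ ω)) ⁻¹' A ×ˢ Set.univ = X ⁻¹' A := by ext; simp
  rw [e2] at e1
  have e3 := setIntegral_condExp hX.comap_le hφi (s := X ⁻¹' A) ⟨A, hA, rfl⟩
  have e4 : ∫ ω in X ⁻¹' A, Function.uncurry φ (X ω, ζ ω) ∂μ = 0 := by
    refine e3.symm.trans ?_
    rw [setIntegral_congr_ae (g := fun _ => 0) (hX hA) (by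
      filter_upwards [hc] with ω h _ using h)]
    simp
  rw [e4] at e1
  exact e1.symm

/-- Independence makes the joint law of input and seed a product, so the variance bound for
deterministic inputs applies to each section and Tonelli integrates it. -/
theorem IsUnbiasedCompressor.memLp_error {m mΩ : MeasurableSpace Ω} {μ : Measure Ω}
    [IsProbabilityMeasure μ] {ν : Measure R} {comp : Vec p → R → Vec p} {C : ℝ}
    (hcomp : IsUnbiasedCompressor comp ν C) (hm : m ≤ mΩ) {V : Ω → Vec p} {r : Ω → R}
    (hV : Measurable[m] V) (hr : Measurable r) (hν : μ.map r = ν)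
    (hind : Indep (MeasurableSpace.comap r inferInstance) m μ) (hV2 : MemLp V 2 μ) :
    MemLp (fun ω => comp (V ω) (r ω) - V ω) 2 μ ∧
      ∫ ω, ‖comp (V ω) (r ω) - V ω‖ ^ 2 ∂μ ≤ C * ∫ ω, ‖V ω‖ ^ 2 ∂μ := by
  have hV' := hV.mono hm le_rfl
  have hlaw := map_prodMk_of_indep hm hV hr hind
  have hp : Measurable fun ω => (V ω, r ω) := hV'.prodMk hr
  have : IsProbabilityMeasure (μ.map V) := Measure.isProbabilityMeasure_map hV'.aemeasurable
  have : IsProbabilityMeasure ν := hν ▸ Measure.isProbabilityMeasure_map hr.aemeasurable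
  rw [hν] at hlaw
  have hdm : Measurable fun u : Vec p × R => comp u.1 u.2 - u.1 :=
    hcomp.measurable.sub measurable_fst
  have hFm : Measurable fun u : Vec p × R => ‖comp u.1 u.2 - u.1‖ ^ 2 := hdm.norm.pow_const 2
  have hsq : Integrable (fun v : Vec p => ‖v‖ ^ 2) (μ.map V) := by
    rw [integrable_map_measure (by fun_prop) hV'.aemeasurable]
    exact hV2.integrable_norm_pow two_ne_zero
  have hsec : ∀ v, Integrable (fun r => ‖comp v r - v‖ ^ 2) ν := fun v =>
    ((hcomp.memLp v).sub (memLp_const v)).integrable_norm_pow two_ne_zero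
  have hFi : Integrable (fun u : Vec p × R => ‖comp u.1 u.2 - u.1‖ ^ 2) ((μ.map V).prod ν) := by
    rw [integrable_prod_iff hFm.aestronglyMeasurable]
    refine ⟨Filter.Eventually.of_forall hsec, ?_⟩
    refine (hsq.const_mul C).mono' ?_ (Filter.Eventually.of_forall fun v => ?_)
    · exact (hFm.norm.stronglyMeasurable.integral_prod_right').aestronglyMeasurable
    · simp only [norm_pow, norm_norm]
      rw [Real.norm_of_nonneg (integral_nonneg fun _ => by positivity)]
      exact hcomp.variance v
  have hFμ : Integrable (fun ω => ‖comp (V ω) (r ω) - V ω‖ ^ 2) μ := by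
    rw [← hlaw, integrable_map_measure hFm.aestronglyMeasurable hp.aemeasurable] at hFi
    exact hFi
  refine ⟨(memLp_two_iff_integrable_sq_norm (hdm.comp hp).aestronglyMeasurable).mpr hFμ, ?_⟩
  calc ∫ ω, ‖comp (V ω) (r ω) - V ω‖ ^ 2 ∂μ
      = ∫ u, ‖comp u.1 u.2 - u.1‖ ^ 2 ∂((μ.map V).prod ν) := by
        rw [← hlaw, integral_map hp.aemeasurable hFm.aestronglyMeasurable]
    _ = ∫ v, ∫ r, ‖comp v r - v‖ ^ 2 ∂ν ∂(μ.map V) := integral_prod _ hFi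
    _ ≤ ∫ v, C * ‖v‖ ^ 2 ∂(μ.map V) :=
        integral_mono hFi.integral_prod_left (hsq.const_mul C) hcomp.variance
    _ = C * ∫ ω, ‖V ω‖ ^ 2 ∂μ := by
        rw [integral_const_mul, integral_map hV'.aemeasurable (by fun_prop)]

theorem IsUnbiasedCompressor.integral_inner_error {m mΩ : MeasurableSpace Ω} {μ : Measure Ω}
    [IsProbabilityMeasure μ] {ν : Measure R} {comp : Vec p → R → Vec p} {C : ℝ}
    (hcomp : IsUnbiasedCompressor comp ν C) (hm : m ≤ mΩ) {V Z : Ω → Vec p} {r : Ω → R}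
    (hV : Measurable[m] V) (hZ : Measurable[m] Z) (hr : Measurable r) (hν : μ.map r = ν)
    (hind : Indep (MeasurableSpace.comap r inferInstance) m μ) (hV2 : MemLp V 2 μ)
    (hZ2 : MemLp Z 2 μ) :
    ∫ ω, inner ℝ (Z ω) (comp (V ω) (r ω) - V ω) ∂μ = 0 := by
  have : IsProbabilityMeasure ν := hν ▸ Measure.isProbabilityMeasure_map hr.aemeasurable
  refine integral_inner_eq_zero_of_indep (φ := fun v s => comp v s - v) hm
    (hcomp.measurable.sub measurable_fst) hV hZ hr hind hZ2
    (hcomp.memLp_error hm hV hr hν hind hV2).1 (Filter.Eventually.of_forall fun v => ?_)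
  rw [hν, integral_sub ((hcomp.memLp v).integrable one_le_two) (integrable_const v),
    hcomp.unbiased, integral_const]
  simp

end Probability

/-! ### The space of square-integrable random vectors -/

section SquareIntegrable

variable {Ω : Type*} {mΩ : MeasurableSpace Ω}

/-- The square-integrable random vectors. -/
def SqInt (μ : Measure Ω) (p : ℕ) : Submodule ℝ (Ω → Vec p) where
  carrier := {X | MemLp X 2 μ}
  add_mem' hX hY := hX.add hY
  zero_mem' := MemLp.zero
  smul_mem' c _ hX := hX.const_smul c

variable {μ : Measure Ω} {p : ℕ}

/-- Functions are not identified when almost everywhere equal. The form is then only semidefinite,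
but measurability with respect to a sub-σ-algebra and pointwise identities of the algorithm apply to
the vectors directly; the abstract lemmas accordingly assume only a seminorm. -/
noncomputable instance : PreInnerProductSpace.Core ℝ (SqInt μ p) where
  inner X Y := ∫ ω, inner ℝ (X.1 ω) (Y.1 ω) ∂μ
  conj_inner_symm X Y := by
    simp only [conj_trivial]
    exact integral_congr_ae (Filter.Eventually.of_forall fun ω => real_inner_comm _ _)
  re_inner_nonneg X := integral_nonneg fun ω => real_inner_self_nonneg
  add_left X Y Z := by
    rw [← integral_add (integrable_inner_of_memLp X.2 Z.2) (integrable_inner_of_memLp Y.2 Z.2)]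
    exact integral_congr_ae (Filter.Eventually.of_forall fun ω => inner_add_left _ _ _)
  smul_left X Y r := by
    simp only [conj_trivial]
    rw [← integral_const_mul]
    exact integral_congr_ae (Filter.Eventually.of_forall fun ω => real_inner_smul_left _ _ _)

noncomputable instance : SeminormedAddCommGroup (SqInt μ p) :=
  InnerProductSpace.Core.toSeminormedAddCommGroup (𝕜 := ℝ)

noncomputable instance : InnerProductSpace ℝ (SqInt μ p) := InnerProductSpace.ofCore inferInstance

theorem SqInt.inner_def (X Y : SqInt μ p) : inner ℝ X Y = ∫ ω, inner ℝ (X.1 ω) (Y.1 ω) ∂μ := rfl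

theorem SqInt.norm_sq (X : SqInt μ p) : ‖X‖ ^ 2 = ∫ ω, ‖X.1 ω‖ ^ 2 ∂μ := by
  rw [← real_inner_self_eq_norm_sq, SqInt.inner_def]
  simp only [real_inner_self_eq_norm_sq]

theorem SqInt.integrable_norm_sq (X : SqInt μ p) : Integrable (fun ω => ‖X.1 ω‖ ^ 2) μ :=
  MemLp.integrable_norm_pow X.2 two_ne_zero

/-- The square-integrable random vectors that are measurable with respect to `m`. -/
def SqInt.measurableSubmodule (μ : Measure Ω) (p : ℕ) (m : MeasurableSpace Ω) :
    Submodule ℝ (SqInt μ p) where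
  carrier := {X | Measurable[m] X.1}
  add_mem' {X Y} hX hY := by
    change Measurable[m] X.1 at hX
    change Measurable[m] Y.1 at hY
    exact hX.add hY
  zero_mem' := @measurable_const _ _ _ m 0
  smul_mem' c X hX := by
    change Measurable[m] X.1 at hX
    exact hX.const_smul c

theorem SqInt.measurableSubmodule_mono {m m' : MeasurableSpace Ω} (h : m ≤ m') :
    SqInt.measurableSubmodule μ p m ≤ SqInt.measurableSubmodule μ p m' :=
  fun _ hX => Measurable.mono hX h le_rfl

end SquareIntegrable


/-! ### One iteration in terms of the compression error -/

section Recursion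

variable {n p : ℕ} {Ξ R : Type*} {W : Matrix (Fin n) (Fin n) ℝ} {g : Fin n → Vec p → Ξ → Vec p}
  {comp : Vec p → R → Vec p} {η γ α : ℝ}

/-- The vectors that the agents compress, before subtracting `h`. -/
noncomputable def localUpdate (g : Fin n → Vec p → Ξ → Vec p) (η : ℝ) (S : State n p) (s : Fin n → Ξ) :
    Fin n → Vec p :=
  fun i => S.x i - η • g i (S.x i) (s i) - S.d i

/-- The compression errors. -/
noncomputable def compressionError (g : Fin n → Vec p → Ξ → Vec p) (comp : Vec p → R → Vec p) (η : ℝ)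
    (S : State n p) (s : Fin n → Ξ) (r : Fin n → R) : Fin n → Vec p :=
  fun i => comp (localUpdate g η S s i - S.h i) (r i) - (localUpdate g η S s i - S.h i)

theorem step_h (S : State n p) (s : Fin n → Ξ) (r : Fin n → R) (i : Fin n) :
    (step W g comp η γ α S s r).h i = S.h i + α • (localUpdate g η S s i - S.h i)
      + α • compressionError g comp η S s r i := by
  simp only [step, communicate, compressionError, localUpdate]
  module

theorem step_hw (S : State n p) (s : Fin n → Ξ) (r : Fin n → R)
    (hS : ∀ i, S.hw i = ∑ j, W i j • S.h j) (i : Fin n) :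
    (step W g comp η γ α S s r).hw i = ∑ j, W i j • (step W g comp η γ α S s r).h j := by
  simp only [step, communicate, hS, smul_add, Finset.sum_add_distrib, smul_comm (W i _),
    ← Finset.smul_sum]

/-- Here ŷ = y + e, and the invariant for h_w gives ŷ_w = W(y + e), so the dual increment is 𝓛(y +
e). -/
theorem step_d (S : State n p) (s : Fin n → Ξ) (r : Fin n → R)
    (hS : ∀ i, S.hw i = ∑ j, W i j • S.h j) (i : Fin n) :
    (step W g comp η γ α S s r).d i = S.d i + laplace W γ (localUpdate g η S s) i
      + laplace W γ (compressionError g comp η S s r) i := by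
  simp only [step, communicate, compressionError, hS, laplace, smul_sub, Finset.sum_sub_distrib,
    localUpdate, smul_add]
  abel

theorem step_x (S : State n p) (s : Fin n → Ξ) (r : Fin n → R)
    (hS : ∀ i, S.hw i = ∑ j, W i j • S.h j) (i : Fin n) :
    (step W g comp η γ α S s r).x i = localUpdate g η S s i
      - laplace W γ (localUpdate g η S s) i
      - laplace W γ (compressionError g comp η S s r) i := by
  have h1 : (step W g comp η γ α S s r).x i
      = S.x i - η • g i (S.x i) (s i) - (step W g comp η γ α S s r).d i := rfl
  rw [h1, step_d S s r hS, localUpdate]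
  abel

theorem state_hw (xinit hinit : Fin n → Vec p) (s : ℕ → Fin n → Ξ) (r : ℕ → Fin n → R) (k : ℕ)
    (i : Fin n) : (state W g comp η γ α xinit hinit s r k).hw i
      = ∑ j, W i j • (state W g comp η γ α xinit hinit s r k).h j := by
  induction k generalizing i with
  | zero => rfl
  | succ k ih => exact step_hw _ _ _ ih i

end Recursion

/-! ### Histories -/

section History

variable {n p : ℕ} {Ω Ξ R : Type*} [MeasurableSpace Ξ] [MeasurableSpace R]

/-- The information carried by the gradient samples with index in `T`. -/
abbrev sampleAlg (ξ : ℕ → Fin n → Ω → Ξ) (T : Set (ℕ × Fin n)) : MeasurableSpace Ω :=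
  ⨆ a ∈ T, MeasurableSpace.comap (ξ a.1 a.2) inferInstance

/-- The information carried by the compression seeds of the iterations in `T`. -/
abbrev seedAlg (ρ : ℕ → Fin n → Ω → R) (T : Set ℕ) : MeasurableSpace Ω :=
  ⨆ k ∈ T, MeasurableSpace.comap (fun ω i => ρ k i ω) inferInstance

theorem sampleAlg_mono (ξ : ℕ → Fin n → Ω → Ξ) {T T' : Set (ℕ × Fin n)} (h : T ⊆ T') :
    sampleAlg ξ T ≤ sampleAlg ξ T' :=
  biSup_mono h

theorem seedAlg_mono (ρ : ℕ → Fin n → Ω → R) {T T' : Set ℕ} (h : T ⊆ T') :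
    seedAlg ρ T ≤ seedAlg ρ T' :=
  biSup_mono h

theorem measurable_sampleAlg (ξ : ℕ → Fin n → Ω → Ξ) {T : Set (ℕ × Fin n)} {t : ℕ} {i : Fin n}
    (h : (t, i) ∈ T) : Measurable[sampleAlg ξ T] (ξ t i) :=
  measurable_iff_comap_le.mpr
    (le_biSup (fun a : ℕ × Fin n => MeasurableSpace.comap (ξ a.1 a.2) inferInstance) h)

theorem measurable_seedAlg (ρ : ℕ → Fin n → Ω → R) {T : Set ℕ} {k : ℕ} (h : k ∈ T) (i : Fin n) :
    Measurable[seedAlg ρ T] (ρ k i) :=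
  (measurable_pi_apply i).comp (measurable_iff_comap_le.mpr
    (le_biSup (fun k => MeasurableSpace.comap (fun ω i => ρ k i ω) inferInstance) h))

/-- The history that determines the variables at the beginning of iteration `k`. -/
abbrev history (ξ : ℕ → Fin n → Ω → Ξ) (ρ : ℕ → Fin n → Ω → R) (k : ℕ) : MeasurableSpace Ω :=
  sampleAlg ξ {a | a.1 ≤ k} ⊔ seedAlg ρ {l | l < k}

theorem history_mono (ξ : ℕ → Fin n → Ω → Ξ) (ρ : ℕ → Fin n → Ω → R) {k l : ℕ} (h : k ≤ l) :
    history ξ ρ k ≤ history ξ ρ l :=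
  sup_le_sup (sampleAlg_mono ξ fun _ ha => le_trans ha h)
    (seedAlg_mono ρ fun _ ha => lt_of_lt_of_le ha h)

namespace IsFreshRandomness

variable {mΩ : MeasurableSpace Ω} {μ : Measure Ω} {ν : Measure R}
  {ξ : ℕ → Fin n → Ω → Ξ} {ρ : ℕ → Fin n → Ω → R}

theorem sampleAlg_le (hr : IsFreshRandomness μ ν ξ ρ) (T : Set (ℕ × Fin n)) :
    sampleAlg ξ T ≤ mΩ :=
  iSup₂_le fun a _ => (hr.measurable_sample a.1 a.2).comap_le

theorem measurable_seed_pi (hr : IsFreshRandomness μ ν ξ ρ) (k : ℕ) :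
    Measurable fun ω i => ρ k i ω :=
  measurable_pi_iff.mpr fun i => hr.measurable_seed k i

theorem seedAlg_le (hr : IsFreshRandomness μ ν ξ ρ) (T : Set ℕ) : seedAlg ρ T ≤ mΩ :=
  iSup₂_le fun k _ => (hr.measurable_seed_pi k).comap_le

theorem indep_sampleAlg_seedAlg (hr : IsFreshRandomness μ ν ξ ρ) (T : Set (ℕ × Fin n))
    (T' : Set ℕ) : Indep (sampleAlg ξ T) (seedAlg ρ T') μ := by
  have h := (IndepFun_iff_Indep _ _ _).mp hr.indep_sample_seed
  refine indep_of_indep_of_le h (iSup₂_le fun a _ => ?_) (iSup₂_le fun k _ => ?_)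
  · rw [← measurable_iff_comap_le]
    exact (measurable_pi_apply a.2).comp ((measurable_pi_apply a.1).comp
      (comap_measurable fun ω t i => ξ t i ω))
  · rw [← measurable_iff_comap_le]
    exact (measurable_pi_apply k).comp (comap_measurable fun ω k i => ρ k i ω)

variable [IsProbabilityMeasure μ]

/-- The complement includes the samples of other agents at the same iteration, so this yields
orthogonality both to the past and between agents. -/
theorem indep_sample_others (hr : IsFreshRandomness μ ν ξ ρ) (t : ℕ) (i : Fin n) :
    Indep (MeasurableSpace.comap (ξ t i) inferInstance)
      (sampleAlg ξ {(t, i)}ᶜ ⊔ seedAlg ρ Set.univ) μ := by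
  have e : sampleAlg ξ {(t, i)} = MeasurableSpace.comap (ξ t i) inferInstance := by
    simp [sampleAlg]
  rw [← e]
  refine Indep.sup_right (hr.sampleAlg_le _) (hr.sampleAlg_le _) (hr.seedAlg_le _) ?_ ?_
  · have hi : iIndep (fun a : ℕ × Fin n => MeasurableSpace.comap (ξ a.1 a.2) inferInstance) μ :=
      hr.indep_sample
    have hle : ∀ a : ℕ × Fin n, MeasurableSpace.comap (ξ a.1 a.2) inferInstance ≤ mΩ :=
      fun a => (hr.measurable_sample a.1 a.2).comap_le
    exact indep_iSup_of_disjoint hle hi (S := {(t, i)}) (T := {(t, i)}ᶜ) disjoint_compl_right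
  · refine indep_of_indep_of_le_left (hr.indep_sampleAlg_seedAlg Set.univ Set.univ) ?_
    exact sup_le (sampleAlg_mono ξ (Set.subset_univ _)) (sampleAlg_mono ξ (Set.subset_univ _))

/-- Seeds of different agents at one iteration may be dependent, so only seeds of strictly earlier
iterations are included, together with all gradient samples. -/
theorem indep_seed_past (hr : IsFreshRandomness μ ν ξ ρ) (k : ℕ) (i : Fin n) :
    Indep (MeasurableSpace.comap (ρ k i) inferInstance)
      (sampleAlg ξ Set.univ ⊔ seedAlg ρ {l | l < k}) μ := by
  have e : MeasurableSpace.comap (ρ k i) inferInstance ≤ seedAlg ρ {k} :=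
    measurable_iff_comap_le.mp (measurable_seedAlg ρ (Set.mem_singleton k) i)
  refine indep_of_indep_of_le_left ?_ e
  rw [sup_comm]
  refine Indep.sup_right (hr.seedAlg_le _) (hr.seedAlg_le _) (hr.sampleAlg_le _) ?_ ?_
  · have hi : iIndep (fun k => MeasurableSpace.comap (fun ω i => ρ k i ω) inferInstance) μ :=
      hr.indep_seed
    refine indep_iSup_of_disjoint (fun k => (hr.measurable_seed_pi k).comap_le) hi ?_
    rw [Set.disjoint_singleton_left]
    exact fun h => lt_irrefl k h
  · refine indep_of_indep_of_le_left (hr.indep_sampleAlg_seedAlg Set.univ Set.univ).symm ?_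
    exact sup_le (seedAlg_mono ρ (Set.subset_univ _)) (seedAlg_mono ρ (Set.subset_univ _))

end IsFreshRandomness

variable {m : MeasurableSpace Ω} {W : Matrix (Fin n) (Fin n) ℝ}
  {g : Fin n → Vec p → Ξ → Vec p} {comp : Vec p → R → Vec p} {η γ α : ℝ}

/-- Measurability of the components of a random state. -/
structure StateMeasurable (m : MeasurableSpace Ω) (S : Ω → State n p) : Prop where
  x : ∀ i, Measurable[m] fun ω => (S ω).x i
  d : ∀ i, Measurable[m] fun ω => (S ω).d i
  h : ∀ i, Measurable[m] fun ω => (S ω).h i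

theorem StateMeasurable.mono {m' : MeasurableSpace Ω} {S : Ω → State n p}
    (hS : StateMeasurable m S) (h : m ≤ m') : StateMeasurable m' S :=
  ⟨fun i => (hS.x i).mono h le_rfl, fun i => (hS.d i).mono h le_rfl,
    fun i => (hS.h i).mono h le_rfl⟩

theorem measurable_laplace {y : Ω → Fin n → Vec p} (hy : ∀ i, Measurable[m] fun ω => y ω i)
    (i : Fin n) : Measurable[m] fun ω => laplace W γ (y ω) i := by
  unfold laplace
  exact ((hy i).sub (Finset.measurable_fun_sum Finset.univ
    fun k _ => (hy k).const_smul (W i k))).const_smul (γ / 2)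

theorem measurable_localUpdate (hg : ∀ i, Measurable (Function.uncurry (g i)))
    {S : Ω → State n p} (hS : StateMeasurable m S) {s : Ω → Fin n → Ξ}
    (hs : ∀ i, Measurable[m] fun ω => s ω i) (i : Fin n) :
    Measurable[m] fun ω => localUpdate g η (S ω) (s ω) i :=
  ((hS.x i).sub (((hg i).comp ((hS.x i).prodMk (hs i))).const_smul η)).sub (hS.d i)

theorem measurable_compressionError (hg : ∀ i, Measurable (Function.uncurry (g i)))
    (hcomp : Measurable (Function.uncurry comp))
    {S : Ω → State n p} (hS : StateMeasurable m S) {s : Ω → Fin n → Ξ} {r : Ω → Fin n → R}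
    (hs : ∀ i, Measurable[m] fun ω => s ω i) (hr : ∀ i, Measurable[m] fun ω => r ω i) (i : Fin n) :
    Measurable[m] fun ω => compressionError g comp η (S ω) (s ω) (r ω) i := by
  have h1 := (measurable_localUpdate (η := η) hg hS hs i).sub (hS.h i)
  exact (hcomp.comp (h1.prodMk (hr i))).sub h1

theorem StateMeasurable.step (hg : ∀ i, Measurable (Function.uncurry (g i)))
    (hcomp : Measurable (Function.uncurry comp))
    {S : Ω → State n p} (hS : StateMeasurable m S) {s : Ω → Fin n → Ξ} {r : Ω → Fin n → R}
    (hs : ∀ i, Measurable[m] fun ω => s ω i) (hr : ∀ i, Measurable[m] fun ω => r ω i)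
    (hw : ∀ ω i, (S ω).hw i = ∑ j, W i j • (S ω).h j) :
    StateMeasurable m fun ω => step W g comp η γ α (S ω) (s ω) (r ω) := by
  have hy := measurable_localUpdate (η := η) hg hS hs
  have he := measurable_compressionError (η := η) hg hcomp hS hs hr
  refine ⟨fun i => ?_, fun i => ?_, fun i => ?_⟩
  · simp_rw [fun ω => step_x (γ := γ) (η := η) (α := α) (g := g) (comp := comp) (S ω) (s ω) (r ω)
      (hw ω)]
    exact ((hy i).sub (measurable_laplace hy i)).sub (measurable_laplace he i)
  · simp_rw [fun ω => step_d (γ := γ) (η := η) (α := α) (g := g) (comp := comp) (S ω) (s ω) (r ω)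
      (hw ω)]
    exact ((hS.d i).add (measurable_laplace hy i)).add (measurable_laplace he i)
  · simp_rw [step_h]
    exact ((hS.h i).add (((hy i).sub (hS.h i)).const_smul α)).add ((he i).const_smul α)

/-- The variables at the beginning of iteration `k` of a random run. -/
noncomputable def runState (W : Matrix (Fin n) (Fin n) ℝ) (g : Fin n → Vec p → Ξ → Vec p)
    (comp : Vec p → R → Vec p) (η γ α : ℝ) (xinit hinit : Fin n → Vec p)
    (ξ : ℕ → Fin n → Ω → Ξ) (ρ : ℕ → Fin n → Ω → R) (k : ℕ) (ω : Ω) : State n p :=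
  state W g comp η γ α xinit hinit (fun t i => ξ t i ω) (fun k i => ρ k i ω) k

theorem stateMeasurable_runState (hg : ∀ i, Measurable (Function.uncurry (g i)))
    (hcomp : Measurable (Function.uncurry comp)) (xinit hinit : Fin n → Vec p)
    (ξ : ℕ → Fin n → Ω → Ξ) (ρ : ℕ → Fin n → Ω → R) (k : ℕ) :
    StateMeasurable (history ξ ρ k) (runState W g comp η γ α xinit hinit ξ ρ k) := by
  induction k with
  | zero =>
    refine ⟨fun i => ?_, fun i => measurable_const, fun i => measurable_const⟩
    have h1 : Measurable[history ξ ρ 0] (ξ 0 i) :=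
      (measurable_sampleAlg ξ (T := {a | a.1 ≤ 0}) (le_refl 0)).mono le_sup_left le_rfl
    exact measurable_const.sub (((hg i).comp (measurable_const.prodMk h1)).const_smul η)
  | succ k ih =>
    refine (ih.mono (history_mono ξ ρ k.le_succ)).step hg hcomp
      (s := fun ω i => ξ (k + 1) i ω) (r := fun ω i => ρ k i ω) (fun i => ?_) (fun i => ?_)
      (fun ω i => state_hw _ _ _ _ _ _)
    · exact (measurable_sampleAlg ξ (T := {a | a.1 ≤ k + 1}) (le_refl (k + 1))).mono
        le_sup_left le_rfl
    · exact (measurable_seedAlg ρ (T := {l | l < k + 1}) (Nat.lt_succ_self k) i).mono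
        le_sup_right le_rfl

end History


/-! ### Second moments and orthogonality of the noise along a run. -/

section Run

variable {n p : ℕ} {Ω Ξ R : Type*} [MeasurableSpace Ξ] [MeasurableSpace R]
  {mΩ : MeasurableSpace Ω}

/-- The standing assumptions on a random run of the algorithm with iterates `x`. -/
structure IsRun (W : Matrix (Fin n) (Fin n) ℝ) (f : Fin n → Vec p → ℝ) (fLow : Fin n → ℝ) (L : ℝ)
    (g : Fin n → Vec p → Ξ → Vec p) (ν : Measure R) (comp : Vec p → R → Vec p) (C : ℝ)
    (μ : Measure Ω) (ξ : ℕ → Fin n → Ω → Ξ) (ρ : ℕ → Fin n → Ω → R)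
    (xinit hinit : Fin n → Vec p) (α γ η σ : ℝ) (x : ℕ → Fin n → Ω → Vec p) : Prop where
  smooth : IsSmoothBddBelow f L fLow
  compressor : IsUnbiasedCompressor comp ν C
  rand : IsFreshRandomness μ ν ξ ρ
  iter : ∀ t i ω, x t i ω = iterate W g comp η γ α xinit hinit
    (fun t i => ξ t i ω) (fun k i => ρ k i ω) t i
  oracle : IsStochasticGradient μ f g ξ x σ

theorem IsSmoothBddBelow.memLp_gradient {μ : Measure Ω} [IsProbabilityMeasure μ]
    {f : Fin n → Vec p → ℝ} {L : ℝ} {fLow : Fin n → ℝ} (hf : IsSmoothBddBelow f L fLow) (i : Fin n)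
    {X : Ω → Vec p} (hX : MemLp X 2 μ) : MemLp (fun ω => gradient (f i) (X ω)) 2 μ := by
  have h1 : MemLp (fun ω => gradient (f i) (X ω) - gradient (f i) 0) 2 μ := by
    refine hX.of_le_mul (c := L) ?_ (Filter.Eventually.of_forall fun ω => ?_)
    · exact ((hf.continuous_gradient i).comp_aestronglyMeasurable hX.1).sub
        aestronglyMeasurable_const
    · simpa using hf.lipschitz i (X ω) 0
  refine (memLp_congr_ae (Filter.Eventually.of_forall fun ω => ?_)).mp
    (h1.add (memLp_const (gradient (f i) 0)))
  exact sub_add_cancel _ _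

theorem memLp_laplace {μ : Measure Ω} (W : Matrix (Fin n) (Fin n) ℝ) (γ : ℝ) {X : Ω → Fin n → Vec p}
    (hX : ∀ i, MemLp (fun ω => X ω i) 2 μ) (i : Fin n) :
    MemLp (fun ω => laplace W γ (X ω) i) 2 μ := by
  unfold laplace
  exact ((hX i).sub (memLp_finsetSum _ fun k _ => (hX k).const_smul (W i k))).const_smul (γ / 2)

namespace IsRun

variable {W : Matrix (Fin n) (Fin n) ℝ} {f : Fin n → Vec p → ℝ} {fLow : Fin n → ℝ} {L : ℝ}
  {g : Fin n → Vec p → Ξ → Vec p} {ν : Measure R} {comp : Vec p → R → Vec p} {C : ℝ}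
  {μ : Measure Ω} [IsProbabilityMeasure μ] {ξ : ℕ → Fin n → Ω → Ξ} {ρ : ℕ → Fin n → Ω → R}
  {xinit hinit : Fin n → Vec p} {α γ η σ : ℝ} {x : ℕ → Fin n → Ω → Vec p}

omit [IsProbabilityMeasure μ] in
theorem x_zero (hr : IsRun W f fLow L g ν comp C μ ξ ρ xinit hinit α γ η σ x) (i : Fin n) (ω : Ω) :
    x 0 i ω = xinit i := hr.iter 0 i ω

omit [IsProbabilityMeasure μ] in
theorem x_succ (hr : IsRun W f fLow L g ν comp C μ ξ ρ xinit hinit α γ η σ x) (k : ℕ) (i : Fin n)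
    (ω : Ω) : x (k + 1) i ω = (runState W g comp η γ α xinit hinit ξ ρ k ω).x i :=
  hr.iter (k + 1) i ω

omit [IsProbabilityMeasure μ] in
theorem stateMeasurable (hr : IsRun W f fLow L g ν comp C μ ξ ρ xinit hinit α γ η σ x) (k : ℕ) :
    StateMeasurable (history ξ ρ k) (runState W g comp η γ α xinit hinit ξ ρ k) :=
  stateMeasurable_runState hr.oracle.measurable hr.compressor.measurable xinit hinit ξ ρ k

omit [IsProbabilityMeasure μ] in
theorem measurable_x (hr : IsRun W f fLow L g ν comp C μ ξ ρ xinit hinit α γ η σ x) (t : ℕ)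
    (i : Fin n) : Measurable[sampleAlg ξ {a | a.1 < t} ⊔ seedAlg ρ Set.univ] (x t i) := by
  cases t with
  | zero => simp_rw [funext (hr.x_zero i)]; exact measurable_const
  | succ k =>
    simp_rw [funext (hr.x_succ k i)]
    refine ((hr.stateMeasurable k).x i).mono (sup_le_sup (sampleAlg_mono ξ ?_) ?_) le_rfl
    · exact fun a ha => Nat.lt_succ_of_le ha
    · exact seedAlg_mono ρ (Set.subset_univ _)

omit [IsProbabilityMeasure μ] in
theorem others_le (hr : IsRun W f fLow L g ν comp C μ ξ ρ xinit hinit α γ η σ x)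
    (T : Set (ℕ × Fin n)) (T' : Set ℕ) : sampleAlg ξ T ⊔ seedAlg ρ T' ≤ mΩ :=
  sup_le (hr.rand.sampleAlg_le _) (hr.rand.seedAlg_le _)

/-- The gradient noise. -/
noncomputable def _root_.CEDAS.gradNoise (f : Fin n → Vec p → ℝ) (g : Fin n → Vec p → Ξ → Vec p)
    (ξ : ℕ → Fin n → Ω → Ξ) (x : ℕ → Fin n → Ω → Vec p) (t : ℕ) (i : Fin n) (ω : Ω) : Vec p :=
  g i (x t i ω) (ξ t i ω) - gradient (f i) (x t i ω)

theorem integral_gradNoise_sq_le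
    (hr : IsRun W f fLow L g ν comp C μ ξ ρ xinit hinit α γ η σ x) (t : ℕ) (i : Fin n) :
    ∫ ω, ‖gradNoise f g ξ x t i ω‖ ^ 2 ∂μ ≤ σ ^ 2 := by
  have hm := ((hr.measurable_x t i).mono (hr.others_le _ _) le_rfl).comap_le
  rw [← integral_condExp hm]
  refine (integral_mono_ae integrable_condExp (integrable_const (σ ^ 2))
    (hr.oracle.variance t i)).trans ?_
  simp

/-- The point x t i depends only on samples with index below t and on seeds, so the sample (t, i) is
fresh relative to the pair formed by that point and Z. -/
theorem integral_inner_gradNoise (hr : IsRun W f fLow L g ν comp C μ ξ ρ xinit hinit α γ η σ x)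
    (t : ℕ) (i : Fin n) (hxm : MemLp (x t i) 2 μ) {Z : Ω → Vec p}
    (hZ : Measurable[sampleAlg ξ {(t, i)}ᶜ ⊔ seedAlg ρ Set.univ] Z) (hZ2 : MemLp Z 2 μ) :
    ∫ ω, inner ℝ (Z ω) (gradNoise f g ξ x t i ω) ∂μ = 0 := by
  have hm := hr.others_le {(t, i)}ᶜ Set.univ
  have hX : Measurable[sampleAlg ξ {(t, i)}ᶜ ⊔ seedAlg ρ Set.univ] (x t i) := by
    refine (hr.measurable_x t i).mono (sup_le_sup (sampleAlg_mono ξ ?_) le_rfl) le_rfl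
    intro a ha h
    rw [Set.mem_singleton_iff.mp h] at ha
    exact lt_irrefl t ha
  have hφ : Measurable (Function.uncurry fun v s => g i v s - gradient (f i) v) :=
    (hr.oracle.measurable i).sub ((hr.smooth.continuous_gradient i).measurable.comp measurable_fst)
  have hind := hr.rand.indep_sample_others t i
  have hgrad := hr.smooth.memLp_gradient i hxm
  refine integral_inner_eq_zero_of_indep (φ := fun v s => g i v s - gradient (f i) v) hm hφ hX hZ (hr.rand.measurable_sample t i) hind hZ2
    (hr.oracle.memLp t i) ?_
  refine ae_integral_eq_zero_of_condExp (φ := fun v s => g i v s - gradient (f i) v) hφ (hX.mono hm le_rfl) (hr.rand.measurable_sample t i)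
    (map_prodMk_of_indep hm hX (hr.rand.measurable_sample t i) hind)
    ((hr.oracle.memLp t i).integrable one_le_two) ?_
  have hgi : Integrable (fun ω => g i (x t i ω) (ξ t i ω)) μ := by
    have := ((hr.oracle.memLp t i).add hgrad).integrable one_le_two
    refine this.congr (Filter.Eventually.of_forall fun ω => ?_)
    simp
  have hgrad_i := hgrad.integrable one_le_two
  have h1 := condExp_sub hgi hgrad_i (MeasurableSpace.comap (x t i) inferInstance)
  have hle := (hX.mono hm le_rfl).comap_le
  have h2 : μ[fun ω => gradient (f i) (x t i ω) | MeasurableSpace.comap (x t i) inferInstance]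
      = fun ω => gradient (f i) (x t i ω) :=
    condExp_of_stronglyMeasurable hle (((hr.smooth.continuous_gradient i).measurable.comp
      (comap_measurable (x t i))).stronglyMeasurable) hgrad_i
  filter_upwards [h1, hr.oracle.unbiased t i] with ω e1 e2
  refine e1.trans ?_
  rw [Pi.sub_apply, e2, h2, sub_self, Pi.zero_apply]

/-- The random points that the agents compress. -/
noncomputable def _root_.CEDAS.runUpdate (W : Matrix (Fin n) (Fin n) ℝ)
    (g : Fin n → Vec p → Ξ → Vec p)
    (comp : Vec p → R → Vec p) (η γ α : ℝ) (xinit hinit : Fin n → Vec p)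
    (ξ : ℕ → Fin n → Ω → Ξ) (ρ : ℕ → Fin n → Ω → R) (k : ℕ) (ω : Ω) : Fin n → Vec p :=
  localUpdate g η (runState W g comp η γ α xinit hinit ξ ρ k ω) fun i => ξ (k + 1) i ω

/-- The random compression errors. -/
noncomputable def _root_.CEDAS.runError (W : Matrix (Fin n) (Fin n) ℝ)
    (g : Fin n → Vec p → Ξ → Vec p)
    (comp : Vec p → R → Vec p) (η γ α : ℝ) (xinit hinit : Fin n → Vec p)
    (ξ : ℕ → Fin n → Ω → Ξ) (ρ : ℕ → Fin n → Ω → R) (k : ℕ) (ω : Ω) : Fin n → Vec p :=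
  compressionError g comp η (runState W g comp η γ α xinit hinit ξ ρ k ω)
    (fun i => ξ (k + 1) i ω) fun i => ρ k i ω

omit [IsProbabilityMeasure μ] in
theorem measurable_runUpdate_sub (hr : IsRun W f fLow L g ν comp C μ ξ ρ xinit hinit α γ η σ x)
    (k : ℕ) (i : Fin n) : Measurable[sampleAlg ξ Set.univ ⊔ seedAlg ρ {l | l < k}] fun ω =>
      runUpdate W g comp η γ α xinit hinit ξ ρ k ω i
        - (runState W g comp η γ α xinit hinit ξ ρ k ω).h i := by
  have hS := (hr.stateMeasurable k).mono
    (sup_le_sup (sampleAlg_mono ξ (Set.subset_univ _)) le_rfl :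
      history ξ ρ k ≤ sampleAlg ξ Set.univ ⊔ seedAlg ρ {l | l < k})
  exact (measurable_localUpdate hr.oracle.measurable hS
    (fun i => (measurable_sampleAlg ξ (Set.mem_univ (k + 1, i))).mono le_sup_left le_rfl) i).sub
    (hS.h i)

theorem memLp_runUpdate (hr : IsRun W f fLow L g ν comp C μ ξ ρ xinit hinit α γ η σ x)
    (k : ℕ) (hx : ∀ i, MemLp (x (k + 1) i) 2 μ)
    (hd : ∀ i, MemLp (fun ω => (runState W g comp η γ α xinit hinit ξ ρ k ω).d i) 2 μ) (i : Fin n) :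
    MemLp (fun ω => runUpdate W g comp η γ α xinit hinit ξ ρ k ω i) 2 μ := by
  have h1 := (((hx i).sub (((hr.oracle.memLp (k + 1) i).add
    (hr.smooth.memLp_gradient i (hx i))).const_smul η)).sub (hd i))
  refine (memLp_congr_ae (Filter.Eventually.of_forall fun ω => ?_)).mp h1
  simp only [Pi.sub_apply, Pi.add_apply, Pi.smul_apply, sub_add_cancel, runUpdate, localUpdate,
    hr.x_succ]

/-- Only the noise g - ∇f is assumed square-integrable. Lipschitz gradients supply the rest of the
update, and the compressor variance bound supplies the error, so the components have to be treated
in one induction. -/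
theorem memLp_state (hr : IsRun W f fLow L g ν comp C μ ξ ρ xinit hinit α γ η σ x) (k : ℕ) :
    (∀ i, MemLp (x (k + 1) i) 2 μ) ∧
    (∀ i, MemLp (fun ω => (runState W g comp η γ α xinit hinit ξ ρ k ω).d i) 2 μ) ∧
    (∀ i, MemLp (fun ω => (runState W g comp η γ α xinit hinit ξ ρ k ω).h i) 2 μ) := by
  induction k with
  | zero =>
    refine ⟨fun i => ?_, fun i => MemLp.zero, fun i => memLp_const _⟩
    have h1 := (memLp_const (xinit i)).sub (((hr.oracle.memLp 0 i).add
      (memLp_const (gradient (f i) (xinit i)))).const_smul η)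
    refine (memLp_congr_ae (Filter.Eventually.of_forall fun ω => ?_)).mp h1
    simp only [Pi.sub_apply, Pi.add_apply, Pi.smul_apply, hr.x_zero, hr.x_succ, sub_add_cancel]
    rfl
  | succ k ih =>
    obtain ⟨hx, hd, hh⟩ := ih
    have hy := hr.memLp_runUpdate k hx hd
    have he : ∀ i, MemLp (fun ω => runError W g comp η γ α xinit hinit ξ ρ k ω i) 2 μ := fun i =>
      (hr.compressor.memLp_error (hr.others_le _ _) (hr.measurable_runUpdate_sub k i)
        (hr.rand.measurable_seed k i) (hr.rand.law_seed k i) (hr.rand.indep_seed_past k i)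
        ((hy i).sub (hh i))).1
    refine ⟨fun i => ?_, fun i => ?_, fun i => ?_⟩
    · have h1 := ((hy i).sub (memLp_laplace W γ hy i)).sub (memLp_laplace W γ he i)
      refine (memLp_congr_ae (Filter.Eventually.of_forall fun ω => ?_)).mp h1
      rw [hr.x_succ]
      exact (step_x _ _ _ (state_hw _ _ _ _ k) i).symm
    · have h1 := ((hd i).add (memLp_laplace W γ hy i)).add (memLp_laplace W γ he i)
      refine (memLp_congr_ae (Filter.Eventually.of_forall fun ω => ?_)).mp h1
      exact (step_d _ _ _ (state_hw _ _ _ _ k) i).symm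
    · have h1 := ((hh i).add (((hy i).sub (hh i)).const_smul α)).add ((he i).const_smul α)
      refine (memLp_congr_ae (Filter.Eventually.of_forall fun ω => ?_)).mp h1
      exact (step_h _ _ _ i).symm

theorem memLp_x (hr : IsRun W f fLow L g ν comp C μ ξ ρ xinit hinit α γ η σ x) (t : ℕ) (i : Fin n) :
    MemLp (x t i) 2 μ := by
  cases t with
  | zero => rw [funext (hr.x_zero i)]; exact memLp_const _
  | succ k => exact (hr.memLp_state k).1 i

end IsRun

end Run


/-! ### The run as a sequence in the space of square-integrable vectors. -/

section Lift

variable {n p : ℕ} {Ω : Type*} {mΩ : MeasurableSpace Ω} {μ : Measure Ω}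

theorem SqInt.coe_mode (a : Fin n → ℝ) (V : Fin n → SqInt μ p) (ω : Ω) :
    (mode a V).1 ω = mode a fun i => (V i).1 ω := by
  simp [mode_apply, Finset.sum_apply]

theorem SqInt.coe_avg (V : Fin n → SqInt μ p) (ω : Ω) :
    (avg V).1 ω = avg fun i => (V i).1 ω :=
  SqInt.coe_mode _ V ω

theorem SqInt.coe_laplace (W : Matrix (Fin n) (Fin n) ℝ) (γ : ℝ) (V : Fin n → SqInt μ p) (i : Fin n)
    (ω : Ω) : (laplace W γ V i).1 ω = laplace W γ (fun i => (V i).1 ω) i := by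
  simp [laplace, Finset.sum_apply]

theorem SqInt.norm_sq_le_of_pointwise {A B : SqInt μ p} {L : ℝ}
    (h : ∀ ω, ‖A.1 ω‖ ≤ L * ‖B.1 ω‖) : ‖A‖ ^ 2 ≤ L ^ 2 * ‖B‖ ^ 2 := by
  rw [SqInt.norm_sq, SqInt.norm_sq, ← integral_const_mul]
  refine integral_mono (SqInt.integrable_norm_sq A) ((SqInt.integrable_norm_sq B).const_mul _) fun ω => ?_
  simp only [← mul_pow]
  exact pow_le_pow_left₀ (norm_nonneg _) (h ω) 2

end Lift

namespace IsRun

variable {n p : ℕ} {Ω Ξ R : Type*} [MeasurableSpace Ξ] [MeasurableSpace R]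
  {mΩ : MeasurableSpace Ω}
  {W : Matrix (Fin n) (Fin n) ℝ} {f : Fin n → Vec p → ℝ} {fLow : Fin n → ℝ} {L : ℝ}
  {g : Fin n → Vec p → Ξ → Vec p} {ν : Measure R} {comp : Vec p → R → Vec p} {C : ℝ}
  {μ : Measure Ω} [IsProbabilityMeasure μ] {ξ : ℕ → Fin n → Ω → Ξ} {ρ : ℕ → Fin n → Ω → R}
  {xinit hinit : Fin n → Vec p} {α γ η σ : ℝ} {x : ℕ → Fin n → Ω → Vec p}
  {O : Matrix (Fin n) (Fin n) ℝ} {lam : Fin n → ℝ} {j₀ : Fin n} {lam₂ : ℝ}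

/-- The iterates as square-integrable vectors. -/
def iterL (hr : IsRun W f fLow L g ν comp C μ ξ ρ xinit hinit α γ η σ x) (t : ℕ) (i : Fin n) :
    SqInt μ p := ⟨x t i, hr.memLp_x t i⟩

/-- The local gradients at the local iterates. -/
noncomputable def gradL (hr : IsRun W f fLow L g ν comp C μ ξ ρ xinit hinit α γ η σ x) (t : ℕ)
    (i : Fin n) : SqInt μ p :=
  ⟨fun ω => gradient (f i) (x t i ω), hr.smooth.memLp_gradient i (hr.memLp_x t i)⟩

/-- The local gradients at the average iterate. -/
noncomputable def gradAvgL (hr : IsRun W f fLow L g ν comp C μ ξ ρ xinit hinit α γ η σ x) (t : ℕ)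
    (i : Fin n) : SqInt μ p :=
  ⟨fun ω => gradient (f i) ((avg (hr.iterL t)).1 ω),
    hr.smooth.memLp_gradient i (avg (hr.iterL t)).2⟩

/-- The gradient noise. -/
noncomputable def noiseL (hr : IsRun W f fLow L g ν comp C μ ξ ρ xinit hinit α γ η σ x) (t : ℕ)
    (i : Fin n) : SqInt μ p :=
  ⟨gradNoise f g ξ x t i, hr.oracle.memLp t i⟩

/-- The dual variables. -/
noncomputable def dualL (hr : IsRun W f fLow L g ν comp C μ ξ ρ xinit hinit α γ η σ x) (k : ℕ)
    (i : Fin n) : SqInt μ p :=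
  ⟨fun ω => (runState W g comp η γ α xinit hinit ξ ρ k ω).d i, (hr.memLp_state k).2.1 i⟩

/-- The reference points of the compression. -/
noncomputable def refL (hr : IsRun W f fLow L g ν comp C μ ξ ρ xinit hinit α γ η σ x) (k : ℕ)
    (i : Fin n) : SqInt μ p :=
  ⟨fun ω => (runState W g comp η γ α xinit hinit ξ ρ k ω).h i, (hr.memLp_state k).2.2 i⟩

/-- The vectors to be communicated. -/
noncomputable def updateL (hr : IsRun W f fLow L g ν comp C μ ξ ρ xinit hinit α γ η σ x) (k : ℕ)
    (i : Fin n) : SqInt μ p :=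
  ⟨fun ω => runUpdate W g comp η γ α xinit hinit ξ ρ k ω i,
    hr.memLp_runUpdate k (hr.memLp_state k).1 (hr.memLp_state k).2.1 i⟩

/-- The compression errors. -/
noncomputable def errorL (hr : IsRun W f fLow L g ν comp C μ ξ ρ xinit hinit α γ η σ x) (k : ℕ)
    (i : Fin n) : SqInt μ p :=
  ⟨fun ω => runError W g comp η γ α xinit hinit ξ ρ k ω i,
    (hr.compressor.memLp_error (hr.others_le _ _) (hr.measurable_runUpdate_sub k i)
      (hr.rand.measurable_seed k i) (hr.rand.law_seed k i) (hr.rand.indep_seed_past k i)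
      (MemLp.sub (hr.updateL k i).2 (hr.refL k i).2)).1⟩

theorem updateL_eq (hr : IsRun W f fLow L g ν comp C μ ξ ρ xinit hinit α γ η σ x) (k : ℕ)
    (i : Fin n) : hr.updateL k i
      = hr.iterL (k + 1) i - η • (hr.gradL (k + 1) i + hr.noiseL (k + 1) i) - hr.dualL k i := by
  refine Subtype.ext (funext fun ω => ?_)
  change _ = x (k + 1) i ω - η • (gradient (f i) (x (k + 1) i ω) + gradNoise f g ξ x (k + 1) i ω)
    - (runState W g comp η γ α xinit hinit ξ ρ k ω).d i
  rw [gradNoise, add_sub_cancel, hr.x_succ]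
  rfl

theorem iterL_succ (hr : IsRun W f fLow L g ν comp C μ ξ ρ xinit hinit α γ η σ x) (k : ℕ) :
    hr.iterL (k + 2)
      = hr.updateL k - laplace W γ (hr.updateL k) - laplace W γ (hr.errorL k) := by
  refine funext fun i => Subtype.ext (funext fun ω => ?_)
  change x (k + 2) i ω = runUpdate W g comp η γ α xinit hinit ξ ρ k ω i
    - (laplace W γ (hr.updateL k) i).1 ω - (laplace W γ (hr.errorL k) i).1 ω
  rw [hr.x_succ, SqInt.coe_laplace, SqInt.coe_laplace]
  exact step_x _ _ _ (state_hw _ _ _ _ k) i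

theorem dualL_succ (hr : IsRun W f fLow L g ν comp C μ ξ ρ xinit hinit α γ η σ x) (k : ℕ) :
    hr.dualL (k + 1)
      = hr.dualL k + laplace W γ (hr.updateL k) + laplace W γ (hr.errorL k) := by
  refine funext fun i => Subtype.ext (funext fun ω => ?_)
  change _ = (runState W g comp η γ α xinit hinit ξ ρ k ω).d i
    + (laplace W γ (hr.updateL k) i).1 ω + (laplace W γ (hr.errorL k) i).1 ω
  rw [SqInt.coe_laplace, SqInt.coe_laplace]
  exact step_d _ _ _ (state_hw _ _ _ _ k) i

theorem refL_succ (hr : IsRun W f fLow L g ν comp C μ ξ ρ xinit hinit α γ η σ x) (k : ℕ)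
    (i : Fin n) : hr.refL (k + 1) i
      = hr.refL k i + α • (hr.updateL k i - hr.refL k i) + α • hr.errorL k i :=
  Subtype.ext (funext fun ω => step_h (W := W) (γ := γ)
    (runState W g comp η γ α xinit hinit ξ ρ k ω) (fun i => ξ (k + 1) i ω) (fun i => ρ k i ω) i)

theorem sum_dualL (hr : IsRun W f fLow L g ν comp C μ ξ ρ xinit hinit α γ η σ x)
    (hB : IsModeBasis W O lam j₀ lam₂) (k : ℕ) : ∑ i, hr.dualL k i = 0 := by
  induction k with
  | zero => exact Finset.sum_eq_zero fun i _ => Subtype.ext (funext fun _ => rfl)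
  | succ k ih =>
    rw [hr.dualL_succ]
    simp only [Pi.add_apply, Finset.sum_add_distrib]
    rw [ih, hB.sum_laplace, hB.sum_laplace, add_zero, add_zero]

theorem avg_iterL_succ (hr : IsRun W f fLow L g ν comp C μ ξ ρ xinit hinit α γ η σ x)
    (hB : IsModeBasis W O lam j₀ lam₂) (t : ℕ) :
    avg (hr.iterL (t + 1))
      = avg (hr.iterL t) - η • (avg (hr.gradL t) + avg (hr.noiseL t)) := by
  cases t with
  -- The initialization is a pure local gradient step without mixing, so it does not fall under
  -- `avg_step`.
  | zero =>
    have : hr.iterL 1 = hr.iterL 0 - η • (hr.gradL 0 + hr.noiseL 0) := by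
      refine funext fun i => Subtype.ext (funext fun ω => ?_)
      change x 1 i ω = x 0 i ω - η • (gradient (f i) (x 0 i ω) + gradNoise f g ξ x 0 i ω)
      rw [gradNoise, add_sub_cancel, hr.x_zero, hr.x_succ]
      rfl
    rw [this, map_sub, map_smul, map_add]
  | succ k =>
    rw [hr.iterL_succ]
    exact hB.avg_step (hr.updateL_eq k) (hr.sum_dualL hB k)

theorem norm_noiseL_sq_le (hr : IsRun W f fLow L g ν comp C μ ξ ρ xinit hinit α γ η σ x) (t : ℕ)
    (i : Fin n) : ‖hr.noiseL t i‖ ^ 2 ≤ σ ^ 2 := by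
  rw [SqInt.norm_sq]; exact hr.integral_gradNoise_sq_le t i

theorem inner_noiseL (hr : IsRun W f fLow L g ν comp C μ ξ ρ xinit hinit α γ η σ x) (t : ℕ)
    (i : Fin n) {Z : SqInt μ p}
    (hZ : Measurable[sampleAlg ξ {(t, i)}ᶜ ⊔ seedAlg ρ Set.univ] Z.1) :
    inner ℝ Z (hr.noiseL t i) = 0 :=
  hr.integral_inner_gradNoise t i (hr.memLp_x t i) hZ Z.2

theorem inner_noiseL_noiseL (hr : IsRun W f fLow L g ν comp C μ ξ ρ xinit hinit α γ η σ x) (t : ℕ)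
    (i k : Fin n) (hik : i ≠ k) : inner ℝ (hr.noiseL t i) (hr.noiseL t k) = 0 := by
  refine hr.inner_noiseL t k ?_
  have h1 : Measurable[sampleAlg ξ {(t, k)}ᶜ ⊔ seedAlg ρ Set.univ] (x t i) := by
    refine (hr.measurable_x t i).mono (sup_le_sup (sampleAlg_mono ξ ?_) le_rfl) le_rfl
    intro a ha h
    rw [Set.mem_singleton_iff.mp h] at ha
    exact lt_irrefl t ha
  have h2 : Measurable[sampleAlg ξ {(t, k)}ᶜ ⊔ seedAlg ρ Set.univ] (ξ t i) :=
    (measurable_sampleAlg ξ (T := {(t, k)}ᶜ) (fun h => hik (Prod.mk.inj h).2)).mono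
      le_sup_left le_rfl
  exact ((hr.oracle.measurable i).comp (h1.prodMk h2)).sub
    ((hr.smooth.continuous_gradient i).measurable.comp h1)

theorem iterL_mem (hr : IsRun W f fLow L g ν comp C μ ξ ρ xinit hinit α γ η σ x) (t : ℕ)
    (i : Fin n) : hr.iterL t i
      ∈ SqInt.measurableSubmodule μ p (sampleAlg ξ {a | a.1 < t} ⊔ seedAlg ρ Set.univ) :=
  hr.measurable_x t i

theorem gradL_mem (hr : IsRun W f fLow L g ν comp C μ ξ ρ xinit hinit α γ η σ x)
    {m : MeasurableSpace Ω} (t : ℕ) (i : Fin n)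
    (h : hr.iterL t i ∈ SqInt.measurableSubmodule μ p m) :
    hr.gradL t i ∈ SqInt.measurableSubmodule μ p m :=
  (hr.smooth.continuous_gradient i).measurable.comp h

theorem gradAvgL_mem (hr : IsRun W f fLow L g ν comp C μ ξ ρ xinit hinit α γ η σ x)
    {m : MeasurableSpace Ω} (t : ℕ) (i : Fin n)
    (h : avg (hr.iterL t) ∈ SqInt.measurableSubmodule μ p m) :
    hr.gradAvgL t i ∈ SqInt.measurableSubmodule μ p m :=
  (hr.smooth.continuous_gradient i).measurable.comp h

theorem norm_gradL_sub_gradAvgL_sq_le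
    (hr : IsRun W f fLow L g ν comp C μ ξ ρ xinit hinit α γ η σ x) (t : ℕ) (i : Fin n) :
    ‖hr.gradL t i - hr.gradAvgL t i‖ ^ 2 ≤ L ^ 2 * ‖hr.iterL t i - avg (hr.iterL t)‖ ^ 2 :=
  SqInt.norm_sq_le_of_pointwise fun _ => hr.smooth.lipschitz i _ _

theorem norm_gradAvgL_sub_sq_le
    (hr : IsRun W f fLow L g ν comp C μ ξ ρ xinit hinit α γ η σ x) (s t : ℕ) (i : Fin n) :
    ‖hr.gradAvgL t i - hr.gradAvgL s i‖ ^ 2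
      ≤ L ^ 2 * ‖avg (hr.iterL t) - avg (hr.iterL s)‖ ^ 2 :=
  SqInt.norm_sq_le_of_pointwise fun _ => hr.smooth.lipschitz i _ _

/-- The Lyapunov function. -/
noncomputable def lyapunov (hr : IsRun W f fLow L g ν comp C μ ξ ρ xinit hinit α γ η σ x)
    (O : Matrix (Fin n) (Fin n) ℝ) (lam : Fin n → ℝ) (j₀ : Fin n) (k : ℕ) : ℝ :=
  energy O lam j₀ γ η (hr.iterL (k + 1)) (hr.dualL k) (hr.gradAvgL (k + 1))
    + 4 * (γ * C) / α * ∑ i, ‖hr.iterL (k + 1) i - hr.refL k i‖ ^ 2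

theorem lyapunov_succ_le (hr : IsRun W f fLow L g ν comp C μ ξ ρ xinit hinit α γ η σ x)
    (hB : IsModeBasis W O lam j₀ lam₂)
    (hα0 : 0 < α) (hα1 : α ≤ 1) (hC : 0 < C) (hαC : α * C ≤ 1 / 12) (hγ : 0 < γ) (hγ2 : γ ≤ 1 / 2)
    (hl : lam₂ < 1) (hn : 2 ≤ n) (hγC : γ * C ≤ α ^ 2 * (1 - lam₂) / 1728)
    (hη : η ^ 2 * L ^ 2 ≤ (γ / 2 * (1 - lam₂)) ^ 2 / 64) (k : ℕ) :
    hr.lyapunov O lam j₀ (k + 1) ≤ hr.lyapunov O lam j₀ k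
      - γ / 2 * (1 - lam₂) / 4 * energy O lam j₀ γ η (hr.iterL (k + 1)) (hr.dualL k)
          (hr.gradAvgL (k + 1))
      + 1 / 4 * (η ^ 2 * (n * ‖avg (hr.gradAvgL (k + 1))‖ ^ 2)) + 2 * (η ^ 2 * (n * σ ^ 2)) := by
  have hS := hr.stateMeasurable k
  have hle : history ξ ρ k ≤ sampleAlg ξ Set.univ ⊔ seedAlg ρ {l | l < k} :=
    sup_le_sup (sampleAlg_mono ξ (Set.subset_univ _)) le_rfl
  have hx : ∀ i, hr.iterL (k + 1) i ∈ SqInt.measurableSubmodule μ p (history ξ ρ k) := fun i => by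
    change Measurable[history ξ ρ k] (x (k + 1) i)
    rw [funext (hr.x_succ k i)]
    exact hS.x i
  have hgx := fun i => hr.gradL_mem (k + 1) i (hx i)
  have hz : ∀ i, hr.noiseL (k + 1) i ∈ SqInt.measurableSubmodule μ p
      (sampleAlg ξ Set.univ ⊔ seedAlg ρ {l | l < k}) := fun i => by
    have h1 : Measurable[sampleAlg ξ Set.univ ⊔ seedAlg ρ {l | l < k}] (x (k + 1) i) :=
      Measurable.mono (hx i) hle le_rfl
    have h2 : Measurable[sampleAlg ξ Set.univ ⊔ seedAlg ρ {l | l < k}] (ξ (k + 1) i) :=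
      (measurable_sampleAlg ξ (Set.mem_univ (k + 1, i))).mono le_sup_left le_rfl
    exact ((hr.oracle.measurable i).comp (h1.prodMk h2)).sub
      ((hr.smooth.continuous_gradient i).measurable.comp h1)
  have hmono := SqInt.measurableSubmodule_mono (μ := μ) (p := p) hle
  -- The two stages of information are the history up to iteration k, and all gradient samples
  -- together with the seeds before k.
  have key := hB.lyapunov_step (η := η) (L := L) (σ := σ) (gm' := hr.gradAvgL (k + 2))
    (gm := hr.gradAvgL (k + 1))
    (S := SqInt.measurableSubmodule μ p (sampleAlg ξ Set.univ ⊔ seedAlg ρ {l | l < k}))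
    (Sz := SqInt.measurableSubmodule μ p (history ξ ρ k))
    hα0 hα1 hC hαC hγ hγ2 hl hn hγC hη (hr.updateL_eq k) (hr.sum_dualL hB k) (e := hr.errorL k)
    (h := hr.refL k) ?_ ?_ hmono hx hS.d hS.h hgx ?_ hz ?_ (hr.norm_noiseL_sq_le (k + 1))
    (hr.inner_noiseL_noiseL (k + 1)) ?_ (hr.norm_gradL_sub_gradAvgL_sq_le (k + 1)) ?_
  · rw [← hr.iterL_succ, ← hr.dualL_succ] at key
    simp only [← hr.refL_succ] at key
    exact key
  · intro s hs i
    refine hr.inner_noiseL (k + 1) i (Measurable.mono hs ?_ le_rfl)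
    refine sup_le_sup (sampleAlg_mono ξ fun a ha h => ?_) (seedAlg_mono ρ (Set.subset_univ _))
    rw [Set.mem_singleton_iff.mp h] at ha
    exact absurd ha (by simp)
  · intro s hs i
    exact hr.compressor.integral_inner_error (hr.others_le _ _) (hr.measurable_runUpdate_sub k i)
      hs (hr.rand.measurable_seed k i) (hr.rand.law_seed k i) (hr.rand.indep_seed_past k i)
      (MemLp.sub (hr.updateL k i).2 (hr.refL k i).2) s.2
  · exact fun i => hr.gradAvgL_mem (k + 1) i (mode_mem _ hx)
  -- The next average iterate is an SGD step, hence measurable before the compression seeds of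
  -- iteration k are drawn.
  · refine fun i => hr.gradAvgL_mem (k + 2) i ?_
    rw [hr.avg_iterL_succ hB]
    exact Submodule.sub_mem _ (hmono (mode_mem _ hx)) (Submodule.smul_mem _ _
      (Submodule.add_mem _ (hmono (mode_mem _ hgx)) (mode_mem _ hz)))
  · intro i
    rw [SqInt.norm_sq, SqInt.norm_sq]
    exact (hr.compressor.memLp_error (hr.others_le _ _) (hr.measurable_runUpdate_sub k i)
      (hr.rand.measurable_seed k i) (hr.rand.law_seed k i) (hr.rand.indep_seed_past k i)
      (MemLp.sub (hr.updateL k i).2 (hr.refL k i).2)).2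
  · rw [← hr.iterL_succ]
    exact hr.norm_gradAvgL_sub_sq_le (k + 1) (k + 2)

end IsRun


/-! ### Descent of the expected objective and the initial Lyapunov value. -/

theorem mean_eq_avg {n p : ℕ} (v : Fin n → Vec p) : mean v = avg v := (avg_apply v).symm

theorem IsSmoothBddBelow.continuous_avgObjective {n p : ℕ} {f : Fin n → Vec p → ℝ} {L : ℝ}
    {fLow : Fin n → ℝ} (hf : IsSmoothBddBelow f L fLow) : Continuous (avgObjective f) :=
  continuous_iff_continuousAt.mpr fun x => (hf.hasGradientAt_avgObjective x).continuousAt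

namespace IsRun

variable {n p : ℕ} {Ω Ξ R : Type*} [MeasurableSpace Ξ] [MeasurableSpace R]
  {mΩ : MeasurableSpace Ω}
  {W : Matrix (Fin n) (Fin n) ℝ} {f : Fin n → Vec p → ℝ} {fLow : Fin n → ℝ} {L : ℝ}
  {g : Fin n → Vec p → Ξ → Vec p} {ν : Measure R} {comp : Vec p → R → Vec p} {C : ℝ}
  {μ : Measure Ω} [IsProbabilityMeasure μ] {ξ : ℕ → Fin n → Ω → Ξ} {ρ : ℕ → Fin n → Ω → R}
  {xinit hinit : Fin n → Vec p} {α γ η σ : ℝ} {x : ℕ → Fin n → Ω → Vec p}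
  {O : Matrix (Fin n) (Fin n) ℝ} {lam : Fin n → ℝ} {j₀ : Fin n} {lam₂ : ℝ}

theorem avg_gradAvgL_apply (hr : IsRun W f fLow L g ν comp C μ ξ ρ xinit hinit α γ η σ x) (t : ℕ)
    (ω : Ω) : (avg (hr.gradAvgL t)).1 ω
      = gradient (avgObjective f) ((avg (hr.iterL t)).1 ω) := by
  rw [SqInt.coe_avg, hr.smooth.gradient_avgObjective]
  rfl

theorem gradient_mean_eq (hr : IsRun W f fLow L g ν comp C μ ξ ρ xinit hinit α γ η σ x) (t : ℕ)
    (ω : Ω) : gradient (avgObjective f) (mean fun i => x t i ω) = (avg (hr.gradAvgL t)).1 ω := by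
  rw [hr.avg_gradAvgL_apply, SqInt.coe_avg, mean_eq_avg]
  rfl

/-- The expected objective value at the average iterate. -/
noncomputable def meanObjective (hr : IsRun W f fLow L g ν comp C μ ξ ρ xinit hinit α γ η σ x)
    (t : ℕ) : ℝ :=
  ∫ ω, avgObjective f ((avg (hr.iterL t)).1 ω) ∂μ

/-- The objective lies between its lower bound and the quadratic model at the origin, and the latter
is integrable in a square-integrable argument. -/
theorem integrable_objective (hr : IsRun W f fLow L g ν comp C μ ξ ρ xinit hinit α γ η σ x)
    (hn : 0 < n) (t : ℕ) : Integrable (fun ω => avgObjective f ((avg (hr.iterL t)).1 ω)) μ := by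
  set X := avg (hr.iterL t)
  set c := (1 / (n : ℝ)) * ∑ i, fLow i
  have hX : MemLp X.1 2 μ := X.2
  have hin : Integrable (fun ω => inner ℝ (gradient (avgObjective f) 0) (X.1 ω)) μ :=
    integrable_inner_of_memLp (memLp_const _) hX
  have hup : Integrable (fun ω => avgObjective f 0 + inner ℝ (gradient (avgObjective f) 0) (X.1 ω)
      + L / 2 * ‖X.1 ω‖ ^ 2) μ :=
    ((integrable_const _).add hin).add ((SqInt.integrable_norm_sq X).const_mul _)
  refine (hup.abs.add (integrable_const |c|)).mono'
    (hr.smooth.continuous_avgObjective.comp_aestronglyMeasurable hX.1)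
    (Filter.Eventually.of_forall fun ω => ?_)
  have h1 := hr.smooth.avgObjective_descent hn 0 (X.1 ω)
  rw [zero_add] at h1
  have h2 := hr.smooth.le_avgObjective (X.1 ω)
  simp only [Pi.add_apply, Real.norm_eq_abs]
  rw [abs_le]
  constructor
  · have := neg_abs_le c
    have := abs_nonneg (avgObjective f 0 + inner ℝ (gradient (avgObjective f) 0) (X.1 ω)
      + L / 2 * ‖X.1 ω‖ ^ 2)
    linarith
  · have := abs_nonneg c
    have := le_abs_self (avgObjective f 0 + inner ℝ (gradient (avgObjective f) 0) (X.1 ω)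
      + L / 2 * ‖X.1 ω‖ ^ 2)
    linarith

theorem le_meanObjective (hr : IsRun W f fLow L g ν comp C μ ξ ρ xinit hinit α γ η σ x)
    (hn : 0 < n) (t : ℕ) : (1 / (n : ℝ)) * ∑ i, fLow i ≤ hr.meanObjective t := by
  have := integral_mono (μ := μ) (integrable_const ((1 / (n : ℝ)) * ∑ i, fLow i))
    (hr.integrable_objective hn t) fun ω => hr.smooth.le_avgObjective _
  rw [integral_const, probReal_univ, one_smul] at this
  exact this

theorem meanObjective_zero (hr : IsRun W f fLow L g ν comp C μ ξ ρ xinit hinit α γ η σ x) :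
    hr.meanObjective 0 = avgObjective f (mean xinit) := by
  have : ∀ ω, (avg (hr.iterL 0)).1 ω = mean xinit := fun ω => by
    rw [SqInt.coe_avg, mean_eq_avg]
    exact congrArg avg (funext fun i => hr.x_zero i ω)
  simp [meanObjective, this]

theorem inner_avg_noiseL (hr : IsRun W f fLow L g ν comp C μ ξ ρ xinit hinit α γ η σ x) (t : ℕ)
    {Z : SqInt μ p}
    (hZ : Z ∈ SqInt.measurableSubmodule μ p (sampleAlg ξ {a | a.1 < t} ⊔ seedAlg ρ Set.univ)) :
    inner ℝ Z (avg (hr.noiseL t)) = 0 := by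
  refine inner_mode_eq_zero _ fun i => hr.inner_noiseL t i (Measurable.mono hZ ?_ le_rfl)
  refine sup_le_sup (sampleAlg_mono ξ fun a ha h => ?_) le_rfl
  rw [Set.mem_singleton_iff.mp h] at ha
  exact lt_irrefl t ha

/-- The average noise is orthogonal to both gradients. Polarizing ⟨a, m⟩, with a the gradient at the
average iterate and m the averaged local gradient, gives -(η/2)‖m‖², which absorbs the quadratic
term because ηL ≤ 1, and leaves ‖m - a‖², which is a disagreement term. -/
theorem meanObjective_succ_le (hr : IsRun W f fLow L g ν comp C μ ξ ρ xinit hinit α γ η σ x)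
    (hB : IsModeBasis W O lam j₀ lam₂) (hn : 0 < n) (hL : 0 ≤ L) (hη : 0 ≤ η) (hηL : η * L ≤ 1)
    (t : ℕ) : hr.meanObjective (t + 1) ≤ hr.meanObjective t - η / 2 * ‖avg (hr.gradAvgL t)‖ ^ 2
      + η / 2 * (L ^ 2 / n * ∑ i, ‖hr.iterL t i - avg (hr.iterL t)‖ ^ 2)
      + L / 2 * (η ^ 2 * (σ ^ 2 / n)) := by
  have hn' : (0 : ℝ) < n := by exact_mod_cast hn
  set X := avg (hr.iterL t) with hX
  set a := avg (hr.gradAvgL t) with ha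
  set m := avg (hr.gradL t) with hm
  set z := avg (hr.noiseL t) with hz
  set v : SqInt μ p := -(η • (m + z)) with hv
  have hXs : avg (hr.iterL (t + 1)) = X + v := by
    rw [hr.avg_iterL_succ hB, sub_eq_add_neg]
  have h1 : hr.meanObjective (t + 1) ≤ hr.meanObjective t + inner ℝ a v + L / 2 * ‖v‖ ^ 2 := by
    have hi := hr.integrable_objective hn t
    have hin : Integrable (fun ω => inner ℝ (a.1 ω) (v.1 ω)) μ := integrable_inner_of_memLp a.2 v.2
    have hsq := (SqInt.integrable_norm_sq v).const_mul (L / 2)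
    have hmono := integral_mono (hr.integrable_objective hn (t + 1)) ((hi.add hin).add hsq)
      fun ω => by
        have := hr.smooth.avgObjective_descent hn (X.1 ω) (v.1 ω)
        rw [← hr.avg_gradAvgL_apply] at this
        rw [hXs]
        exact this
    rw [integral_add' (hi.add hin) hsq, integral_add' hi hin, integral_const_mul] at hmono
    rw [SqInt.norm_sq, SqInt.inner_def]
    exact hmono
  have hiter : ∀ i, hr.iterL t i ∈ _ := hr.iterL_mem t
  have haz : inner ℝ a z = 0 := hr.inner_avg_noiseL t
    (mode_mem _ fun i => hr.gradAvgL_mem t i (mode_mem _ hiter))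
  have hmz : inner ℝ m z = 0 := hr.inner_avg_noiseL t
    (mode_mem _ fun i => hr.gradL_mem t i (hiter i))
  have h2 : inner ℝ a v = -(η * inner ℝ a m) := by
    rw [hv, inner_neg_right, inner_smul_right, inner_add_right, haz, add_zero]
  have h3 : ‖v‖ ^ 2 = η ^ 2 * (‖m‖ ^ 2 + ‖z‖ ^ 2) := by
    rw [hv, norm_neg, norm_smul_sq, norm_add_sq_of_inner_eq_zero hmz]
  have h4 : ‖z‖ ^ 2 ≤ σ ^ 2 / n := by
    rw [le_div_iff₀ hn', mul_comm]
    exact norm_avg_sq_le_of_orthogonal hn (hr.norm_noiseL_sq_le t) (hr.inner_noiseL_noiseL t)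
  have h5 : ‖m - a‖ ^ 2 ≤ L ^ 2 / n * ∑ i, ‖hr.iterL t i - X‖ ^ 2 := by
    have e1 := norm_avg_sq_le (hr.gradL t - hr.gradAvgL t)
    have e2 : ∑ i, ‖(hr.gradL t - hr.gradAvgL t) i‖ ^ 2
        ≤ L ^ 2 * ∑ i, ‖hr.iterL t i - X‖ ^ 2 := by
      rw [Finset.mul_sum]
      exact Finset.sum_le_sum fun i _ => hr.norm_gradL_sub_gradAvgL_sq_le t i
    rw [map_sub] at e1
    rw [div_mul_eq_mul_div, le_div_iff₀ hn', mul_comm]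
    exact e1.trans e2
  have h6 := norm_sub_sq_real m a
  rw [real_inner_comm] at h6
  rw [h2, h3] at h1
  have h7 : L / 2 * (η ^ 2 * (‖m‖ ^ 2 + ‖z‖ ^ 2))
      ≤ η / 2 * ‖m‖ ^ 2 + L / 2 * (η ^ 2 * (σ ^ 2 / n)) := by
    have e1 : L / 2 * (η ^ 2 * ‖z‖ ^ 2) ≤ L / 2 * (η ^ 2 * (σ ^ 2 / n)) := by gcongr
    have e2 : η * L * (η / 2 * ‖m‖ ^ 2) ≤ 1 * (η / 2 * ‖m‖ ^ 2) := by gcongr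
    linarith
  have h8 := mul_le_mul_of_nonneg_left h5 (by positivity : 0 ≤ η / 2)
  have h9 : η * inner ℝ a m = η / 2 * ‖m‖ ^ 2 + η / 2 * ‖a‖ ^ 2 - η / 2 * ‖m - a‖ ^ 2 := by
    rw [h6]; ring
  linarith

theorem norm_sq_of_const {X : SqInt μ p} {c : Vec p}
    (h : ∀ ω, X.1 ω = c) : ‖X‖ ^ 2 = ‖c‖ ^ 2 := by
  rw [SqInt.norm_sq]
  simp [h]

theorem sum_iterL_one_le (hr : IsRun W f fLow L g ν comp C μ ξ ρ xinit hinit α γ η σ x) :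
    ∑ i, ‖hr.iterL 1 i‖ ^ 2 ≤ 2 * sqNorm xinit
      + 2 * (η ^ 2 * sqNorm fun i => gradient (f i) (xinit i)) + η ^ 2 * (n * σ ^ 2) := by
  have step : ∀ i, ‖hr.iterL 1 i‖ ^ 2 ≤ 2 * ‖xinit i‖ ^ 2
      + 2 * (η ^ 2 * ‖gradient (f i) (xinit i)‖ ^ 2) + η ^ 2 * σ ^ 2 := by
    intro i
    have e1 : hr.iterL 1 i = (hr.iterL 0 i - η • hr.gradL 0 i) - η • hr.noiseL 0 i := by
      refine Subtype.ext (funext fun ω => ?_)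
      change x 1 i ω = x 0 i ω - η • gradient (f i) (x 0 i ω) - η • gradNoise f g ξ x 0 i ω
      rw [sub_sub, ← smul_add, gradNoise, add_sub_cancel, hr.x_zero, hr.x_succ]
      rfl
    have e2 : inner ℝ (hr.iterL 0 i - η • hr.gradL 0 i) (η • hr.noiseL 0 i) = 0 := by
      rw [inner_smul_right, hr.inner_noiseL 0 i, mul_zero]
      have hc : (hr.iterL 0 i - η • hr.gradL 0 i).1
          = fun _ => xinit i - η • gradient (f i) (xinit i) := by
        funext ω
        change x 0 i ω - η • gradient (f i) (x 0 i ω) = _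
        rw [hr.x_zero]
      rw [hc]
      exact measurable_const
    have e3 := norm_sub_sq_le_two (hr.iterL 0 i) (η • hr.gradL 0 i)
    rw [norm_smul_sq, norm_sq_of_const (X := hr.iterL 0 i) (hr.x_zero i),
      norm_sq_of_const (X := hr.gradL 0 i) (c := gradient (f i) (xinit i))
        (fun ω => congrArg (gradient (f i)) (hr.x_zero i ω))] at e3
    rw [e1, norm_sub_sq_of_inner_eq_zero e2, norm_smul_sq]
    have e4 := mul_le_mul_of_nonneg_left (hr.norm_noiseL_sq_le 0 i) (sq_nonneg η)
    linarith
  refine (Finset.sum_le_sum fun i _ => step i).trans (le_of_eq ?_)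
  simp only [sqNorm, Finset.sum_add_distrib, ← Finset.mul_sum, Finset.sum_const, Finset.card_univ,
    Fintype.card_fin, nsmul_eq_mul]

theorem sum_gradAvgL_one_le (hr : IsRun W f fLow L g ν comp C μ ξ ρ xinit hinit α γ η σ x) :
    ∑ i, ‖hr.gradAvgL 1 i‖ ^ 2 ≤ 2 * (sqNorm fun i => gradient (f i) (xinit i))
      + 4 * (L ^ 2 * (∑ i, ‖hr.iterL 1 i‖ ^ 2 + sqNorm xinit)) := by
  have step : ∀ i, ‖hr.gradAvgL 1 i‖ ^ 2 ≤ 2 * ‖gradient (f i) (xinit i)‖ ^ 2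
      + 4 * (L ^ 2 * (‖avg (hr.iterL 1)‖ ^ 2 + ‖xinit i‖ ^ 2)) := by
    intro i
    have e0 : hr.gradAvgL 1 i = hr.gradL 0 i + (hr.gradAvgL 1 i - hr.gradL 0 i) := by abel
    have e1 := norm_add_sq_le_two (hr.gradL 0 i) (hr.gradAvgL 1 i - hr.gradL 0 i)
    rw [← e0] at e1
    have e2 : ‖hr.gradAvgL 1 i - hr.gradL 0 i‖ ^ 2
        ≤ L ^ 2 * ‖avg (hr.iterL 1) - hr.iterL 0 i‖ ^ 2 :=
      SqInt.norm_sq_le_of_pointwise fun _ => hr.smooth.lipschitz i _ _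
    have e3 := mul_le_mul_of_nonneg_left
      (norm_sub_sq_le_two (avg (hr.iterL 1)) (hr.iterL 0 i)) (sq_nonneg L)
    rw [norm_sq_of_const (X := hr.iterL 0 i) (hr.x_zero i)] at e3
    rw [norm_sq_of_const (X := hr.gradL 0 i) (c := gradient (f i) (xinit i))
        (fun ω => congrArg (gradient (f i)) (hr.x_zero i ω))] at e1
    linarith
  refine (Finset.sum_le_sum fun i _ => step i).trans ?_
  simp only [sqNorm, Finset.sum_add_distrib, ← Finset.mul_sum, Finset.sum_const, Finset.card_univ,
    Fintype.card_fin, nsmul_eq_mul]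
  have := norm_avg_sq_le (hr.iterL 1)
  gcongr

/-- Initially d = 0, so the dual part is η times the gradients at the first average, with weight at
most 1/b. The Lipschitz bound moves those gradients back to the starting points, at a price kept
below 1 by the stepsize condition. -/
theorem lyapunov_zero_le (hr : IsRun W f fLow L g ν comp C μ ξ ρ xinit hinit α γ η σ x)
    (hB : IsModeBasis W O lam j₀ lam₂)
    (hα0 : 0 < α) (hα1 : α ≤ 1) (hγ : 0 < γ) (hγ2 : γ ≤ 1 / 2) (hl : lam₂ < 1)
    (hl2 : 1 - lam₂ ≤ 2) (hγC : γ * C ≤ α ^ 2 * (1 - lam₂) / 1728)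
    (hη : η ^ 2 * L ^ 2 ≤ (γ / 2 * (1 - lam₂)) ^ 2 / 64) :
    hr.lyapunov O lam j₀ 0 ≤ 7 * sqNorm xinit + sqNorm hinit
      + 8 / (γ / 2 * (1 - lam₂)) * (η ^ 2 * sqNorm fun i => gradient (f i) (xinit i))
      + 3 * (η ^ 2 * (n * σ ^ 2)) := by
  set b := γ / 2 * (1 - lam₂) with hb
  have hb0 : 0 < b := mul_pos (by positivity) (by linarith)
  have hb1 : b ≤ 1 := by rw [hb]; nlinarith
  set Γ := sqNorm fun i => gradient (f i) (xinit i) with hΓ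
  have hΓ0 : 0 ≤ Γ := Finset.sum_nonneg fun _ _ => sq_nonneg _
  have hA1 := hr.sum_iterL_one_le
  have hG1 := hr.sum_gradAvgL_one_le
  set A := ∑ i, ‖hr.iterL 1 i‖ ^ 2 with hA
  have hA0 : 0 ≤ A := Finset.sum_nonneg fun _ _ => sq_nonneg _
  have hX0 : 0 ≤ sqNorm xinit := Finset.sum_nonneg fun _ _ => sq_nonneg _
  have hP : energy O lam j₀ γ η (hr.iterL 1) (hr.dualL 0) (hr.gradAvgL 1)
      ≤ A + 1 / b * (η ^ 2 * ∑ i, ‖hr.gradAvgL 1 i‖ ^ 2) := by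
    have hd : hr.dualL 0 = 0 := funext fun i => Subtype.ext (funext fun _ => rfl)
    have step : ∀ j ∈ Finset.univ.erase j₀, ‖mode (O j) (hr.iterL 1)‖ ^ 2
        + (1 - γ / 2 * (1 - lam j)) / (γ / 2 * (1 - lam j))
          * ‖mode (O j) (hr.dualL 0 + η • hr.gradAvgL 1)‖ ^ 2
        ≤ ‖mode (O j) (hr.iterL 1)‖ ^ 2
          + 1 / b * (η ^ 2 * ‖mode (O j) (hr.gradAvgL 1)‖ ^ 2) := by
      intro j hj
      obtain ⟨h1, h2⟩ := hB.laplace_eigenvalue_bounds hγ (Finset.ne_of_mem_erase hj)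
      rw [hd, zero_add, map_smul, norm_smul_sq]
      have h3 : (1 - γ / 2 * (1 - lam j)) / (γ / 2 * (1 - lam j)) ≤ 1 / b := by
        apply div_le_div₀ zero_le_one _ hb0 h1
        linarith
      gcongr
    refine (Finset.sum_le_sum step).trans ?_
    simp only [Finset.sum_add_distrib, ← Finset.mul_sum]
    have a1 := hB.sum_mode_le (hr.iterL 1)
    have a2 := hB.sum_mode_le (hr.gradAvgL 1)
    gcongr
  have hH : ∑ i, ‖hr.iterL 1 i - hr.refL 0 i‖ ^ 2 ≤ 2 * A + 2 * sqNorm hinit := by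
    rw [hA, sqNorm, Finset.mul_sum, Finset.mul_sum, ← Finset.sum_add_distrib]
    refine Finset.sum_le_sum fun i _ => ?_
    have := norm_sub_sq_le_two (hr.iterL 1 i) (hr.refL 0 i)
    rw [norm_sq_of_const (X := hr.refL 0 i) (c := hinit i) (fun _ => rfl)] at this
    exact this
  have hκ : 4 * (γ * C) / α ≤ 1 / 2 := by
    rw [div_le_iff₀ hα0]
    have h1 : α ^ 2 * (1 - lam₂) ≤ α * 2 := by
      have : α ^ 2 ≤ α := by rw [sq]; exact mul_le_of_le_one_left hα0.le hα1
      gcongr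
    linarith
  have hκH : 4 * (γ * C) / α * ∑ i, ‖hr.iterL 1 i - hr.refL 0 i‖ ^ 2
      ≤ 1 / 2 * (2 * A + 2 * sqNorm hinit) :=
    mul_le_mul hκ hH (Finset.sum_nonneg fun _ _ => sq_nonneg _) (by norm_num)
  have hG2 : 1 / b * (η ^ 2 * ∑ i, ‖hr.gradAvgL 1 i‖ ^ 2)
      ≤ 2 / b * (η ^ 2 * Γ) + (A + sqNorm xinit) := by
    have e1 : 1 / b * (η ^ 2 * ∑ i, ‖hr.gradAvgL 1 i‖ ^ 2)
        ≤ 1 / b * (η ^ 2 * (2 * Γ + 4 * (L ^ 2 * (A + sqNorm xinit)))) := by gcongr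
    have e2 : 4 / b * (η ^ 2 * L ^ 2) ≤ 1 := by
      calc 4 / b * (η ^ 2 * L ^ 2) ≤ 4 / b * (b ^ 2 / 64) := by gcongr
        _ = b / 16 := by field_simp; ring
        _ ≤ 1 := by linarith
    have e3 : 4 / b * (η ^ 2 * L ^ 2) * (A + sqNorm xinit) ≤ 1 * (A + sqNorm xinit) := by gcongr
    have e4 : 1 / b * (η ^ 2 * (2 * Γ + 4 * (L ^ 2 * (A + sqNorm xinit))))
        = 2 / b * (η ^ 2 * Γ) + 4 / b * (η ^ 2 * L ^ 2) * (A + sqNorm xinit) := by ring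
    linarith
  have hΓb : η ^ 2 * Γ ≤ 1 / b * (η ^ 2 * Γ) := by
    apply le_mul_of_one_le_left (by positivity)
    rw [le_div_iff₀ hb0]; linarith
  have e8 : 8 / b * (η ^ 2 * Γ) = 2 / b * (η ^ 2 * Γ) + 6 * (1 / b * (η ^ 2 * Γ)) := by ring
  have hlyap : hr.lyapunov O lam j₀ 0
      = energy O lam j₀ γ η (hr.iterL 1) (hr.dualL 0) (hr.gradAvgL 1)
        + 4 * (γ * C) / α * ∑ i, ‖hr.iterL 1 i - hr.refL 0 i‖ ^ 2 := rfl
  rw [hlyap, e8]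
  linarith

end IsRun


/-! ### From the two summed recursions to the rate. -/

/-- Gs is the sum of squared gradients, Ps the sum of energies and q = 1/√(nK). The bounds on Gs and
Ps are circular; eliminating Ps returns Gs with coefficient η²L²/b + o where o = 0, at most 1/2, and
moving it to the left doubles the other terms. Then η² = n/K and η/n = q produce the four rates. -/
theorem rate_arith {n K b q η L σ Δ A₀ H₀ Γ V₀ Gs Ps : ℝ} (hn : 1 ≤ n) (hK : 1 ≤ K) (hb : 0 < b)
    (hb1 : b ≤ 1) (hq : 0 < q) (hqK : q ^ 2 * (n * K) = 1) (hη : η = n * q) (hL : 0 ≤ L)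
    (hηL : η ^ 2 * L ^ 2 ≤ b ^ 2 / 64) (hA : 0 ≤ A₀) (hH : 0 ≤ H₀) (hG : 0 ≤ Gs)
    (h1 : η / 2 * Gs ≤ Δ + η / 2 * (L ^ 2 / n * (A₀ + Ps))
      + (K + 1) * (L / 2 * (η ^ 2 * (σ ^ 2 / n))))
    (h2 : b / 4 * Ps ≤ V₀ + 1 / 4 * (η ^ 2 * (n * Gs)) + K * (2 * (η ^ 2 * (n * σ ^ 2))))
    (h3 : V₀ ≤ 7 * A₀ + H₀ + 8 / b * (η ^ 2 * Γ) + 3 * (η ^ 2 * (n * σ ^ 2))) :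
    1 / K * Gs ≤ 4 * |Δ| * q + 4 * L * σ ^ 2 * q + 40 * L ^ 2 * σ ^ 2 * (n / (b * K))
      + 58 * L ^ 2 * ((A₀ + H₀) / (n * b * K)) + 64 * L ^ 2 * (Γ / (b ^ 2 * K ^ 2)) := by
  have hn0 : 0 < n := by linarith
  have hK0 : 0 < K := by linarith
  have hη0 : 0 < η := by rw [hη]; positivity
  have hη2 : η ^ 2 = n / K := by
    rw [eq_div_iff hK0.ne', hη]; linear_combination n * hqK
  have hqη : η * q * K = 1 := by rw [hη]; linear_combination hqK
  have hηn : η / n = q := by rw [hη]; field_simp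
  have e1 : Gs ≤ 2 * |Δ| / η + L ^ 2 / n * (A₀ + Ps) + (K + 1) * (L * σ ^ 2 * q) := by
    have f1 : 2 / η * (η / 2 * Gs) ≤ 2 / η * (|Δ| + η / 2 * (L ^ 2 / n * (A₀ + Ps))
      + (K + 1) * (L / 2 * (η ^ 2 * (σ ^ 2 / n)))) := by
      gcongr
      exact h1.trans (by gcongr; exact le_abs_self Δ)
    have f2 : 2 / η * (η / 2 * Gs) = Gs := by field_simp
    have f3 : 2 / η * (|Δ| + η / 2 * (L ^ 2 / n * (A₀ + Ps))
      + (K + 1) * (L / 2 * (η ^ 2 * (σ ^ 2 / n))))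
        = 2 * |Δ| / η + L ^ 2 / n * (A₀ + Ps) + (K + 1) * (L * σ ^ 2 * (η / n)) := by
      field_simp
    rw [f2, f3, hηn] at f1
    exact f1
  have e2 : L ^ 2 / n * Ps ≤ 4 * L ^ 2 / (n * b) * V₀ + 1 / 2 * Gs
      + K * (8 * L ^ 2 * σ ^ 2 * (η ^ 2 / b)) := by
    have f1 := mul_le_mul_of_nonneg_left h2 (by positivity : 0 ≤ 4 * L ^ 2 / (n * b))
    have f2 : 4 * L ^ 2 / (n * b) * (b / 4 * Ps) = L ^ 2 / n * Ps := by field_simp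
    have f3 : 4 * L ^ 2 / (n * b) * (V₀ + 1 / 4 * (η ^ 2 * (n * Gs))
        + K * (2 * (η ^ 2 * (n * σ ^ 2))))
        = 4 * L ^ 2 / (n * b) * V₀ + η ^ 2 * L ^ 2 / b * Gs
          + K * (8 * L ^ 2 * σ ^ 2 * (η ^ 2 / b)) := by
      field_simp
      ring
    have f4 : η ^ 2 * L ^ 2 / b ≤ 1 / 2 := by
      rw [div_le_iff₀ hb]; nlinarith
    have f5 := mul_le_mul_of_nonneg_right f4 hG
    rw [f2, f3] at f1
    linarith
  have e3 := mul_le_mul_of_nonneg_left h3 (by positivity : 0 ≤ 4 * L ^ 2 / (n * b))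
  have e4 : Gs ≤ 4 * |Δ| / η + 2 * (L ^ 2 / n * A₀)
      + 2 * (4 * L ^ 2 / (n * b)
        * (7 * A₀ + H₀ + 8 / b * (η ^ 2 * Γ) + 3 * (η ^ 2 * (n * σ ^ 2))))
      + K * (16 * L ^ 2 * σ ^ 2 * (η ^ 2 / b)) + K * (4 * (L * σ ^ 2 * q)) := by
    -- There are K + 1 gradient steps because the run starts at iteration -1.
    have f1 : (K + 1) * (L * σ ^ 2 * q) ≤ 2 * K * (L * σ ^ 2 * q) := by
      gcongr; linarith
    have f2 : 4 * |Δ| / η = 2 * (2 * |Δ| / η) := by ring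
    rw [f2]
    linarith
  have e5 : 1 / K * Gs ≤ 1 / K * (4 * |Δ| / η + 2 * (L ^ 2 / n * A₀)
      + 2 * (4 * L ^ 2 / (n * b)
        * (7 * A₀ + H₀ + 8 / b * (η ^ 2 * Γ) + 3 * (η ^ 2 * (n * σ ^ 2))))
      + K * (16 * L ^ 2 * σ ^ 2 * (η ^ 2 / b)) + K * (4 * (L * σ ^ 2 * q))) := by gcongr
  have g1 : 1 / K * (4 * |Δ| / η) = 4 * |Δ| * q := by
    have : 1 / (K * η) = q := by rw [div_eq_iff (by positivity)]; linear_combination -hqη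
    rw [← this]; field_simp
  have g2 : 1 / K * (2 * (L ^ 2 / n * A₀)) ≤ 2 * L ^ 2 * (A₀ / (n * b * K)) := by
    have : 1 / K * (2 * (L ^ 2 / n * A₀)) = 2 * L ^ 2 * (A₀ / (n * 1 * K)) := by field_simp
    rw [this]
    gcongr
  have g3 : 1 / K * (2 * (4 * L ^ 2 / (n * b)
        * (7 * A₀ + H₀ + 8 / b * (η ^ 2 * Γ) + 3 * (η ^ 2 * (n * σ ^ 2)))))
      = 56 * L ^ 2 * (A₀ / (n * b * K)) + 8 * L ^ 2 * (H₀ / (n * b * K))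
        + 64 * L ^ 2 * (Γ / (b ^ 2 * K ^ 2)) + 24 * L ^ 2 * σ ^ 2 * (n / (b * K)) * (1 / K) := by
    rw [hη2]
    field_simp
    ring
  have g4 : 24 * L ^ 2 * σ ^ 2 * (n / (b * K)) * (1 / K)
      ≤ 24 * L ^ 2 * σ ^ 2 * (n / (b * K)) := by
    apply mul_le_of_le_one_right (by positivity)
    rw [div_le_one hK0]; exact hK
  have g5 : 1 / K * (K * (16 * L ^ 2 * σ ^ 2 * (η ^ 2 / b)))
      = 16 * L ^ 2 * σ ^ 2 * (n / (b * K)) := by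
    rw [hη2]; field_simp
  have g6 : 1 / K * (K * (4 * (L * σ ^ 2 * q))) = 4 * L * σ ^ 2 * q := by field_simp
  have g7 : 0 ≤ 50 * L ^ 2 * (H₀ / (n * b * K)) := by positivity
  have g8 : (A₀ + H₀) / (n * b * K) = A₀ / (n * b * K) + H₀ / (n * b * K) := add_div _ _ _
  rw [mul_add, mul_add, mul_add, mul_add, g1, g3, g5, g6] at e5
  rw [g8]
  linarith

/-! ### Telescoping the two recursions. -/

namespace IsRun

variable {n p : ℕ} {Ω Ξ R : Type*} [MeasurableSpace Ξ] [MeasurableSpace R]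
  {mΩ : MeasurableSpace Ω}
  {W : Matrix (Fin n) (Fin n) ℝ} {f : Fin n → Vec p → ℝ} {fLow : Fin n → ℝ} {L : ℝ}
  {g : Fin n → Vec p → Ξ → Vec p} {ν : Measure R} {comp : Vec p → R → Vec p} {C : ℝ}
  {μ : Measure Ω} [IsProbabilityMeasure μ] {ξ : ℕ → Fin n → Ω → Ξ} {ρ : ℕ → Fin n → Ω → R}
  {xinit hinit : Fin n → Vec p} {α γ η σ : ℝ} {x : ℕ → Fin n → Ω → Vec p}
  {O : Matrix (Fin n) (Fin n) ℝ} {lam : Fin n → ℝ} {j₀ : Fin n} {lam₂ : ℝ}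

theorem sum_energy_le (hr : IsRun W f fLow L g ν comp C μ ξ ρ xinit hinit α γ η σ x)
    (hB : IsModeBasis W O lam j₀ lam₂)
    (hα0 : 0 < α) (hα1 : α ≤ 1) (hC : 0 < C) (hαC : α * C ≤ 1 / 12) (hγ : 0 < γ) (hγ2 : γ ≤ 1 / 2)
    (hl : lam₂ < 1) (hn : 2 ≤ n) (hγC : γ * C ≤ α ^ 2 * (1 - lam₂) / 1728)
    (hη : η ^ 2 * L ^ 2 ≤ (γ / 2 * (1 - lam₂)) ^ 2 / 64) (K : ℕ) :
    γ / 2 * (1 - lam₂) / 4 * ∑ k ∈ Finset.range K,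
        energy O lam j₀ γ η (hr.iterL (k + 1)) (hr.dualL k) (hr.gradAvgL (k + 1))
      ≤ hr.lyapunov O lam j₀ 0
        + 1 / 4 * (η ^ 2 * (n * ∑ t ∈ Finset.range (K + 1), ‖avg (hr.gradAvgL t)‖ ^ 2))
        + K * (2 * (η ^ 2 * (n * σ ^ 2))) := by
  have hV0 : ∀ k, 0 ≤ hr.lyapunov O lam j₀ k := fun k =>
    add_nonneg (hB.energy_nonneg hγ hγ2 hl _ _ _)
      (mul_nonneg (by positivity) (Finset.sum_nonneg fun _ _ => sq_nonneg _))
  have key : hr.lyapunov O lam j₀ K + γ / 2 * (1 - lam₂) / 4 * ∑ k ∈ Finset.range K,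
        energy O lam j₀ γ η (hr.iterL (k + 1)) (hr.dualL k) (hr.gradAvgL (k + 1))
      ≤ hr.lyapunov O lam j₀ 0
        + 1 / 4 * (η ^ 2 * (n * ∑ k ∈ Finset.range K, ‖avg (hr.gradAvgL (k + 1))‖ ^ 2))
        + K * (2 * (η ^ 2 * (n * σ ^ 2))) := by
    induction K with
    | zero => simp
    | succ K ih =>
      have h1 := hr.lyapunov_succ_le hB hα0 hα1 hC hαC hγ hγ2 hl hn hγC hη K
      rw [Finset.sum_range_succ, Finset.sum_range_succ]
      push_cast
      linarith
  -- The Lyapunov recursion starts after initialization; adding the gradient at the starting point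
  -- matches the range of the descent inequality.
  have hG : ∑ k ∈ Finset.range K, ‖avg (hr.gradAvgL (k + 1))‖ ^ 2
      ≤ ∑ t ∈ Finset.range (K + 1), ‖avg (hr.gradAvgL t)‖ ^ 2 := by
    rw [Finset.sum_range_succ']
    exact le_add_of_nonneg_right (sq_nonneg _)
  have h2 : 1 / 4 * (η ^ 2 * (n * ∑ k ∈ Finset.range K, ‖avg (hr.gradAvgL (k + 1))‖ ^ 2))
      ≤ 1 / 4 * (η ^ 2 * (n * ∑ t ∈ Finset.range (K + 1), ‖avg (hr.gradAvgL t)‖ ^ 2)) := by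
    gcongr
  have := hV0 K
  linarith

theorem sum_gradient_le (hr : IsRun W f fLow L g ν comp C μ ξ ρ xinit hinit α γ η σ x)
    (hB : IsModeBasis W O lam j₀ lam₂) (hγ : 0 < γ) (hγ2 : γ ≤ 1 / 2)
    (hl : lam₂ < 1) (hn : 0 < n) (hL : 0 ≤ L) (hη : 0 ≤ η) (hηL : η * L ≤ 1) (K : ℕ) :
    η / 2 * ∑ t ∈ Finset.range (K + 1), ‖avg (hr.gradAvgL t)‖ ^ 2
      ≤ avgObjective f (mean xinit) - (1 / (n : ℝ)) * ∑ i, fLow i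
        + η / 2 * (L ^ 2 / n * (sqNorm xinit + ∑ k ∈ Finset.range K,
          energy O lam j₀ γ η (hr.iterL (k + 1)) (hr.dualL k) (hr.gradAvgL (k + 1))))
        + (K + 1) * (L / 2 * (η ^ 2 * (σ ^ 2 / n))) := by
  -- The starting point has no energy term, so its disagreement is charged to the initial norm.
  have h0 : ∑ i, ‖hr.iterL 0 i - avg (hr.iterL 0)‖ ^ 2 ≤ sqNorm xinit := by
    rw [hB.sum_sub_avg]
    refine (hB.sum_mode_le _).trans (le_of_eq ?_)
    exact Finset.sum_congr rfl fun i _ => norm_sq_of_const (hr.x_zero i)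
  have hk : ∀ k, ∑ i, ‖hr.iterL (k + 1) i - avg (hr.iterL (k + 1))‖ ^ 2
      ≤ energy O lam j₀ γ η (hr.iterL (k + 1)) (hr.dualL k) (hr.gradAvgL (k + 1)) := fun k => by
    rw [hB.sum_sub_avg]
    exact hB.sum_mode_le_energy hγ hγ2 hl _ _ _
  have key : hr.meanObjective (K + 1)
      + η / 2 * ∑ t ∈ Finset.range (K + 1), ‖avg (hr.gradAvgL t)‖ ^ 2
      ≤ hr.meanObjective 0 + η / 2 * (L ^ 2 / n * (sqNorm xinit + ∑ k ∈ Finset.range K,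
          energy O lam j₀ γ η (hr.iterL (k + 1)) (hr.dualL k) (hr.gradAvgL (k + 1))))
        + (K + 1) * (L / 2 * (η ^ 2 * (σ ^ 2 / n))) := by
    induction K with
    | zero =>
      have h1 := hr.meanObjective_succ_le hB hn hL hη hηL 0
      have h2 : η / 2 * (L ^ 2 / n * ∑ i, ‖hr.iterL 0 i - avg (hr.iterL 0)‖ ^ 2)
        ≤ η / 2 * (L ^ 2 / n * sqNorm xinit) := by gcongr
      simp only [zero_add, Finset.sum_range_one, Finset.range_zero, Finset.sum_empty, add_zero,
        Nat.cast_zero] at h1 ⊢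
      linarith
    | succ K ih =>
      have h1 := hr.meanObjective_succ_le hB hn hL hη hηL (K + 1)
      have h2 : η / 2 * (L ^ 2 / n * ∑ i, ‖hr.iterL (K + 1) i - avg (hr.iterL (K + 1))‖ ^ 2)
        ≤ η / 2 * (L ^ 2 / n * energy O lam j₀ γ η (hr.iterL (K + 1)) (hr.dualL K)
          (hr.gradAvgL (K + 1))) := by
        have := hk K
        gcongr
      simp only [Finset.sum_range_succ] at ih ⊢
      push_cast
      linarith
  have hlow := hr.le_meanObjective hn (K + 1)
  rw [hr.meanObjective_zero] at key
  linarith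

end IsRun

end CEDAS

/-! ### The convergence theorem. -/

theorem corollary3 :
    ∀ L σ Δ : ℝ, 0 ≤ L → 0 < σ →
    -- the constant in the `O`-bound depends only on `L`, `σ` and `Δ`
    ∃ M : ℝ,
    ∀ (n p : ℕ) (hn : 2 ≤ n)
      -- network and mixing matrix
      (G : SimpleGraph (Fin n)) (W : Matrix (Fin n) (Fin n) ℝ) (hW : CEDAS.IsMixingMatrix G W)
      -- local objective functions and their stochastic gradient oracles
      (f : Fin n → CEDAS.Vec p → ℝ) (fLow : Fin n → ℝ) (_hf : CEDAS.IsSmoothBddBelow f L fLow)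
      (Ξ : Type*) [MeasurableSpace Ξ] (g : Fin n → CEDAS.Vec p → Ξ → CEDAS.Vec p)
      -- unbiased compressor
      (R : Type*) [MeasurableSpace R] (ν : Measure R) (comp : CEDAS.Vec p → R → CEDAS.Vec p)
      (C : ℝ) (_hC : 0 < C) (_hcomp : CEDAS.IsUnbiasedCompressor comp ν C)
      -- randomness of the run
      (Ω : Type*) [MeasurableSpace Ω] (μ : Measure Ω) [IsProbabilityMeasure μ]
      (ξ : ℕ → Fin n → Ω → Ξ) (ρ : ℕ → Fin n → Ω → R)
      (_hrand : CEDAS.IsFreshRandomness μ ν ξ ρ)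
      -- initial values `x_{-1}` and `H_0`
      (xinit hinit : Fin n → CEDAS.Vec p)
      (_hΔ : CEDAS.avgObjective f (CEDAS.mean xinit) - (1 / (n : ℝ)) * ∑ i, fLow i ≤ Δ)
      -- parameters
      (α γ η : ℝ) (K : ℕ)
      (_hα0 : 0 < α) (_hα1 : α ≤ 1) (_hα : α ≤ 1 / (12 * C))
      (_hγ0 : 0 < γ)
      (_hγ : γ ≤ min (√α / (2 * √C)) (min (1 / 2) (α ^ 2 * (1 - hW.lambda₂ hn) / (1728 * C))))
      (_hη : η = √((n : ℝ) / (K : ℝ)))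
      (_hK0 : 0 < K)
      (_hK : max (12 * L ^ 2 * n / α) (256 * n * L ^ 2 / (γ ^ 2 * (1 - hW.lambda₂ hn) ^ 2))
        ≤ (K : ℝ))
      -- the iterates: `x t i` is the random vector `x_{i,t-1}`
      (x : ℕ → Fin n → Ω → CEDAS.Vec p)
      (_hx : ∀ t i ω, x t i ω = CEDAS.iterate W g comp η γ α xinit hinit
        (fun t i => ξ t i ω) (fun k i => ρ k i ω) t i)
      (_hg : CEDAS.IsStochasticGradient μ f g ξ x σ),
      (∀ t ≤ K, Integrable
        (fun ω => ‖gradient (CEDAS.avgObjective f) (CEDAS.mean fun i => x t i ω)‖ ^ 2) μ) ∧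
      (1 / (K : ℝ)) * ∑ t ∈ Finset.range (K + 1),
          ∫ ω, ‖gradient (CEDAS.avgObjective f) (CEDAS.mean fun i => x t i ω)‖ ^ 2 ∂μ
        ≤ M * (1 / √((n : ℝ) * K)
          + n / ((1 - hW.tlambda₂ hn γ) * K)
          + (CEDAS.sqNorm xinit + CEDAS.sqNorm hinit) / (n * (1 - hW.tlambda₂ hn γ) * K)
          + CEDAS.sqNorm (fun i => gradient (f i) (xinit i))
              / ((1 - hW.tlambda₂ hn γ) ^ 2 * (K : ℝ) ^ 2)) := by
  intro L σ Δ hL hσ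
  -- A sum dominating each coefficient in `rate_arith`; the last summand covers both 58L² and 64L².
  refine ⟨4 * |Δ| + 4 * L * σ ^ 2 + 40 * L ^ 2 * σ ^ 2 + 64 * L ^ 2, ?_⟩
  intro n p hn G W hW f fLow hf Ξ _ g R _ ν comp C hC hcomp Ω _ μ _ ξ ρ hrand xinit hinit hΔ α γ η K
    hα0 hα1 hα hγ0 hγ hη hK0 hK x hx hg
  have hr : CEDAS.IsRun W f fLow L g ν comp C μ ξ ρ xinit hinit α γ η σ x :=
    ⟨hf, hcomp, hrand, hx, hg⟩
  have hγ2 : γ ≤ 1 / 2 := hγ.trans ((min_le_right _ _).trans (min_le_left _ _))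
  have hγ3 : γ ≤ α ^ 2 * (1 - hW.lambda₂ hn) / (1728 * C) :=
    hγ.trans ((min_le_right _ _).trans (min_le_right _ _))
  have hαC : α * C ≤ 1 / 12 := by
    rw [le_div_iff₀ (by positivity)] at hα; linarith
  have hγC : γ * C ≤ α ^ 2 * (1 - hW.lambda₂ hn) / 1728 := by
    rw [le_div_iff₀ (by positivity)] at hγ3; linarith
  -- The spectral gap is read off from the stepsize condition: a positive γ below a multiple of 1 -
  -- λ₂ forces λ₂ < 1.
  have hl : hW.lambda₂ hn < 1 := by
    by_contra h
    have h1 : 0 < γ * C := by positivity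
    have h2 : α ^ 2 * (1 - hW.lambda₂ hn) ≤ 0 :=
      mul_nonpos_of_nonneg_of_nonpos (sq_nonneg _) (by linarith)
    linarith
  obtain ⟨O, lam, j₀, hB⟩ := hW.exists_isModeBasis hn hl
  have hl2 : 1 - hW.lambda₂ hn ≤ 2 := by
    have : Nontrivial (Fin n) := Fin.nontrivial_iff_two_le.mpr hn
    obtain ⟨j, hj⟩ := exists_ne j₀
    have := hB.le_lam₂ j hj
    have := hB.neg_one_le j
    linarith
  have hn0 : (0 : ℝ) < n := by exact_mod_cast (by omega : 0 < n)
  have hK0' : (0 : ℝ) < K := by exact_mod_cast hK0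
  have hη2 : η ^ 2 = n / K := by rw [hη, Real.sq_sqrt (by positivity)]
  have hη0 : 0 ≤ η := by rw [hη]; exact Real.sqrt_nonneg _
  have hbt : 1 - hW.tlambda₂ hn γ = γ / 2 * (1 - hW.lambda₂ hn) := by
    rw [CEDAS.IsMixingMatrix.tlambda₂]; ring
  rw [hbt]
  have hb0 : 0 < γ / 2 * (1 - hW.lambda₂ hn) := mul_pos (by positivity) (by linarith)
  have hb1 : γ / 2 * (1 - hW.lambda₂ hn) ≤ 1 := by nlinarith
  -- This is the second lower bound on K, with 256 = 4 · 64.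
  have hηL : η ^ 2 * L ^ 2 ≤ (γ / 2 * (1 - hW.lambda₂ hn)) ^ 2 / 64 := by
    have hl0 : 0 < 1 - hW.lambda₂ hn := by linarith
    have h1 := (le_max_right _ _).trans hK
    rw [div_le_iff₀ (by positivity)] at h1
    rw [hη2, div_mul_eq_mul_div, div_le_iff₀ hK0']
    linarith
  have hηL1 : η * L ≤ 1 := by
    have h1 : (η * L) ^ 2 ≤ 1 := by
      rw [mul_pow]
      have := pow_le_one₀ (n := 2) hb0.le hb1
      linarith
    exact (abs_le_one_iff_mul_self_le_one.mpr (by rw [← sq]; exact h1)).trans' (le_abs_self _)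
  have hint : ∀ t, (fun ω => ‖gradient (CEDAS.avgObjective f)
      (CEDAS.mean fun i => x t i ω)‖ ^ 2) = fun ω => ‖(CEDAS.avg (hr.gradAvgL t)).1 ω‖ ^ 2 :=
    fun t => funext fun ω => by rw [hr.gradient_mean_eq]
  refine ⟨fun t _ => by rw [hint]; exact CEDAS.SqInt.integrable_norm_sq _, ?_⟩
  simp_rw [hint, ← CEDAS.SqInt.norm_sq]
  have hX0 : 0 ≤ CEDAS.sqNorm xinit := Finset.sum_nonneg fun _ _ => sq_nonneg _
  have hH0 : 0 ≤ CEDAS.sqNorm hinit := Finset.sum_nonneg fun _ _ => sq_nonneg _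
  have hΓ0 : 0 ≤ CEDAS.sqNorm (fun i => gradient (f i) (xinit i)) :=
    Finset.sum_nonneg fun _ _ => sq_nonneg _
  have hq : (1 / √((n : ℝ) * K)) ^ 2 * (n * K) = 1 := by
    rw [div_pow, Real.sq_sqrt (by positivity)]; field_simp
  have hηq : η = n * (1 / √((n : ℝ) * K)) := by
    rw [hη, Real.sqrt_eq_iff_mul_self_eq (by positivity) (by positivity), ← sq, mul_pow,
      div_eq_iff hK0'.ne']
    linear_combination -(n : ℝ) * hq
  have h1 := hr.sum_gradient_le hB hγ0 hγ2 hl (by omega) hL hη0 hηL1 K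
  have h2 := hr.sum_energy_le hB hα0 hα1 hC hαC hγ0 hγ2 hl hn hγC hηL K
  have h3 := hr.lyapunov_zero_le hB hα0 hα1 hγ0 hγ2 hl hl2 hγC hηL
  have key := CEDAS.rate_arith (Δ := Δ) (by exact_mod_cast (by omega : 1 ≤ n))
    (by exact_mod_cast hK0) hb0 hb1 (by positivity) hq hηq hL hηL hX0 hH0
    (Finset.sum_nonneg fun _ _ => sq_nonneg _) (h1.trans (by gcongr)) h2 h3
  refine key.trans ?_
  set q := 1 / √((n : ℝ) * K)
  set b := γ / 2 * (1 - hW.lambda₂ hn)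
  have t1 : 0 ≤ q := by positivity
  have t2 : 0 ≤ (n : ℝ) / (b * K) := by positivity
  have t3 : 0 ≤ (CEDAS.sqNorm xinit + CEDAS.sqNorm hinit) / (n * b * K) := by positivity
  have t4 : 0 ≤ CEDAS.sqNorm (fun i => gradient (f i) (xinit i)) / (b ^ 2 * (K : ℝ) ^ 2) := by
    positivity
  have m1 : 0 ≤ |Δ| := abs_nonneg Δ
  have m2 : 0 ≤ L * σ ^ 2 := by positivity
  have m3 : 0 ≤ L ^ 2 * σ ^ 2 := by positivity
  have m4 : 0 ≤ L ^ 2 := by positivity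
  have b1 : (4 * |Δ| + 4 * L * σ ^ 2) * q
      ≤ (4 * |Δ| + 4 * L * σ ^ 2 + 40 * L ^ 2 * σ ^ 2 + 64 * L ^ 2) * q :=
    mul_le_mul_of_nonneg_right (by linarith) t1
  have b2 := mul_le_mul_of_nonneg_right (by linarith : 40 * L ^ 2 * σ ^ 2
    ≤ 4 * |Δ| + 4 * L * σ ^ 2 + 40 * L ^ 2 * σ ^ 2 + 64 * L ^ 2) t2
  have b3 := mul_le_mul_of_nonneg_right (by linarith : 58 * L ^ 2
    ≤ 4 * |Δ| + 4 * L * σ ^ 2 + 40 * L ^ 2 * σ ^ 2 + 64 * L ^ 2) t3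
  have b4 := mul_le_mul_of_nonneg_right (by linarith : 64 * L ^ 2
    ≤ 4 * |Δ| + 4 * L * σ ^ 2 + 40 * L ^ 2 * σ ^ 2 + 64 * L ^ 2) t4
  rw [mul_add, mul_add, mul_add]
  linarith
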